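/- Let $P$ be a smooth manifold (Hausdorff, $\sigma$-compact, finite-dimensional, without boundary), $g$ a Riemannian metric on $P$, $B\in\Omega^2(P)$, $H\in\Omega^3(P)$ (not necessarily closed) and $\Lambda\in\mathbb{R}$. Let $E=TP\oplus T^*P$ with anchor $\rho(X,\xi)=X$, pairing $\langle (X,\xi),(Y,\eta)\rangle_E=\eta(X)+\xi(Y)$ and the $H$-twisted Dorfman bracket $$[(X,\xi),(Y,\eta)]_E=\big([X,Y],\ \mathcal{L}_X\eta-i_Yd\xi-H(X,Y,\cdot)\big).$$ Let $\mathbf{G}=\begin{pmatrix} g-Bg^{-1}B & Bg^{-1}\\ -g^{-1}B & g^{-1}\end{pmatrix}$ be the generalized metric of $(g,B)$, where $B$ is viewed as the map $TP\to T^*P$, $B(Y)=B(\cdot,Y)$; let $\tau$ be the involution of $E$ with $\mathbf{G}(\psi,\psi')=\langle\psi,\tau\psi'\rangle_E$, and let $V_\pm$ be its $\pm1$ eigenbundles. A connection on $E$ is an $\mathbb{R}$-bilinear $\nabla:\Gamma(E)\times\Gamma(E)\to\Gamma(E)$ with $\nabla_{f\psi}\psi'=f\nabla_\psi\psi'$,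 $\nabla_\psi(f\psi')=f\nabla_\psi\psi'+(\rho(\psi).f)\psi'$ and $\rho(\psi).\langle\psi',\psi''\rangle_E=\langle\nabla_\psi\psi',\psi''\rangle_E+\langle\psi',\nabla_\psi\psi''\rangle_E$. It is Levi-Civita with respect to $\mathbf{G}$ if $\nabla\mathbf{G}=0$ and $$\langle\nabla_\psi\psi'-\nabla_{\psi'}\psi-[\psi,\psi']_E,\psi''\rangle_E+\langle\nabla_{\psi''}\psi,\psi'\rangle_E=0$$ for all sections. Let $\{\psi_\lambda\}$ be any local frame of $E$, $\{\psi^\lambda\}$ the dual frame of $E^*$, and $\{\psi_E^\lambda\}$ the frame of $E$ with $\langle\psi_\lambda,\psi_E^\kappa\rangle_E=\delta_\lambda^\kappa$. The curvature of $\nabla$ is $$R(\chi',\chi,\psi,\psi')=\tfrac12\{R^{(0)}(\chi',\chi,\psi,\psi')+R^{(0)}(\psi',\psi,\chi,\chi')+\langle\nabla_{\psi_\lambda}\psi,\psi'\rangle_E\langle\nabla_{\psi^\lambda_E}\chi,\chi'\rangle_E\},$$ $$R^{(0)}(\chi',\chi,\psi,\psi')=\langle\chi',([\nabla_\psi,\nabla_{\psi'}]-\nabla_{[\psi,\psi']_E})\chi\rangle_E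 ,$$ and $\mathrm{Ric}(\psi,\psi')=R(\psi_E^\lambda,\psi',\psi_\lambda,\psi)$, $\mathcal{R}_E=\mathrm{Ric}(\psi^\lambda_E,\psi_\lambda)$, $\mathcal{R}_{\mathbf{G}}=\mathrm{Ric}(\mathbf{G}^{-1}(\psi^\lambda),\psi_\lambda)$. The connection is Ricci compatible with $\mathbf{G}$ if $\mathrm{Ric}(V_+,V_-)=0$. Its divergence is $\mathrm{Div}_\nabla(\psi)=\langle\nabla_{\psi_\lambda}\psi,\psi^\lambda_E\rangle_E$, and its characteristic vector field is defined by $X_\nabla.f=\mathrm{Div}_\nabla(0,df)$. For $\phi\in C^\infty(P)$ put $H'=H+dB$ and, with $\nabla^{LC}$, $\mathrm{Ric}^{LC}$ and $\mathcal{R}(g)$ the Levi-Civita connection, Ricci tensor and scalar curvature of $g$, $\langle\cdot,\cdot\rangle_g$ the scalar product of $p$-forms given by $\alpha\wedge\ast\beta=\langle\alpha,\beta\rangle_g\,d\mathrm{vol}_g$, $\delta_g$ the codifferential (the formal adjoint of $d$) and $\Delta_g=-\delta_gd$ on functions, $$\beta_g(X,Y)=\mathrm{Ric}^{LC}(X,Y)-\tfrac12\langle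 i_XH',i_YH'\rangle_g+(\nabla^{LC}_Xd\phi)(Y)+(\nabla^{LC}_Yd\phi)(X),$$ $$\beta_B=\tfrac12e^{2\phi}\delta_g(e^{-2\phi}H'),\qquad \beta_\phi=\mathcal{R}(g)-\tfrac12\langle H',H'\rangle_g+4\Delta_g\phi-4\langle d\phi,d\phi\rangle_g-2\Lambda.$$ **Theorem.** Let $\nabla$ be a Levi-Civita connection on $E$ with respect to $\mathbf{G}$ such that $X_\nabla=0$, and let $\phi\in C^\infty(P)$ satisfy $$d\phi(Z)=\langle\nabla_{(0,e^k)}(0,g(e_k)),(0,g(Z))\rangle_E$$ for all vector fields $Z$, where $\{e_k\}$ is a local frame of $TP$ with dual coframe $\{e^k\}$. Then: 1. $\beta_g=\beta_B=\beta_\phi=0$ if and only if $\mathcal{R}_{\mathbf{G}}=2\Lambda$ and $\nabla$ is Ricci compatible with $\mathbf{G}$; 2. $\nabla$ is Ricci compatible with $\mathbf{G}$ if and only if $\beta_g=\beta_B=0$; 3. $\mathcal{R}_E=0$. -/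

import Mathlib

open scoped Manifold ContDiff Bundle Topology

noncomputable section
namespace GenGeom

section Basic

variable {n : ℕ} {P : Type*} [TopologicalSpace P] [ChartedSpace (EuclideanSpace ℝ (Fin n)) P]

/-- The ring `C^∞(P)` of smooth real functions on an `n`-dimensional manifold `P`. -/
abbrev Fn (n : ℕ) (P : Type*) [TopologicalSpace P] [ChartedSpace (EuclideanSpace ℝ (Fin n)) P] :=
  C^∞⟮𝓡 n, P; 𝓘(ℝ), ℝ⟯

theorem Fn.mdiffAt (f : Fn n P) (x : P) : MDifferentiableAt (𝓡 n) 𝓘(ℝ) f x :=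
  f.contMDiff.mdifferentiable (by simp) x

variable [IsManifold (𝓡 n) ∞ P]

/-- Smooth vector fields on `P`. -/
abbrev VF (n : ℕ) (P : Type*) [TopologicalSpace P] [ChartedSpace (EuclideanSpace ℝ (Fin n)) P]
    [IsManifold (𝓡 n) ∞ P] :=
  Cₛ^∞⟮𝓡 n; EuclideanSpace ℝ (Fin n), (TangentSpace (𝓡 n) : P → Type)⟯

instance : SMul (Fn n P) (VF n P) :=
  ⟨fun f X => ⟨fun x => f x • X x, f.contMDiff.smul_section X.contMDiff⟩⟩

theorem VF.smul_apply (f : Fn n P) (X : VF n P) (x : P) : (f • X) x = f x • X x := rfl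

/-- Vector fields form a module over the smooth functions, with pointwise operations. -/
instance : Module (Fn n P) (VF n P) where
  one_smul X := by ext x; exact one_smul ℝ (X x)
  mul_smul f h X := by ext x; exact mul_smul (f x) (h x) (X x)
  smul_zero f := by ext x; exact smul_zero (f x)
  smul_add f X Y := by ext x; exact smul_add (f x) (X x) (Y x)
  add_smul f h X := by ext x; exact add_smul (f x) (h x) (X x)
  zero_smul X := by ext x; exact zero_smul ℝ (X x)

/-- The derivative `X.f` of a function along a vector field. -/
def VF.deriv (X : VF n P) (f : Fn n P) : Fn n P :=
  ⟨fun x => mvfderiv (𝓡 n) f x (X x), by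
    have h := (f.contMDiff.contMDiff_tangentMap (m := ∞) (by simp)).comp X.contMDiff
    exact (contMDiff_snd_tangentBundle_modelSpace ℝ 𝓘(ℝ, ℝ)).comp h⟩

/-- The Lie bracket of vector fields. -/
def VF.bracket (X Y : VF n P) : VF n P :=
  ⟨VectorField.mlieBracket (𝓡 n) X Y, by
    have : IsManifold (𝓡 n) ((⊤ : ℕ∞) + 1) P := by
      simpa using (inferInstance : IsManifold (𝓡 n) ∞ P)
    have : IsManifold (𝓡 n) (minSmoothness ℝ 2) P := by
      rw [minSmoothness_of_isRCLikeNormedField]; infer_instance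
    exact ContDiff.mlieBracket_vectorField X.contMDiff Y.contMDiff (by simp)⟩

theorem VF.sum_apply {ι : Type*} (s : Finset ι) (X : ι → VF n P) (x : P) :
    (∑ i ∈ s, X i) x = ∑ i ∈ s, X i x := by
  have h := map_sum (ContMDiffSection.coeAddHom (𝓡 n) (EuclideanSpace ℝ (Fin n)) ∞
    (TangentSpace (𝓡 n) : P → Type)) X s
  have h' := congrFun h x
  rw [Finset.sum_apply] at h'
  exact h'

theorem VF.deriv_apply (X : VF n P) (f : Fn n P) (x : P) :
    X.deriv f x = mvfderiv (𝓡 n) f x (X x) := rfl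

theorem VF.deriv_add (X : VF n P) (f h : Fn n P) : X.deriv (f + h) = X.deriv f + X.deriv h := by
  ext x
  simp [VF.deriv_apply, mvfderiv_add (f.mdiffAt x) (h.mdiffAt x)]

theorem VF.deriv_mul (X : VF n P) (f h : Fn n P) :
    X.deriv (f * h) = f * X.deriv h + X.deriv f * h := by
  ext x
  simp [VF.deriv_apply, mvfderiv_mul (f.mdiffAt x) (h.mdiffAt x)]
  ring

theorem VF.add_deriv (X Y : VF n P) (f : Fn n P) : (X + Y).deriv f = X.deriv f + Y.deriv f := by
  ext x
  simp [VF.deriv_apply]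

theorem VF.smul_deriv (h : Fn n P) (X : VF n P) (f : Fn n P) :
    (h • X).deriv f = h * X.deriv f := by
  ext x
  simp [VF.deriv_apply, VF.smul_apply]

theorem VF.bracket_add (X Y Z : VF n P) : X.bracket (Y + Z) = X.bracket Y + X.bracket Z := by
  ext x
  exact VectorField.mlieBracket_add_right Y.mdifferentiableAt Z.mdifferentiableAt

theorem VF.bracket_smul (X : VF n P) (f : Fn n P) (Y : VF n P) :
    X.bracket (f • Y) = X.deriv f • Y + f • X.bracket Y := by
  ext x
  exact VectorField.mlieBracket_smul_right (f.mdiffAt x) Y.mdifferentiableAt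

theorem VF.bracket_swap (X Y : VF n P) : X.bracket Y = -Y.bracket X := by
  ext x
  exact VectorField.mlieBracket_swap_apply

end Basic

/-- Alternating `R`-multilinear maps `M × ⋯ × M → R`. -/
abbrev AltMap (R M : Type*) [CommRing R] [AddCommGroup M] [Module R M] (p : ℕ) :=
  M [⋀^Fin p]→ₗ[R] R

section Forms

variable {n : ℕ} {P : Type*} [TopologicalSpace P] [ChartedSpace (EuclideanSpace ℝ (Fin n)) P]
  [IsManifold (𝓡 n) ∞ P]

/-- `1`-forms on `P`, as `C^∞(P)`-linear maps from vector fields to functions. -/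
abbrev OneForm (n : ℕ) (P : Type*) [TopologicalSpace P]
    [ChartedSpace (EuclideanSpace ℝ (Fin n)) P] [IsManifold (𝓡 n) ∞ P] :=
  Module.Dual (Fn n P) (VF n P)

/-- `p`-forms on `P`, as alternating `C^∞(P)`-multilinear maps on vector fields. -/
abbrev Form (n : ℕ) (P : Type*) [TopologicalSpace P]
    [ChartedSpace (EuclideanSpace ℝ (Fin n)) P] [IsManifold (𝓡 n) ∞ P] (p : ℕ) :=
  AltMap (Fn n P) (VF n P) p

/-- The differential `df`. -/
def diff (f : Fn n P) : OneForm n P where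
  toFun X := X.deriv f
  map_add' X Y := X.add_deriv Y f
  map_smul' h X := X.smul_deriv h f

/-- The Lie derivative `L_X η`. -/
def lieForm (X : VF n P) (η : OneForm n P) : OneForm n P where
  toFun Z := X.deriv (η Z) - η (X.bracket Z)
  map_add' Z W := by simp only [map_add, VF.deriv_add, VF.bracket_add]; ring
  map_smul' f Z := by
    simp only [map_add, map_smul, smul_eq_mul, VF.deriv_mul, VF.bracket_smul, RingHom.id_apply]
    ring

/-- The contraction `i_Y dξ`, where `dξ(Y,Z) = Y.ξ(Z) - Z.ξ(Y) - ξ([Y,Z])`. -/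
def intD (Y : VF n P) (ξ : OneForm n P) : OneForm n P where
  toFun Z := Y.deriv (ξ Z) - Z.deriv (ξ Y) - ξ (Y.bracket Z)
  map_add' Z W := by simp only [map_add, VF.deriv_add, VF.add_deriv, VF.bracket_add]; ring
  map_smul' f Z := by
    simp only [map_add, map_smul, smul_eq_mul, VF.deriv_mul, VF.smul_deriv, VF.bracket_smul,
      RingHom.id_apply]
    ring

/-- The `1`-form `H(X,Y,·)`. -/
def Form.contract₂ (H : Form n P 3) (X Y : VF n P) : OneForm n P where
  toFun Z := H ![X, Y, Z]
  map_add' Z W := by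
    have h : ∀ V : VF n P, ![X, Y, V] = Function.update ![X, Y, 0] 2 V := fun V => by
      ext i : 1; fin_cases i <;> rfl
    rw [h (Z + W), h Z, h W, H.map_update_add]
  map_smul' f Z := by
    have h : ∀ V : VF n P, ![X, Y, V] = Function.update ![X, Y, 0] 2 V := fun V => by
      ext i : 1; fin_cases i <;> rfl
    rw [h (f • Z), h Z, H.map_update_smul, RingHom.id_apply]

/-- A `2`-form as the bundle map `TP → T*P` with `(BY)(Z) = B(Z,Y)`, that is, the matrix of `B`
acting on the column of components of `Y`. -/
def Form.map (B : Form n P 2) (Y : VF n P) : OneForm n P where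
  toFun Z := B ![Z, Y]
  map_add' Z W := by
    have h : ∀ V : VF n P, ![V, Y] = Function.update ![0, Y] 0 V := fun V => by
      ext i : 1; fin_cases i <;> rfl
    rw [h (Z + W), h Z, h W, B.map_update_add]
  map_smul' f Z := by
    have h : ∀ V : VF n P, ![V, Y] = Function.update ![0, Y] 0 V := fun V => by
      ext i : 1; fin_cases i <;> rfl
    rw [h (f • Z), h Z, B.map_update_smul, RingHom.id_apply]

/-- The exterior derivative `dB` of a `2`-form, evaluated on three vector fields. -/
def extD₂ (B : Form n P 2) (v : Fin 3 → VF n P) : Fn n P :=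
  (v 0).deriv (B ![v 1, v 2]) - (v 1).deriv (B ![v 0, v 2]) + (v 2).deriv (B ![v 0, v 1])
    - B ![(v 0).bracket (v 1), v 2] + B ![(v 0).bracket (v 2), v 1]
    - B ![(v 1).bracket (v 2), v 0]

end Forms

section Frames

variable {n : ℕ} {P : Type*} [TopologicalSpace P] [ChartedSpace (EuclideanSpace ℝ (Fin n)) P]
  [IsManifold (𝓡 n) ∞ P]

/-- A local frame of `TP` around `x` with its dual coframe: (globally defined) vector fields `e i`
and `1`-forms `ε i` with `ε i (e j) = δ i j` in a neighbourhood of `x`. -/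
structure LocalFrame (x : P) where
  e : Fin n → VF n P
  ε : Fin n → OneForm n P
  dual : ∀ i j, ∀ᶠ y in 𝓝 x, ε i (e j) y = if i = j then 1 else 0

theorem exists_frame [T2Space P] (x : P) : ∃ (F : LocalFrame (n := n) x) (χ : Fn n P),
    (∀ᶠ y in 𝓝 x, χ y = 1) ∧ (∀ Z : VF n P, χ • Z = ∑ i, F.ε i Z • F.e i) ∧
      ∀ i (Z : VF n P) y, Z y = 0 → F.ε i Z y = 0 := by
  classical
  let b := (EuclideanSpace.basisFun (Fin n) ℝ).toBasis
  let t := trivializationAt (EuclideanSpace ℝ (Fin n)) (TangentSpace (𝓡 n) : P → Type) x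
  obtain ⟨f⟩ : Nonempty (SmoothBumpFunction (𝓡 n) x) := inferInstance
  have hbase : t.baseSet = (chartAt (EuclideanSpace ℝ (Fin n)) x).source := rfl
  have hts : tsupport f ⊆ t.baseSet := hbase ▸ f.tsupport_subset_chartAt_source
  have hf0 : ∀ y, y ∉ t.baseSet → ∀ᶠ z in 𝓝 y, f z = 0 := by
    intro y hy
    have : y ∉ tsupport f := fun h => hy (hts h)
    exact notMem_tsupport_iff_eventuallyEq.mp this
  let e : Fin n → VF n P := fun i => ⟨fun y => f y • t.localFrame b i y, by
    intro y
    by_cases hy : y ∈ t.baseSet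
    · exact ContMDiffAt.smul_section (f.contMDiff y) (contMDiffAt_localFrame_of_mem ∞ t b i hy)
    · refine ((0 : VF n P).contMDiff y).congr_of_eventuallyEq ?_
      filter_upwards [hf0 y hy] with z hz
      simp [hz]⟩
  let ε : Fin n → OneForm n P := fun i =>
    { toFun := fun Z => ⟨fun y => f y * t.localFrameCoeff (𝓡 n) b i y (Z y), by
        intro y
        by_cases hy : y ∈ t.baseSet
        · exact (f.contMDiff y).mul (contMDiffAt_localFrameCoeff b hy (Z.contMDiff y) i)
        · refine (contMDiffAt_const (c := (0 : ℝ))).congr_of_eventuallyEq ?_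
          filter_upwards [hf0 y hy] with z hz
          simp [hz]⟩
      map_add' := fun Z W => by
        ext y
        change f y * _ = f y * _ + f y * _
        simp [mul_add]
      map_smul' := fun h Z => by
        ext y
        change f y * _ = h y * (f y * _)
        simp [VF.smul_apply]
        ring }
  have hεe : ∀ i j y, y ∈ t.baseSet → ε i (e j) y = f y * (f y * if i = j then 1 else 0) := by
    intro i j y hy
    change f y * t.localFrameCoeff (𝓡 n) b i y (f y • t.localFrame b j y) = _
    rw [map_smul, Bundle.Trivialization.localFrameCoeff_apply_of_mem_baseSet t b hy,
      Bundle.Trivialization.localFrame_apply_of_mem_baseSet t b hy, Module.Basis.repr_self,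
      Finsupp.single_apply, smul_eq_mul]
    simp [eq_comm]
  have hx : ∀ᶠ y in 𝓝 x, y ∈ t.baseSet :=
    t.open_baseSet.mem_nhds (FiberBundle.mem_baseSet_trivializationAt' x)
  refine ⟨⟨e, ε, fun i j => ?_⟩, ⟨fun y => f y * f y, f.contMDiff.mul f.contMDiff⟩, ?_, fun Z => ?_,
    fun i Z y hZ => ?_⟩
  · filter_upwards [hx, f.eventuallyEq_one] with y hy hy1
    rw [hεe i j y hy, hy1]; simp
  · filter_upwards [f.eventuallyEq_one] with y hy1
    change f y * f y = 1
    rw [hy1]; simp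
  · ext y
    rw [VF.sum_apply]
    change (f y * f y) • Z y = ∑ i, (f y * t.localFrameCoeff (𝓡 n) b i y (Z y)) •
      (f y • t.localFrame b i y)
    by_cases hy : y ∈ t.baseSet
    · conv_lhs => rw [t.eq_sum_localFrameCoeff_smul (I := 𝓡 n) (b := b) (s := Z) hy]
      rw [Finset.smul_sum]
      refine Finset.sum_congr rfl fun i _ => ?_
      rw [smul_smul, smul_smul]
      congr 1
      ring
    · have : f y = 0 := (hf0 y hy).self_of_nhds
      simp [this]
  · change f y * t.localFrameCoeff (𝓡 n) b i y (Z y) = 0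
    rw [hZ, map_zero, mul_zero]

instance [T2Space P] (x : P) : Nonempty (LocalFrame (n := n) x) :=
  ⟨(exists_frame x).choose⟩


/-- A local frame of `TP` around `x` with its dual coframe. The traces below are taken in this
frame; being traces of tensors, they do not depend on it. -/
def frameAt [T2Space P] (x : P) : LocalFrame (n := n) x := Classical.choice inferInstance

end Frames

section Riemannian

variable {n : ℕ} {P : Type*} [TopologicalSpace P] [ChartedSpace (EuclideanSpace ℝ (Fin n)) P]
  [IsManifold (𝓡 n) ∞ P]

/-- Smooth Riemannian metrics on `P`. -/
abbrev Metric (n : ℕ) (P : Type*) [TopologicalSpace P]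
    [ChartedSpace (EuclideanSpace ℝ (Fin n)) P] [IsManifold (𝓡 n) ∞ P] :=
  Bundle.ContMDiffRiemannianMetric (𝓡 n) ∞ (EuclideanSpace ℝ (Fin n))
    (TangentSpace (𝓡 n) : P → Type)

/-- The smooth function `g(X,Y)`. -/
def prod (g : Metric n P) (X Y : VF n P) : Fn n P :=
  ⟨fun x => g.inner x (X x) (Y x), fun x => by
    have h := ContMDiff.clm_bundle_apply₂ (E₃ := fun _ : P => ℝ) (F₃ := ℝ) g.contMDiff
      X.contMDiff Y.contMDiff
    exact (Bundle.contMDiffAt_section _).mp (h x)⟩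

theorem prod_apply (g : Metric n P) (X Y : VF n P) (x : P) :
    prod g X Y x = g.inner x (X x) (Y x) := rfl

/-- The bundle map `g : TP → T*P`, `X ↦ g(X,·)`. -/
def flat (g : Metric n P) : VF n P →ₗ[Fn n P] OneForm n P :=
  LinearMap.mk₂ (Fn n P) (prod g)
    (fun X X' Y => by ext x; simp [prod_apply])
    (fun f X Y => by ext x; simp [prod_apply, VF.smul_apply])
    (fun X Y Y' => by ext x; simp [prod_apply])
    (fun f X Y => by ext x; simp [prod_apply, VF.smul_apply])

theorem flat_apply (g : Metric n P) (X Y : VF n P) (x : P) :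
    flat g X Y x = g.inner x (X x) (Y x) := rfl

theorem flat_injective (g : Metric n P) : Function.Injective (flat g) := by
  rw [injective_iff_map_eq_zero]
  intro X hX
  ext x
  by_contra h
  have h1 := g.pos x (X x) h
  rw [← flat_apply, hX] at h1
  exact lt_irrefl _ h1

theorem flat_surjective [T2Space P] [SigmaCompactSpace P] (g : Metric n P) :
    Function.Surjective (flat g) := by
  intro ξ
  have key := exists_contMDiffSection_forall_mem_convex_of_local (n := ⊤) (𝓡 n)
    (F_fiber := EuclideanSpace ℝ (Fin n))
    (TangentSpace (𝓡 n) : P → Type)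
    (fun y => {v | ∀ Z : VF n P, g.inner y v (Z y) = ξ Z y}) ?_ ?_
  · obtain ⟨X, hX⟩ := key
    refine ⟨X, ?_⟩
    ext Z y
    exact hX y Z
  · intro y v hv w hw a b _ _ hab Z
    have h1 := hv Z
    have h2 := hw Z
    simp only [map_add, map_smul, add_apply, smul_apply,
      smul_eq_mul]
    rw [h1, h2, ← add_mul, hab, one_mul]
  · intro x
    obtain ⟨F, χ, hχ, hF, hloc⟩ := exists_frame (n := n) x
    let M : Matrix (Fin n) (Fin n) (Fn n P) := Matrix.of fun i j => flat g (F.e i) (F.e j)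
    let W : VF n P := ∑ i, ∑ j, (ξ (F.e j) * M.adjugate j i) • F.e i
    have hW : ∀ Z, χ * flat g W Z = M.det * (χ * ξ Z) := by
      intro Z
      have e1 : χ * flat g W Z = flat g W (χ • Z) := by rw [map_smul, smul_eq_mul]
      have e2 : χ * ξ Z = ξ (χ • Z) := by rw [map_smul, smul_eq_mul]
      rw [e1, e2, hF]
      simp only [map_sum, map_smul, smul_eq_mul, W, LinearMap.sum_apply, LinearMap.smul_apply,
        Finset.mul_sum]
      refine Finset.sum_congr rfl fun k _ => ?_
      rw [Finset.sum_comm]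
      have h3 : ∀ j, ∑ i, M.adjugate j i * flat g (F.e i) (F.e k) =
          if j = k then M.det else 0 := by
        intro j
        have := congrFun (congrFun (Matrix.adjugate_mul M) j) k
        rw [Matrix.mul_apply] at this
        simp only [Matrix.smul_apply, Matrix.one_apply, smul_eq_mul, mul_ite, mul_one,
          mul_zero] at this
        exact this
      calc _ = ∑ j, F.ε k Z * ξ (F.e j) * ∑ i, M.adjugate j i * flat g (F.e i) (F.e k) := by
            refine Finset.sum_congr rfl fun j _ => ?_
            rw [Finset.mul_sum]
            refine Finset.sum_congr rfl fun i _ => ?_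
            ring
        _ = _ := by
            simp only [h3, mul_ite, mul_zero, Finset.sum_ite_eq', Finset.mem_univ, if_true]
            ring
    have hdet : ∀ y, (∀ i j, F.ε i (F.e j) y = if i = j then 1 else 0) → M.det y ≠ 0 := by
      intro y hy h0
      let ev : Fn n P →+* ℝ := ContMDiffMap.evalRingHom y
      have h1 : (ev.mapMatrix M).det = 0 := by
        rw [← RingHom.map_det]; exact h0
      obtain ⟨c, hc0, hc⟩ := Matrix.exists_mulVec_eq_zero_iff.mpr h1
      let C : Fin n → Fn n P := fun i => ContMDiffMap.const (c i)
      let V : VF n P := ∑ i, C i • F.e i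
      have hV : V y = 0 := by
        by_contra hne
        have hp := g.pos y (V y) hne
        rw [← flat_apply] at hp
        have : flat g V V y = 0 := by
          have e : flat g V V = ∑ i, C i * ∑ j, M i j * C j := by
            simp only [V, map_sum, map_smul, LinearMap.sum_apply, LinearMap.smul_apply,
              smul_eq_mul, Finset.mul_sum]
            rw [Finset.sum_comm]
            refine Finset.sum_congr rfl fun i _ => Finset.sum_congr rfl fun j _ => ?_
            simp only [M, Matrix.of_apply]
            ring
          have e' : ev (flat g V V) = ∑ i, c i * ∑ j, ev (M i j) * c j := by
            rw [e]; simp only [map_sum, map_mul]; rfl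
          change ev (flat g V V) = 0
          rw [e']
          refine Finset.sum_eq_zero fun i _ => ?_
          have := congrFun hc i
          simp only [Matrix.mulVec, dotProduct, RingHom.mapMatrix_apply, Matrix.map_apply,
            Pi.zero_apply] at this
          rw [this, mul_zero]
        linarith
      apply hc0
      ext i
      have h2 := hloc i V y hV
      have h3 : ev (F.ε i V) = ∑ j, c j * ev (F.ε i (F.e j)) := by
        simp only [V, map_sum, map_smul, smul_eq_mul, map_mul]; rfl
      have h4 : ∀ j, ev (F.ε i (F.e j)) = if i = j then 1 else 0 := fun j => hy i j
      change ev (F.ε i V) = 0 at h2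
      rw [h3] at h2
      simpa [h4] using h2
    have hall : ∀ᶠ y in 𝓝 x, (∀ i j, F.ε i (F.e j) y = if i = j then 1 else 0) ∧ χ y = 1 :=
      (Filter.eventually_all.mpr fun i => Filter.eventually_all.mpr fun j => F.dual i j).and hχ
    refine ⟨_, hall, fun y => (M.det y)⁻¹ • W y, ?_, ?_⟩
    · intro y hy
      refine ContMDiffAt.contMDiffWithinAt ?_
      exact ContMDiffAt.smul_section ((M.det.contMDiff y).inv₀ (hdet y hy.1)) (W.contMDiff y)
    · intro y hy Z
      have h1 := congrArg (fun f : Fn n P => f y) (hW Z)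
      simp only [ContMDiffMap.coe_mul, Pi.mul_apply, hy.2, one_mul] at h1
      rw [map_smul, smul_apply, smul_eq_mul, ← flat_apply, h1,
        inv_mul_cancel_left₀ (hdet y hy.1)]


theorem flat_comm (g : Metric n P) (X Y : VF n P) : flat g X Y = flat g Y X := by
  ext x
  exact g.symm x (X x) (Y x)

/-- The `1`-form `Z ↦ 2 g(∇_X Y, Z)` given by the Koszul formula. -/
def koszul (g : Metric n P) (X Y : VF n P) : OneForm n P where
  toFun Z := X.deriv (flat g Y Z) + Y.deriv (flat g Z X) - Z.deriv (flat g X Y)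
    + flat g (X.bracket Y) Z - flat g (Y.bracket Z) X + flat g (Z.bracket X) Y
  map_add' Z W := by
    rw [VF.bracket_swap (Z + W), VF.bracket_swap Z, VF.bracket_swap W]
    simp only [map_add, map_neg, LinearMap.add_apply, LinearMap.neg_apply, VF.deriv_add,
      VF.add_deriv, VF.bracket_add]
    ring
  map_smul' f Z := by
    rw [VF.bracket_swap (f • Z), VF.bracket_swap Z]
    simp only [map_add, map_neg, map_smul, LinearMap.add_apply, LinearMap.neg_apply,
      LinearMap.smul_apply, smul_eq_mul, VF.deriv_mul, VF.smul_deriv, VF.bracket_smul,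
      RingHom.id_apply, flat_comm g Z X, flat_comm g Z Y]
    ring

variable [T2Space P] [SigmaCompactSpace P]

/-- The inverse map `g⁻¹ : T*P → TP`. -/
def sharp (g : Metric n P) : OneForm n P ≃ₗ[Fn n P] VF n P :=
  (LinearEquiv.ofBijective (flat g) ⟨flat_injective g, flat_surjective g⟩).symm

/-- The Levi-Civita connection of `g`. -/
def lc (g : Metric n P) (X Y : VF n P) : VF n P :=
  (1 / 2 : ℝ) • sharp g (koszul g X Y)

end Riemannian

section Beta

variable {n : ℕ} {P : Type*} [TopologicalSpace P] [ChartedSpace (EuclideanSpace ℝ (Fin n)) P]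
  [IsManifold (𝓡 n) ∞ P] [T2Space P] [SigmaCompactSpace P]

/-- The Riemann tensor `R(X,Y)Z` of the Levi-Civita connection of `g`. -/
def curvLC (g : Metric n P) (X Y Z : VF n P) : VF n P :=
  lc g X (lc g Y Z) - lc g Y (lc g X Z) - lc g (X.bracket Y) Z

/-- The Ricci tensor `Ric(X,Y) = tr (Z ↦ R(Z,X)Y)` of the Levi-Civita connection of `g`. -/
def ricLC (g : Metric n P) (X Y : VF n P) (x : P) : ℝ :=
  ∑ k, (frameAt x).ε k (curvLC g ((frameAt x).e k) X Y) x

/-- The scalar curvature of `g`. -/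
def scalLC (g : Metric n P) (x : P) : ℝ :=
  ∑ k, ricLC g (sharp g ((frameAt x).ε k)) ((frameAt x).e k) x

/-- The scalar product of `p`-forms with
`⟨α,β⟩ = (1/p!) α(e_{i₁},…,e_{i_p}) β(g⁻¹e^{i₁},…,g⁻¹e^{i_p})`, so that
`α ∧ ∗β = ⟨α,β⟩ dvol`. -/
def formInner (g : Metric n P) {p : ℕ} (α β : (Fin p → VF n P) → Fn n P) (x : P) : ℝ :=
  (1 / (p.factorial : ℝ)) * ∑ i : Fin p → Fin n,
    α (fun a => (frameAt x).e (i a)) x * β (fun a => sharp g ((frameAt x).ε (i a))) x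

/-- The covariant derivative `∇_X α` of a `p`-form. -/
def covForm (g : Metric n P) (X : VF n P) {p : ℕ} (α : (Fin p → VF n P) → Fn n P)
    (v : Fin p → VF n P) : Fn n P :=
  X.deriv (α v) - ∑ a, α (Function.update v a (lc g X (v a)))

/-- The codifferential `(δα)(X₁,…,X_p) = -(∇_{e_k} α)(g⁻¹(e^k),X₁,…,X_p)`. -/
def codiff (g : Metric n P) {p : ℕ} (α : (Fin (p + 1) → VF n P) → Fn n P)
    (v : Fin p → VF n P) (x : P) : ℝ :=
  -∑ k, covForm g ((frameAt x).e k) α (Fin.cons (sharp g ((frameAt x).ε k)) v) x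

/-- The interior product `i_X α`. -/
def intProd {p : ℕ} (X : VF n P) (α : (Fin (p + 1) → VF n P) → Fn n P)
    (v : Fin p → VF n P) : Fn n P :=
  α (Fin.cons X v)

/-- `dφ` as a function of a family of one vector field. -/
def dForm (φ : Fn n P) (v : Fin 1 → VF n P) : Fn n P := (v 0).deriv φ

/-- The Laplace–Beltrami operator `Δφ = -δ dφ` on functions. -/
def laplace (g : Metric n P) (φ : Fn n P) (x : P) : ℝ := -codiff g (dForm φ) ![] x

/-- The field strength `H' = H + dB`. -/
def fieldStrength (H : Form n P 3) (B : Form n P 2) (v : Fin 3 → VF n P) : Fn n P :=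
  H v + extD₂ B v

/-- The smooth function `exp(-2φ)`. -/
def expNeg (φ : Fn n P) : Fn n P :=
  ⟨fun x => Real.exp (-2 * φ x),
    Real.contDiff_exp.contMDiff.comp (contMDiff_const.mul φ.contMDiff)⟩

/-- `β_g(X,Y) = Ric(X,Y) - ½⟨i_X H', i_Y H'⟩ + (∇_X dφ)(Y) + (∇_Y dφ)(X)`. -/
def betaG (H : Form n P 3) (g : Metric n P) (B : Form n P 2) (φ : Fn n P)
    (X Y : VF n P) (x : P) : ℝ :=
  ricLC g X Y x
    - 1 / 2 * formInner g (intProd X (fieldStrength H B)) (intProd Y (fieldStrength H B)) x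
    + covForm g X (dForm φ) ![Y] x + covForm g Y (dForm φ) ![X] x

/-- `β_B = ½ e^{2φ} δ(e^{-2φ} H')`. -/
def betaB (H : Form n P 3) (g : Metric n P) (B : Form n P 2) (φ : Fn n P)
    (X Y : VF n P) (x : P) : ℝ :=
  1 / 2 * Real.exp (2 * φ x) *
    codiff g (fun v => expNeg φ * fieldStrength H B v) ![X, Y] x

/-- `β_φ = R(g) - ½⟨H',H'⟩ + 4Δφ - 4⟨dφ,dφ⟩ - 2Λ`. -/
def betaPhi (H : Form n P 3) (Λ : ℝ) (g : Metric n P) (B : Form n P 2) (φ : Fn n P)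
    (x : P) : ℝ :=
  scalLC g x - 1 / 2 * formInner g (fieldStrength H B) (fieldStrength H B) x
    + 4 * laplace g φ x - 4 * formInner g (dForm φ) (dForm φ) x - 2 * Λ

end Beta

section Courant

variable {n : ℕ} {P : Type*} [TopologicalSpace P] [ChartedSpace (EuclideanSpace ℝ (Fin n)) P]
  [IsManifold (𝓡 n) ∞ P]

/-- Sections `(X,ξ)` of `E = TP ⊕ T*P`. The anchor is `ρ(X,ξ) = X`. -/
abbrev Sec (n : ℕ) (P : Type*) [TopologicalSpace P]
    [ChartedSpace (EuclideanSpace ℝ (Fin n)) P] [IsManifold (𝓡 n) ∞ P] :=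
  VF n P × OneForm n P

/-- The canonical pairing `⟨(X,ξ),(Y,η)⟩ = η(X) + ξ(Y)`. -/
def pair (ψ ψ' : Sec n P) : Fn n P := ψ'.2 ψ.1 + ψ.2 ψ'.1

/-- The `H`-twisted Dorfman bracket
`[(X,ξ),(Y,η)] = ([X,Y], L_X η - i_Y dξ - H(X,Y,·))`. -/
def dorfman (H : Form n P 3) (ψ ψ' : Sec n P) : Sec n P :=
  (ψ.1.bracket ψ'.1, lieForm ψ.1 ψ'.2 - intD ψ'.1 ψ.2 - Form.contract₂ H ψ.1 ψ'.1)

/-- The map `𝒟 : C^∞(P) → Γ(E)`, `⟨𝒟f,ψ⟩ = ρ(ψ).f`, that is `𝒟f = (0,df)`. -/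
def dMap (f : Fn n P) : Sec n P := (0, diff f)

theorem pair_dMap (f : Fn n P) (ψ : Sec n P) : pair (dMap f) ψ = ψ.1.deriv f := by
  simp [pair, dMap, diff]

/-- Courant algebroid connections on `TP ⊕ T*P`. -/
structure Conn (n : ℕ) (P : Type*) [TopologicalSpace P]
    [ChartedSpace (EuclideanSpace ℝ (Fin n)) P] [IsManifold (𝓡 n) ∞ P] where
  /-- The operator `∇_ψ ψ'`. -/
  nabla : Sec n P → Sec n P → Sec n P
  add_left : ∀ ψ₁ ψ₂ ψ', nabla (ψ₁ + ψ₂) ψ' = nabla ψ₁ ψ' + nabla ψ₂ ψ'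
  smul_left : ∀ (f : Fn n P) ψ ψ', nabla (f • ψ) ψ' = f • nabla ψ ψ'
  add_right : ∀ ψ ψ₁ ψ₂, nabla ψ (ψ₁ + ψ₂) = nabla ψ ψ₁ + nabla ψ ψ₂
  leibniz : ∀ ψ (f : Fn n P) ψ', nabla ψ (f • ψ') = f • nabla ψ ψ' + ψ.1.deriv f • ψ'
  compat : ∀ ψ ψ' ψ'', ψ.1.deriv (pair ψ' ψ'') =
    pair (nabla ψ ψ') ψ'' + pair ψ' (nabla ψ ψ'')

/-- The torsion `3`-form `T_G`, for the `H`-twisted bracket. -/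
def torsion (H : Form n P 3) (D : Conn n P) (ψ ψ' ψ'' : Sec n P) : Fn n P :=
  pair (D.nabla ψ ψ' - D.nabla ψ' ψ - dorfman H ψ ψ') ψ'' + pair (D.nabla ψ'' ψ) ψ'

/-- The naive curvature `R⁽⁰⁾(φ',φ,ψ,ψ') = ⟨φ', ([∇_ψ,∇_ψ'] - ∇_[ψ,ψ']) φ⟩`. -/
def curv₀ (H : Form n P 3) (D : Conn n P) (φ' φ ψ ψ' : Sec n P) : Fn n P :=
  pair φ' (D.nabla ψ (D.nabla ψ' φ) - D.nabla ψ' (D.nabla ψ φ) - D.nabla (dorfman H ψ ψ') φ)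

variable [T2Space P]

/-- The local frame `ψ_λ = (e_k,0), (0,e^k)` of `E` around `x`. -/
def frameE (x : P) : Fin n ⊕ Fin n → Sec n P :=
  Sum.elim (fun k => ((frameAt x).e k, 0)) (fun k => (0, (frameAt x).ε k))

/-- The dual frame `ψ^λ_E = (0,e^k), (e_k,0)`, with `⟨ψ_λ, ψ^κ_E⟩ = δ` near `x`. -/
def coframeE (x : P) : Fin n ⊕ Fin n → Sec n P :=
  Sum.elim (fun k => (0, (frameAt x).ε k)) (fun k => ((frameAt x).e k, 0))

theorem pair_frameE_coframeE (x : P) (l m : Fin n ⊕ Fin n) :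
    ∀ᶠ y in 𝓝 x, pair (frameE x l) (coframeE x m) y = if l = m then 1 else 0 := by
  rcases l with i | i <;> rcases m with j | j
  · filter_upwards [(frameAt x).dual j i] with y hy
    simpa [pair, frameE, coframeE, eq_comm] using hy
  · exact Filter.Eventually.of_forall fun y => by simp [pair, frameE, coframeE]
  · exact Filter.Eventually.of_forall fun y => by simp [pair, frameE, coframeE]
  · filter_upwards [(frameAt x).dual i j] with y hy
    simpa [pair, frameE, coframeE] using hy

/-- The Riemann tensor
`R(φ',φ,ψ,ψ') = ½ {R⁽⁰⁾(φ',φ,ψ,ψ') + R⁽⁰⁾(ψ',ψ,φ,φ') + ⟨∇_{ψ_λ} ψ, ψ'⟩⟨∇_{ψ^λ_E} φ, φ'⟩}`. -/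
def riem (H : Form n P 3) (D : Conn n P) (φ' φ ψ ψ' : Sec n P) (x : P) : ℝ :=
  1 / 2 * (curv₀ H D φ' φ ψ ψ' x + curv₀ H D ψ' ψ φ φ' x
    + ∑ l, pair (D.nabla (frameE x l) ψ) ψ' x * pair (D.nabla (coframeE x l) φ) φ' x)

/-- The Ricci tensor `Ric(ψ,ψ') = R(ψ^λ_E, ψ', ψ_λ, ψ)`. -/
def ric (H : Form n P 3) (D : Conn n P) (ψ ψ' : Sec n P) (x : P) : ℝ :=
  ∑ l, riem H D (coframeE x l) ψ' (frameE x l) ψ x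

/-- The Courant-Ricci scalar curvature `R_E = Ric(ψ^λ_E, ψ_λ)`. -/
def scalE (H : Form n P 3) (D : Conn n P) (x : P) : ℝ :=
  ∑ l, ric H D (coframeE x l) (frameE x l) x

/-- The covariant divergence `Div_∇(ψ) = ⟨∇_{ψ_λ} ψ, ψ^λ_E⟩`. -/
def divergence (D : Conn n P) (ψ : Sec n P) (x : P) : ℝ :=
  ∑ l, pair (D.nabla (frameE x l) ψ) (coframeE x l) x

/-- The action `X_∇.f = Div_∇(𝒟f)` of the characteristic vector field on a function. -/
def charField (D : Conn n P) (f : Fn n P) (x : P) : ℝ := divergence D (dMap f) x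

/-- The function `⟨∇_{ρ*(e^k)} ρ*(g(e_k)), ρ*(g(Z))⟩`, where `ρ*(ξ) = (0,ξ)`. -/
def dilatonForm (g : Metric n P) (D : Conn n P) (Z : VF n P) (x : P) : ℝ :=
  ∑ k, pair (D.nabla (0, (frameAt x).ε k) (0, flat g ((frameAt x).e k))) (0, flat g Z) x

variable [SigmaCompactSpace P]

/-- The involution `τ = g_E⁻¹ G` of `E` associated with the generalized metric
`G = ((g - B g⁻¹ B, B g⁻¹), (-g⁻¹ B, g⁻¹)) : TP ⊕ T*P → T*P ⊕ TP`. -/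
def tau (g : Metric n P) (B : Form n P 2) (ψ : Sec n P) : Sec n P :=
  (-sharp g (Form.map B ψ.1) + sharp g ψ.2,
    (flat g ψ.1 - Form.map B (sharp g (Form.map B ψ.1))) + Form.map B (sharp g ψ.2))

/-- The generalized metric `G(ψ,ψ') = ⟨ψ,τψ'⟩`. -/
def genMetric (g : Metric n P) (B : Form n P 2) (ψ ψ' : Sec n P) : Fn n P :=
  pair ψ (tau g B ψ')

/-- `∇` is a Levi-Civita connection with respect to `G`: `∇G = 0` and `T_G = 0`. -/
structure IsLeviCivita (H : Form n P 3) (g : Metric n P) (B : Form n P 2) (D : Conn n P) :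
    Prop where
  metric : ∀ ψ ψ' ψ'', ψ.1.deriv (genMetric g B ψ' ψ'') =
    genMetric g B (D.nabla ψ ψ') ψ'' + genMetric g B ψ' (D.nabla ψ ψ'')
  torsion_free : ∀ ψ ψ' ψ'', torsion H D ψ ψ' ψ'' = 0

/-- Ricci compatibility `Ric(V₊,V₋) = 0`, where `V_±` are the `±1` eigenbundles of `τ`. -/
def RicciCompatible (H : Form n P 3) (g : Metric n P) (B : Form n P 2) (D : Conn n P) : Prop :=
  ∀ ψ ψ' : Sec n P, tau g B ψ = ψ → tau g B ψ' = -ψ' → ∀ x, ric H D ψ ψ' x = 0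

/-- The scalar curvature `R_G = Ric(G⁻¹(ψ^λ), ψ_λ)`. As `G = g_E τ` and `τ² = 1`, the section
`G⁻¹(ψ^λ)` is `τ(ψ^λ_E)`. -/
def scalG (H : Form n P 3) (g : Metric n P) (B : Form n P 2) (D : Conn n P) (x : P) : ℝ :=
  ∑ l, ric H D (tau g B (coframeE x l)) (frameE x l) x

end Courant

end GenGeom

end

/-!
The eigenbundles `V_±` of `τ` are the graphs of `±g + B`, so `lift` identifies both with `TP`, and a
Levi-Civita connection `∇` on `E`, which commutes with `τ`, becomes four metric connections on `TP`
(`IsLeviCivita.conn`): a section of `V_s` differentiates a section of `V_t`. Vanishing torsion fixes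
the two mixed connections to be the Levi-Civita connection of `g` shifted by `∓ ½ g⁻¹(H + dB)`
(`IsLeviCivita.conn_mixed`). Of the connection on each `V_s` it fixes only the totally skew part of
the contorsion tensor (`IsLeviCivita.cont_cyclic`); the remaining part is arbitrary, but its trace is
not: up to constants `X_∇` is the difference of the two traces and `dφ` is their sum, so under the
hypotheses both traces are `-2dφ` (`IsLeviCivita.trace_cont`).

Since `∇` preserves `V_±`, most components of the Riemann tensor vanish. The components with exactly
one argument in the other eigenbundle reduce to the naive curvature, because the Dorfman bracket of
mixed sections is given by the mixed connections. Their trace sees the undetermined part of the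
contorsion only through its trace (`trace_mixedCurv`), which yields `Ric(V₊,V₋) = β_g - β_B`
(`IsLeviCivita.ric_mixed_eq_beta`). As `β_g` is symmetric and `β_B` is skew, Ricci compatibility means
that both vanish.

For the scalar curvatures only the components with all arguments in one `V_s` matter. The bracket of
two sections of `V_s` has components in both eigenbundles, and together with the quadratic term of
the Riemann tensor these give contractions of connection coefficients (`IsLeviCivita.sum_ric_pure`).
The undetermined part of the contorsion enters quadratically; by the cyclic identity
(`quadratic_identity`) and the trace condition everything cancels except `β_φ + 2Λ`
(`scalar_contraction`). The result is the same for both signs, and `R_E` and `R_G` are half the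
difference and half the sum of the two traces (`scalE_eq`, `scalG_eq`): hence `R_E = 0` and
`R_G = β_φ + 2Λ`.

Tensors are handled pointwise (`TensorAt`), and traces are taken over `g`-dual pairs of vector fields
(`DualAt`); they are independent of the pair by `trace_eq`.
-/

open scoped Manifold ContDiff Bundle Topology

noncomputable section
namespace GenGeom

/-! ### Vector fields as derivations -/

section Calculus

variable {n : ℕ} {P : Type*} [TopologicalSpace P] [ChartedSpace (EuclideanSpace ℝ (Fin n)) P]
  [IsManifold (𝓡 n) ∞ P]

theorem VF.deriv_neg (X : VF n P) (f : Fn n P) : X.deriv (-f) = -X.deriv f :=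
  map_neg (AddMonoidHom.mk' X.deriv X.deriv_add) f

theorem VF.deriv_sum {ι : Type*} (s : Finset ι) (X : VF n P) (f : ι → Fn n P) :
    X.deriv (∑ i ∈ s, f i) = ∑ i ∈ s, X.deriv (f i) :=
  map_sum (AddMonoidHom.mk' X.deriv X.deriv_add) f s

theorem VF.neg_deriv (X : VF n P) (f : Fn n P) : (-X).deriv f = -X.deriv f :=
  map_neg (diff f) X

theorem VF.sub_deriv (X Y : VF n P) (f : Fn n P) : (X - Y).deriv f = X.deriv f - Y.deriv f :=
  map_sub (diff f) X Y

/-- The derivative `X.f` at a point depends only on the germ of `f`. -/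
theorem VF.deriv_congr (X : VF n P) {f h : Fn n P} {x : P} (hf : ∀ᶠ y in 𝓝 x, f y = h y) :
    X.deriv f x = X.deriv h x := by
  have : mfderiv (𝓡 n) 𝓘(ℝ) f x = mfderiv (𝓡 n) 𝓘(ℝ) h x := Filter.EventuallyEq.mfderiv_eq hf
  have e : f x = h x := hf.self_of_nhds
  simp only [VF.deriv_apply, mvfderiv]
  simp only [ContinuousLinearMap.comp_apply]
  rw [this]
  rfl

theorem VF.deriv_const (X : VF n P) (c : ℝ) : X.deriv (ContMDiffMap.const c) = 0 := by
  ext x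
  change mvfderiv (𝓡 n) (fun _ : P => c) x (X x) = 0
  rw [mvfderiv_const]
  rfl

theorem VF.deriv_real_smul (X : VF n P) (c : ℝ) (f : Fn n P) :
    X.deriv (c • f) = c • X.deriv f := by
  have h : c • f = (ContMDiffMap.const c : Fn n P) * f := by ext; rfl
  have h' : c • X.deriv f = (ContMDiffMap.const c : Fn n P) * X.deriv f := by ext; rfl
  rw [h, h', VF.deriv_mul, VF.deriv_const, zero_mul, add_zero]

theorem VF.add_bracket (X Y Z : VF n P) : (X + Y).bracket Z = X.bracket Z + Y.bracket Z := by
  rw [VF.bracket_swap, VF.bracket_add, VF.bracket_swap Z X, VF.bracket_swap Z Y]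
  abel

theorem VF.smul_bracket (f : Fn n P) (X Y : VF n P) :
    (f • X).bracket Y = f • X.bracket Y - Y.deriv f • X := by
  rw [VF.bracket_swap, VF.bracket_smul, VF.bracket_swap Y X, smul_neg]
  abel

/-- The Jacobi identity for vector fields. -/
theorem VF.jacobi (X Y Z : VF n P) :
    X.bracket (Y.bracket Z) = (X.bracket Y).bracket Z + Y.bracket (X.bracket Z) := by
  have : IsManifold (𝓡 n) (minSmoothness ℝ 3) P := by
    rw [minSmoothness_of_isRCLikeNormedField]
    exact IsManifold.of_le (n := ∞) (WithTop.coe_le_coe.mpr le_top)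
  have hs : minSmoothness ℝ 2 ≤ (∞ : WithTop ℕ∞) := by
    rw [minSmoothness_of_isRCLikeNormedField]
    exact WithTop.coe_le_coe.mpr le_top
  ext x
  exact VectorField.leibniz_identity_mlieBracket_apply ((X.contMDiff x).of_le hs)
    ((Y.contMDiff x).of_le hs) ((Z.contMDiff x).of_le hs)

/-- The Lie bracket acts on functions as the commutator of derivations. This is the Leibniz rule
applied to the Jacobi identity for `X, Y, fZ`. -/
theorem VF.bracket_deriv (X Y : VF n P) (f : Fn n P) :
    (X.bracket Y).deriv f = X.deriv (Y.deriv f) - Y.deriv (X.deriv f) := by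
  ext x
  by_cases h : ∃ Z : VF n P, Z x ≠ 0
  · obtain ⟨Z, hZ⟩ := h
    have hJ := VF.jacobi X Y (f • Z)
    simp only [VF.bracket_smul, VF.bracket_add, VF.jacobi X Y Z] at hJ
    have h0 : ((X.bracket Y).deriv f - (X.deriv (Y.deriv f) - Y.deriv (X.deriv f))) • Z = 0 := by
      rw [← sub_eq_zero] at hJ
      rw [← neg_eq_zero, ← hJ]
      module
    have h1 : ((X.bracket Y).deriv f - (X.deriv (Y.deriv f) - Y.deriv (X.deriv f))) x • Z x = 0 :=
      congrArg (fun W : VF n P => W x) h0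
    rcases smul_eq_zero.mp h1 with h2 | h2
    · exact sub_eq_zero.mp h2
    · exact absurd h2 hZ
  · have h' : ∀ Z : VF n P, Z x = 0 := fun Z => by_contra fun hZ => h ⟨Z, hZ⟩
    change (X.bracket Y).deriv f x = X.deriv (Y.deriv f) x - Y.deriv (X.deriv f) x
    simp [VF.deriv_apply, h']

/-- Smooth functions separate tangent vectors: the coordinate functions cut off by a bump function
do. -/
theorem VF.eq_zero_of_deriv [T2Space P] (W : VF n P) (x : P)
    (hW : ∀ f : Fn n P, W.deriv f x = 0) : W x = 0 := by
  obtain ⟨b⟩ : Nonempty (SmoothBumpFunction (𝓡 n) x) := inferInstance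
  have hinv := isInvertible_mfderiv_extChartAt (I := 𝓡 n) (mem_extChartAt_source (I := 𝓡 n) x)
  have hmd : MDifferentiableAt (𝓡 n) 𝓘(ℝ, EuclideanSpace ℝ (Fin n)) (extChartAt (𝓡 n) x) x :=
    mdifferentiableAt_extChartAt (mem_chart_source _ x)
  have key : ∀ L : EuclideanSpace ℝ (Fin n) →L[ℝ] ℝ,
      L (mfderiv (𝓡 n) 𝓘(ℝ, EuclideanSpace ℝ (Fin n)) (extChartAt (𝓡 n) x) x (W x)) = 0 := by
    intro L
    let u : P → ℝ := fun y => L (extChartAt (𝓡 n) x y)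
    let f : Fn n P := ⟨fun y => b y • u y, b.contMDiff_smul
      (L.contMDiff.comp_contMDiffOn (contMDiffOn_extChartAt (I := 𝓡 n) (x := x)))⟩
    have hfu : (f : P → ℝ) =ᶠ[𝓝 x] u := by
      filter_upwards [b.eventuallyEq_one] with y hy
      change b y • u y = u y
      rw [hy]; simp
    have h0 : W.deriv f x = 0 := hW f
    rw [VF.deriv_apply] at h0
    have hc : mfderiv (𝓡 n) 𝓘(ℝ) f x = L.comp
        (mfderiv (𝓡 n) 𝓘(ℝ, EuclideanSpace ℝ (Fin n)) (extChartAt (𝓡 n) x) x) := by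
      rw [hfu.mfderiv_eq]
      have := mfderiv_comp x (I' := 𝓘(ℝ, EuclideanSpace ℝ (Fin n))) (I'' := 𝓘(ℝ))
        (g := L) L.mdifferentiableAt hmd
      rw [ContinuousLinearMap.mfderiv_eq] at this
      exact this
    simp only [mvfderiv, hc] at h0
    exact h0
  have h1 : mfderiv (𝓡 n) 𝓘(ℝ, EuclideanSpace ℝ (Fin n)) (extChartAt (𝓡 n) x) x (W x) = 0 := by
    exact PiLp.ext fun i => key (EuclideanSpace.proj i)
  exact hinv.injective (h1.trans (map_zero _).symm)

end Calculus

/-! ### Pointwise tensors and traces over dual pairs -/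

section Tensors

variable {n : ℕ} {P : Type*} [TopologicalSpace P] [ChartedSpace (EuclideanSpace ℝ (Fin n)) P]

/-- A real-valued map on a module of sections that is linear over the functions evaluated at `x`:
the value at `x` of a `C^∞`-linear expression. -/
structure TensorAt (n : ℕ) {P : Type*} [TopologicalSpace P]
    [ChartedSpace (EuclideanSpace ℝ (Fin n)) P] {M : Type*} [AddCommGroup M] [Module (Fn n P) M]
    (x : P) (T : M → ℝ) : Prop where
  add : ∀ Z W, T (Z + W) = T Z + T W
  smul : ∀ (f : Fn n P) Z, T (f • Z) = f x * T Z

section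
variable {M : Type*} [AddCommGroup M] [Module (Fn n P) M] {x : P} {T : M → ℝ}

theorem TensorAt.sub (hT : TensorAt n x T) (Z W : M) : T (Z - W) = T Z - T W :=
  map_sub (AddMonoidHom.mk' T hT.add) Z W

theorem TensorAt.sum (hT : TensorAt n x T) {ι : Type*} (s : Finset ι) (Z : ι → M) :
    T (∑ i ∈ s, Z i) = ∑ i ∈ s, T (Z i) :=
  map_sum (AddMonoidHom.mk' T hT.add) Z s

theorem TensorAt.mul_const (hT : TensorAt n x T) (r : ℝ) : TensorAt n x (fun A => T A * r) :=
  ⟨fun Z W => by rw [hT.add, add_mul], fun f Z => by rw [hT.smul, mul_assoc]⟩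

theorem TensorAt.const_mul (hT : TensorAt n x T) (r : ℝ) : TensorAt n x (fun A => r * T A) :=
  ⟨fun Z W => by rw [hT.add, mul_add], fun f Z => by rw [hT.smul, mul_left_comm]⟩

theorem TensorAt.add_tensor {S : M → ℝ} (hT : TensorAt n x T) (hS : TensorAt n x S) :
    TensorAt n x (fun A => T A + S A) :=
  ⟨fun Z W => by rw [hT.add, hS.add]; ring, fun f Z => by rw [hT.smul, hS.smul, mul_add]⟩

theorem TensorAt.comp {N : Type*} [AddCommGroup N] [Module (Fn n P) N]
    (hT : TensorAt n x T) (L : N →ₗ[Fn n P] M) : TensorAt n x (fun Z => T (L Z)) :=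
  ⟨fun Z W => by rw [map_add, hT.add], fun f Z => by rw [map_smul, hT.smul]⟩

end

variable [IsManifold (𝓡 n) ∞ P]

theorem tensorAt_form (x : P) (ξ : OneForm n P) : TensorAt n x (fun Z => ξ Z x) :=
  ⟨fun Z W => by simp, fun f Z => by simp⟩

/-- Tensors are local: the value depends only on the argument at the point. -/
theorem TensorAt.congr [T2Space P] {x : P} {T : VF n P → ℝ} (hT : TensorAt n x T) {Z W : VF n P}
    (h : Z x = W x) : T Z = T W := by
  obtain ⟨F, χ, hχ, hF, hloc⟩ := exists_frame (n := n) x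
  rw [← sub_eq_zero, ← hT.sub]
  have h0 : (Z - W) x = 0 := sub_eq_zero.mpr h
  have h1 : T (χ • (Z - W)) = 0 := by
    rw [hF, hT.sum]
    exact Finset.sum_eq_zero fun i _ => by rw [hT.smul, hloc i _ x h0, zero_mul]
  rwa [hT.smul, hχ.self_of_nhds, one_mul] at h1

end Tensors

section Traces

variable {n : ℕ} {P : Type*} [TopologicalSpace P] [ChartedSpace (EuclideanSpace ℝ (Fin n)) P]
  [IsManifold (𝓡 n) ∞ P]

/-- Two families of vector fields are dual at `x` with respect to `g` if `g(e_i,e'_j) = δ_ij`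
there. -/
def DualAt (g : Metric n P) (x : P) (e e' : Fin n → VF n P) : Prop :=
  ∀ i j, flat g (e i) (e' j) x = if i = j then 1 else 0

theorem DualAt.symm {g : Metric n P} {x : P} {e e' : Fin n → VF n P} (h : DualAt g x e e') :
    DualAt g x e' e := fun i j => by
  rw [flat_comm, h j i]; simp [eq_comm]

theorem sum_dual_smul {V : Type*} [AddCommGroup V] [Module ℝ V] [FiniteDimensional ℝ V]
    (hV : Module.finrank ℝ V = n) (v : Fin n → V) (G : Fin n → V →ₗ[ℝ] ℝ)
    (hG : ∀ i j, G j (v i) = if i = j then 1 else 0) (z : V) : z = ∑ i, G i z • v i := by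
  have hli : LinearIndependent ℝ v := by
    rw [Fintype.linearIndependent_iff]
    intro c hc j
    have := congrArg (G j) hc
    simpa [hG] using this
  have hspan := hli.span_eq_top_of_card_eq_finrank' (by simp [hV])
  have hz : z ∈ Submodule.span ℝ (Set.range v) := by rw [hspan]; trivial
  obtain ⟨c, rfl⟩ := (Submodule.mem_span_range_iff_exists_fun ℝ).mp hz
  simp [hG]

/-- A dual pair spans the tangent space. -/
theorem DualAt.expand {g : Metric n P} {x : P} {e e' : Fin n → VF n P} (h : DualAt g x e e')
    (Z : VF n P) : Z x = ∑ i, flat g Z (e' i) x • e i x := by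
  have hfr : Module.finrank ℝ (EuclideanSpace ℝ (Fin n)) = n := by simp
  have := sum_dual_smul (V := EuclideanSpace ℝ (Fin n)) hfr (fun i => e i x)
    (fun j => (g.inner x (e' j x)).toLinearMap) (fun i j => by rw [← h i j, flat_comm]; rfl) (Z x)
  simp only [flat_comm g Z]
  exact this

variable [T2Space P] {g : Metric n P} {x : P}

theorem TensorAt.expand {T : VF n P → ℝ} (hT : TensorAt n x T) {e e' : Fin n → VF n P}
    (h : DualAt g x e e') (Z : VF n P) : T Z = ∑ i, flat g Z (e' i) x * T (e i) := by
  have h1 : Z x = (∑ i, flat g Z (e' i) • e i) x := by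
    rw [VF.sum_apply, h.expand Z]; rfl
  rw [hT.congr h1, hT.sum]
  exact Finset.sum_congr rfl fun i _ => hT.smul _ _

/-- Contraction over a dual pair. -/
theorem DualAt.contract {e e' : Fin n → VF n P} (h : DualAt g x e e') (A B : VF n P) :
    ∑ i, flat g A (e i) x * flat g B (e' i) x = flat g A B x := by
  rw [(tensorAt_form x (flat g A)).expand h B]
  exact Finset.sum_congr rfl fun i _ => mul_comm _ _

/-- The `g`-trace of a bilinear form does not depend on the dual pair used to compute it. -/
theorem trace_eq {T : VF n P → VF n P → ℝ} (h₁ : ∀ B, TensorAt n x (fun A => T A B))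
    (h₂ : ∀ A, TensorAt n x (T A)) {e e' f f' : Fin n → VF n P} (he : DualAt g x e e')
    (hf : DualAt g x f f') : ∑ i, T (e i) (e' i) = ∑ i, T (f i) (f' i) := by
  have a1 : ∀ i, T (e i) (e' i) = ∑ j, flat g (e i) (f' j) x * T (f j) (e' i) := fun i =>
    (h₁ (e' i)).expand hf (e i)
  simp only [a1]
  rw [Finset.sum_comm]
  refine Finset.sum_congr rfl fun j _ => ?_
  rw [(h₂ (f j)).expand he.symm (f' j)]
  exact Finset.sum_congr rfl fun i _ => by rw [flat_comm]

theorem trace_swap {T : VF n P → VF n P → ℝ} (h₁ : ∀ B, TensorAt n x (fun A => T A B))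
    (h₂ : ∀ A, TensorAt n x (T A)) {e e' : Fin n → VF n P} (he : DualAt g x e e') :
    ∑ i, T (e i) (e' i) = ∑ i, T (e' i) (e i) := trace_eq h₁ h₂ he he.symm

/-- A skew endomorphism may be moved across the trace. -/
theorem trace_skew {T : VF n P → VF n P → ℝ} (h₁ : ∀ B, TensorAt n x (fun A => T A B))
    (h₂ : ∀ A, TensorAt n x (T A)) {e e' : Fin n → VF n P} (he : DualAt g x e e')
    {b : VF n P → VF n P} (hb : ∀ A B, flat g (b A) B = -flat g A (b B)) :
    ∑ i, T (b (e i)) (e' i) = -∑ i, T (e i) (b (e' i)) := by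
  have a1 : ∀ i, T (b (e i)) (e' i) = ∑ j, flat g (b (e i)) (e' j) x * T (e j) (e' i) := fun i =>
    (h₁ (e' i)).expand he _
  have a2 : ∀ i, T (e i) (b (e' i)) = ∑ j, flat g (b (e' i)) (e j) x * T (e i) (e' j) := fun i =>
    (h₂ (e i)).expand he.symm _
  simp only [a1, a2, ← Finset.sum_neg_distrib]
  rw [Finset.sum_comm]
  refine Finset.sum_congr rfl fun j _ => Finset.sum_congr rfl fun i _ => ?_
  rw [hb, flat_comm]
  simp

end Traces

/-! ### Metric connections and the Levi-Civita connection -/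

section MetricConnections

variable {n : ℕ} {P : Type*} [TopologicalSpace P] [ChartedSpace (EuclideanSpace ℝ (Fin n)) P]

theorem Fn.two_mul_cancel {f h : Fn n P} (H : 2 * f = 2 * h) : f = h := by
  ext x
  rw [two_mul, two_mul] at H
  have : f x + f x = h x + h x := congrArg (fun k : Fn n P => k x) H
  linarith

variable [IsManifold (𝓡 n) ∞ P]

theorem flat_ext {g : Metric n P} {A B : VF n P} (h : ∀ Z, flat g A Z = flat g B Z) : A = B :=
  flat_injective g (LinearMap.ext h)

theorem flat_ext_two {g : Metric n P} {A B : VF n P}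
    (h : ∀ Z, 2 * flat g A Z = 2 * flat g B Z) : A = B :=
  flat_ext fun Z => Fn.two_mul_cancel (h Z)

/-- Metric connections on `TP`, possibly with torsion. -/
structure MConn (g : Metric n P) where
  /-- The operator `∇_X Y`. -/
  nabla : VF n P → VF n P → VF n P
  add_left : ∀ X Y Z, nabla (X + Y) Z = nabla X Z + nabla Y Z
  smul_left : ∀ (f : Fn n P) X Z, nabla (f • X) Z = f • nabla X Z
  add_right : ∀ X Y Z, nabla X (Y + Z) = nabla X Y + nabla X Z
  leibniz : ∀ X (f : Fn n P) Y, nabla X (f • Y) = f • nabla X Y + X.deriv f • Y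
  metric : ∀ X Y Z, X.deriv (flat g Y Z) = flat g (nabla X Y) Z + flat g Y (nabla X Z)

/-- The difference of two metric connections, a `(2,1)`-tensor. -/
def MConn.diffTensor {g : Metric n P} (D D' : MConn g) :
    VF n P →ₗ[Fn n P] VF n P →ₗ[Fn n P] VF n P :=
  LinearMap.mk₂ (Fn n P) (fun X Y => D.nabla X Y - D'.nabla X Y)
    (fun X Y Z => by simp only [MConn.add_left]; abel)
    (fun f X Z => by simp only [MConn.smul_left]; module)
    (fun X Y Z => by simp only [MConn.add_right]; abel)
    (fun f X Z => by simp only [MConn.leibniz]; module)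

theorem MConn.diffTensor_apply {g : Metric n P} (D D' : MConn g) (X Y : VF n P) :
    D.diffTensor D' X Y = D.nabla X Y - D'.nabla X Y := rfl

theorem MConn.diffTensor_skew {g : Metric n P} (D D' : MConn g) (X Y Z : VF n P) :
    flat g (D.diffTensor D' X Y) Z = -flat g (D.diffTensor D' X Z) Y := by
  have h1 := D.metric X Y Z
  have h2 := D'.metric X Y Z
  simp only [MConn.diffTensor_apply, map_sub, LinearMap.sub_apply]
  rw [flat_comm g (D.nabla X Z), flat_comm g (D'.nabla X Z)]
  linear_combination h2 - h1

/-- The sum of the two ways to differentiate one leg of a dual pair vanishes under a trace, because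
the inverse metric is parallel. -/
theorem MConn.trace_nabla [T2Space P] {g : Metric n P} (D : MConn g) {x : P}
    {T : VF n P → VF n P → ℝ} (h₁ : ∀ B, TensorAt n x (fun A => T A B))
    (h₂ : ∀ A, TensorAt n x (T A)) {e e' : Fin n → VF n P} (he : ∀ᶠ y in 𝓝 x, DualAt g y e e')
    (X : VF n P) : ∑ k, (T (D.nabla X (e k)) (e' k) + T (e k) (D.nabla X (e' k))) = 0 := by
  have he0 := he.self_of_nhds
  have a1 : ∀ k, T (D.nabla X (e k)) (e' k) =
      ∑ j, flat g (D.nabla X (e k)) (e' j) x * T (e j) (e' k) := fun k => (h₁ (e' k)).expand he0 _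
  have a2 : ∀ k, T (e k) (D.nabla X (e' k)) =
      ∑ j, flat g (D.nabla X (e' k)) (e j) x * T (e k) (e' j) := fun k =>
    (h₂ (e k)).expand he0.symm _
  have hd : ∀ k j, flat g (D.nabla X (e k)) (e' j) x + flat g (D.nabla X (e' j)) (e k) x = 0 := by
    intro k j
    have h0 : X.deriv (flat g (e k) (e' j)) x = 0 := by
      rw [X.deriv_congr (h := ContMDiffMap.const (if k = j then 1 else 0))
        (he.mono fun y hy => hy k j),
        VF.deriv_const]
      rfl
    rw [D.metric, flat_comm g (e k)] at h0
    exact h0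
  rw [Finset.sum_add_distrib]
  simp only [a1, a2]
  rw [Finset.sum_comm, ← Finset.sum_add_distrib]
  refine Finset.sum_eq_zero fun j _ => ?_
  rw [← Finset.sum_add_distrib]
  refine Finset.sum_eq_zero fun k _ => ?_
  rw [← add_mul, hd, zero_mul]

theorem koszul_apply (g : Metric n P) (X Y Z : VF n P) :
    koszul g X Y Z = X.deriv (flat g Y Z) + Y.deriv (flat g Z X) - Z.deriv (flat g X Y)
    + flat g (X.bracket Y) Z - flat g (Y.bracket Z) X + flat g (Z.bracket X) Y := rfl

variable [T2Space P] [SigmaCompactSpace P]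

@[simp]
theorem flat_sharp (g : Metric n P) (ξ : OneForm n P) : flat g (sharp g ξ) = ξ :=
  (LinearEquiv.ofBijective (flat g) ⟨flat_injective g, flat_surjective g⟩).apply_symm_apply ξ

@[simp]
theorem sharp_flat (g : Metric n P) (X : VF n P) : sharp g (flat g X) = X :=
  flat_injective g (flat_sharp g _)

theorem flat_sharp_right (g : Metric n P) (X : VF n P) (ξ : OneForm n P) :
    flat g X (sharp g ξ) = ξ X := by rw [flat_comm, flat_sharp]

theorem two_flat_lc (g : Metric n P) (X Y Z : VF n P) :
    2 * flat g (lc g X Y) Z = koszul g X Y Z := by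
  have h : lc g X Y + lc g X Y = sharp g (koszul g X Y) := by
    rw [lc, ← two_smul ℝ, smul_smul]; norm_num
  rw [two_mul, ← LinearMap.add_apply, ← map_add, h, flat_sharp]

theorem lc_torsion (g : Metric n P) (X Y : VF n P) :
    lc g X Y - lc g Y X = X.bracket Y := by
  refine flat_ext_two (g := g) fun Z => ?_
  rw [map_sub, LinearMap.sub_apply, mul_sub, two_flat_lc, two_flat_lc, koszul_apply, koszul_apply,
    VF.bracket_swap Y X, VF.bracket_swap X Z, VF.bracket_swap Z Y, flat_comm g Z X, flat_comm g Z Y,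
    flat_comm g Y X]
  simp only [map_neg, LinearMap.neg_apply]
  ring

/-- The Levi-Civita connection as a metric connection. -/
def lcConn (g : Metric n P) : MConn g where
  nabla := lc g
  add_left X Y Z := flat_ext_two (g := g) fun W => by
    simp only [map_add, LinearMap.add_apply, mul_add, two_flat_lc, koszul_apply, VF.add_deriv,
      VF.add_bracket, VF.bracket_add, VF.deriv_add]
    ring
  smul_left f X Z := flat_ext_two (g := g) fun W => by
    have h : 2 * flat g (f • lc g X Z) W = f * (2 * flat g (lc g X Z) W) := by
      rw [map_smul, LinearMap.smul_apply, smul_eq_mul]; ring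
    rw [h]
    simp only [two_flat_lc, koszul_apply, VF.smul_deriv, VF.smul_bracket, VF.bracket_smul,
      map_smul, map_add, map_sub, LinearMap.smul_apply, LinearMap.add_apply, LinearMap.sub_apply,
      smul_eq_mul, VF.deriv_mul, flat_comm g W X]
    ring
  add_right X Y Z := flat_ext_two (g := g) fun W => by
    simp only [map_add, LinearMap.add_apply, mul_add, two_flat_lc, koszul_apply, VF.add_deriv,
      VF.add_bracket, VF.bracket_add, VF.deriv_add]
    ring
  leibniz X f Y := flat_ext_two (g := g) fun W => by
    have h : 2 * flat g (f • lc g X Y + X.deriv f • Y) W =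
        f * (2 * flat g (lc g X Y) W) + 2 * X.deriv f * flat g Y W := by
      simp only [map_add, map_smul, LinearMap.add_apply, LinearMap.smul_apply, smul_eq_mul]; ring
    rw [h]
    simp only [two_flat_lc, koszul_apply, VF.smul_deriv, VF.smul_bracket, VF.bracket_smul,
      map_smul, map_add, map_sub, LinearMap.smul_apply, LinearMap.add_apply, LinearMap.sub_apply,
      smul_eq_mul, VF.deriv_mul, flat_comm g W X, flat_comm g Y X]
    ring
  metric X Y Z := by
    refine Fn.two_mul_cancel ?_
    rw [mul_add, flat_comm g Y (lc g X Z), two_flat_lc, two_flat_lc, koszul_apply, koszul_apply,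
      VF.bracket_swap Z Y, VF.bracket_swap X Z, VF.bracket_swap Y X, flat_comm g Z X,
      flat_comm g Z Y, flat_comm g Y X]
    simp only [map_neg, LinearMap.neg_apply]
    ring

theorem lcConn_nabla (g : Metric n P) : (lcConn g).nabla = lc g := rfl

theorem lc_metric (g : Metric n P) (X Y Z : VF n P) :
    X.deriv (flat g Y Z) = flat g (lc g X Y) Z + flat g Y (lc g X Z) := (lcConn g).metric X Y Z

theorem lc_add_left (g : Metric n P) (X Y Z : VF n P) : lc g (X + Y) Z = lc g X Z + lc g Y Z :=
  (lcConn g).add_left X Y Z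

theorem lc_add_right (g : Metric n P) (X Y Z : VF n P) : lc g X (Y + Z) = lc g X Y + lc g X Z :=
  (lcConn g).add_right X Y Z

theorem lc_smul_left (g : Metric n P) (f : Fn n P) (X Z : VF n P) :
    lc g (f • X) Z = f • lc g X Z := (lcConn g).smul_left f X Z

theorem lc_smul_right (g : Metric n P) (X : VF n P) (f : Fn n P) (Y : VF n P) :
    lc g X (f • Y) = f • lc g X Y + X.deriv f • Y := (lcConn g).leibniz X f Y

theorem lc_neg_left (g : Metric n P) (X Z : VF n P) : lc g (-X) Z = -lc g X Z :=
  map_neg (AddMonoidHom.mk' (fun X => lc g X Z) fun X Y => lc_add_left g X Y Z) X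

theorem lc_sub_left (g : Metric n P) (X Y Z : VF n P) : lc g (X - Y) Z = lc g X Z - lc g Y Z :=
  map_sub (AddMonoidHom.mk' (fun X => lc g X Z) fun X Y => lc_add_left g X Y Z) X Y

theorem lc_neg_right (g : Metric n P) (X Y : VF n P) : lc g X (-Y) = -lc g X Y :=
  map_neg (AddMonoidHom.mk' (lc g X) (lc_add_right g X)) Y

theorem lc_sub_right (g : Metric n P) (X Y Z : VF n P) : lc g X (Y - Z) = lc g X Y - lc g X Z :=
  map_sub (AddMonoidHom.mk' (lc g X) (lc_add_right g X)) Y Z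

/-- The first Bianchi identity. -/
theorem curvLC_bianchi (g : Metric n P) (X Y Z : VF n P) :
    curvLC g X Y Z + curvLC g Y Z X + curvLC g Z X Y = 0 := by
  have h1 := VF.jacobi X Y Z
  have t : ∀ A B : VF n P, lc g A B = lc g B A + A.bracket B := fun A B => by
    rw [← lc_torsion g A B]; abel
  have e1 := congrArg (lc g X) (t Y Z)
  have e2 := congrArg (lc g Y) (t Z X)
  have e3 := congrArg (lc g Z) (t X Y)
  rw [lc_add_right] at e1 e2 e3
  have f1 := t X (Y.bracket Z)
  have f2 := t Y (Z.bracket X)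
  have f3 := t Z (X.bracket Y)
  rw [VF.bracket_swap Z X, VF.bracket_swap Z (X.bracket Y)] at *
  rw [h1, VF.bracket_swap Y (- X.bracket Z)] at *
  unfold curvLC
  rw [VF.bracket_swap Z X] at *
  rw [e1, e2, e3, f1, f2, f3, VF.bracket_swap (-X.bracket Z) Y]
  have : Y.bracket (-X.bracket Z) = -Y.bracket (X.bracket Z) := by
    exact map_neg (AddMonoidHom.mk' Y.bracket Y.bracket_add) _
  rw [this]
  abel

theorem curvLC_skew (g : Metric n P) (X Y Z W : VF n P) :
    flat g (curvLC g X Y Z) W = -flat g (curvLC g X Y W) Z := by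
  have h := VF.bracket_deriv X Y (flat g Z W)
  simp only [lc_metric, VF.deriv_add] at h
  simp only [curvLC, map_sub, LinearMap.sub_apply]
  rw [flat_comm g _ Z, flat_comm g _ Z, flat_comm g _ Z]
  linear_combination -h

theorem curvLC_smul (g : Metric n P) (X Y : VF n P) (f : Fn n P) (Z : VF n P) :
    curvLC g X Y (f • Z) = f • curvLC g X Y Z := by
  simp only [curvLC, lc_smul_right, lc_add_right, VF.bracket_deriv]
  module

theorem curvLC_add (g : Metric n P) (X Y Z W : VF n P) :
    curvLC g X Y (Z + W) = curvLC g X Y Z + curvLC g X Y W := by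
  simp only [curvLC, lc_add_right]
  abel

theorem curvLC_swap (g : Metric n P) (X Y Z : VF n P) : curvLC g X Y Z = -curvLC g Y X Z := by
  simp only [curvLC]
  rw [VF.bracket_swap X Y, lc_neg_left]
  abel

/-- The frame `e_k` used in the traces of the definitions. -/
abbrev fr {n : ℕ} {P : Type*} [TopologicalSpace P]
    [ChartedSpace (EuclideanSpace ℝ (Fin n)) P] [IsManifold (𝓡 n) ∞ P] [T2Space P] (x : P)
    (k : Fin n) : VF n P := (frameAt x).e k

/-- The vector fields `g⁻¹(e^k)`. -/
abbrev cofr (g : Metric n P) (x : P) (k : Fin n) : VF n P := sharp g ((frameAt x).ε k)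

theorem dualNear_frame (g : Metric n P) (x : P) :
    ∀ᶠ y in 𝓝 x, DualAt g y (fr (n := n) x) (cofr g x) := by
  have h : ∀ᶠ y in 𝓝 x, ∀ j i : Fin n,
      (frameAt (n := n) x).ε j ((frameAt x).e i) y = if j = i then 1 else 0 :=
    Filter.eventually_all.mpr fun j => Filter.eventually_all.mpr fun i => (frameAt x).dual j i
  filter_upwards [h] with y hy i j
  rw [flat_sharp_right, hy j i]
  simp [eq_comm]

theorem dualAt_frame (g : Metric n P) (x : P) : DualAt g x (fr (n := n) x) (cofr g x) :=
  (dualNear_frame g x).self_of_nhds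

theorem ricLC_eq (g : Metric n P) (X Y : VF n P) (x : P) :
    ricLC g X Y x = ∑ k : Fin n, flat g (curvLC g (fr x k) X Y) (cofr g x k) x := by
  simp only [flat_sharp_right]
  rfl

/-- The Ricci tensor is symmetric, by the Bianchi identity and the skew-symmetry of `R(X,Y)`. -/
theorem ricLC_comm (g : Metric n P) (X Y : VF n P) (x : P) : ricLC g X Y x = ricLC g Y X x := by
  have hd := dualAt_frame g x
  have h0 : ∑ k, flat g (curvLC g X Y (fr x k)) (cofr g x k) x = 0 := by
    have h1 := trace_swap (x := x) (T := fun A B => flat g (curvLC g X Y A) B x)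
      (fun B => ⟨fun Z W => by simp [curvLC_add], fun f Z => by simp [curvLC_smul]⟩)
      (fun A => tensorAt_form x _) hd
    have h2 : ∀ k, flat g (curvLC g X Y (cofr g x k)) (fr x k) x =
        -flat g (curvLC g X Y (fr x k)) (cofr g x k) x := fun k => by rw [curvLC_skew]; rfl
    simp only [h2, Finset.sum_neg_distrib] at h1
    linarith
  rw [ricLC_eq, ricLC_eq, ← sub_eq_zero, ← Finset.sum_sub_distrib, ← neg_eq_zero,
    ← Finset.sum_neg_distrib, ← h0]
  refine Finset.sum_congr rfl fun k _ => ?_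
  have h3 := curvLC_bianchi g X Y (fr x k)
  have h4 : curvLC g X Y (fr x k) = curvLC g (fr x k) Y X - curvLC g (fr x k) X Y := by
    rw [curvLC_swap g Y (fr x k)] at h3
    rw [← sub_eq_zero, ← h3]; abel
  rw [h4, map_sub, LinearMap.sub_apply]
  simp

end MetricConnections

/-! ### The eigenbundles of `τ` -/

section Lifts

variable {n : ℕ} {P : Type*} [TopologicalSpace P] [ChartedSpace (EuclideanSpace ℝ (Fin n)) P]

/-- A sign as a constant function. -/
abbrev sg {n : ℕ} {P : Type*} [TopologicalSpace P] [ChartedSpace (EuclideanSpace ℝ (Fin n)) P]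
    (s : ℤˣ) : Fn n P := ((s : ℤ) : Fn n P)

theorem sg_one : sg 1 = (1 : Fn n P) := by simp [sg]

theorem sg_mul_sg (s : ℤˣ) : sg s * sg s = (1 : Fn n P) := by
  rcases Int.units_eq_one_or s with rfl | rfl <;> simp [sg]

theorem sg_neg (s : ℤˣ) : sg (-s) = (-sg s : Fn n P) := by
  simp [sg]

theorem sg_cancel (s : ℤˣ) {f h : Fn n P} (H : 2 * sg s * f = 2 * sg s * h) : f = h := by
  refine Fn.two_mul_cancel ?_
  have := congrArg (fun k => sg s * k) H
  linear_combination this - (2 * f - 2 * h) * sg_mul_sg (n := n) (P := P) s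

variable [IsManifold (𝓡 n) ∞ P]

theorem pair_comm (ψ ψ' : Sec n P) : pair ψ ψ' = pair ψ' ψ := add_comm _ _

theorem pair_add_left (ψ₁ ψ₂ ψ : Sec n P) : pair (ψ₁ + ψ₂) ψ = pair ψ₁ ψ + pair ψ₂ ψ := by
  simp [pair]; ring

theorem pair_add_right (ψ ψ₁ ψ₂ : Sec n P) : pair ψ (ψ₁ + ψ₂) = pair ψ ψ₁ + pair ψ ψ₂ := by
  simp [pair]; ring

theorem pair_smul_left (f : Fn n P) (ψ ψ' : Sec n P) : pair (f • ψ) ψ' = f * pair ψ ψ' := by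
  simp [pair]; ring

theorem pair_smul_right (f : Fn n P) (ψ ψ' : Sec n P) : pair ψ (f • ψ') = f * pair ψ ψ' := by
  simp [pair]; ring

theorem pair_neg_left (ψ ψ' : Sec n P) : pair (-ψ) ψ' = -pair ψ ψ' := by
  simp [pair]; ring

theorem pair_sub_left (ψ₁ ψ₂ ψ : Sec n P) : pair (ψ₁ - ψ₂) ψ = pair ψ₁ ψ - pair ψ₂ ψ := by
  simp [pair]; ring

theorem pair_sub_right (ψ ψ₁ ψ₂ : Sec n P) : pair ψ (ψ₁ - ψ₂) = pair ψ ψ₁ - pair ψ ψ₂ := by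
  simp [pair]; ring

theorem Form.map_skew (B : Form n P 2) (Y Z : VF n P) : Form.map B Y Z = -Form.map B Z Y := by
  have h := B.map_swap ![Y, Z] (i := 0) (j := 1) (by decide)
  have e : ![Y, Z] ∘ Equiv.swap (0 : Fin 2) 1 = ![Z, Y] := by
    ext i : 1; fin_cases i <;> rfl
  rw [e] at h
  exact h

theorem Form.map_apply (B : Form n P 2) (Y Z : VF n P) : Form.map B Y Z = B ![Z, Y] := rfl

/-- The bundle map of a `2`-form, as a linear map. -/
def Form.mapL (B : Form n P 2) : VF n P →ₗ[Fn n P] OneForm n P where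
  toFun := Form.map B
  map_add' Y Z := by
    ext1 W
    rw [LinearMap.add_apply, B.map_skew, B.map_skew Y, B.map_skew Z, map_add]
    ring
  map_smul' f Y := by
    ext1 W
    rw [LinearMap.smul_apply, B.map_skew, B.map_skew Y, map_smul]
    simp

theorem VF.deriv_sg_mul (X : VF n P) (s : ℤˣ) (f : Fn n P) :
    X.deriv (sg s * f) = sg s * X.deriv f := by
  rcases Int.units_eq_one_or s with rfl | rfl <;> simp [sg, VF.deriv_neg]

/-- The lift `X ↦ (X, ± g(X) + B(X))` of vector fields to the `±1` eigenbundle of `τ`. The sign is a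
unit of `ℤ`, so that both eigenbundles can be treated at once. -/
def lift (g : Metric n P) (B : Form n P 2) (s : ℤˣ) : VF n P →ₗ[Fn n P] Sec n P where
  toFun X := (X, (sg s : Fn n P) • flat g X + B.mapL X)
  map_add' X Y := by
    refine Prod.ext rfl ?_
    simp only [map_add, smul_add, Prod.snd_add]
    abel
  map_smul' f X := by
    refine Prod.ext rfl ?_
    simp only [map_smul, smul_add, Prod.smul_snd, RingHom.id_apply, smul_comm f]

variable {g : Metric n P} {B : Form n P 2}

theorem lift_fst (s : ℤˣ) (X : VF n P) : (lift g B s X).1 = X := rfl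

theorem lift_snd_apply (s : ℤˣ) (X Z : VF n P) :
    (lift g B s X).2 Z = sg s * flat g X Z + Form.map B X Z := rfl

theorem pair_lift (s t : ℤˣ) (X Y : VF n P) :
    pair (lift g B s X) (lift g B t Y) = (sg s + sg t) * flat g X Y := by
  simp only [pair, lift_fst, lift_snd_apply]
  rw [flat_comm g Y X, B.map_skew X Y]
  ring

theorem pair_lift_self (s : ℤˣ) (X Y : VF n P) :
    pair (lift g B s X) (lift g B s Y) = 2 * sg s * flat g X Y := by
  rw [pair_lift]; ring

theorem pair_lift_neg (s : ℤˣ) (X Y : VF n P) :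
    pair (lift g B s X) (lift g B (-s) Y) = 0 := by
  rw [pair_lift, sg_neg]; ring

theorem pair_lift_neg' (s : ℤˣ) (X Y : VF n P) :
    pair (lift g B (-s) X) (lift g B s Y) = 0 := by
  rw [pair_lift, sg_neg]; ring

/-- Pairings with the lifts determine a section. -/
theorem sec_ext {ψ ψ' : Sec n P}
    (h : ∀ s Z, pair ψ (lift g B s Z) = pair ψ' (lift g B s Z)) : ψ = ψ' := by
  have h1 : ψ.1 = ψ'.1 := flat_ext_two (g := g) fun Z => by
    have a := h 1 Z
    have b := h (-1) Z
    simp only [pair, lift_fst, lift_snd_apply, sg_neg] at a b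
    simp only [sg_one] at a b
    rw [flat_comm g ψ.1, flat_comm g ψ'.1]
    linear_combination a - b
  refine Prod.ext h1 (LinearMap.ext fun Z => ?_)
  have a := h 1 Z
  simp only [pair, lift_fst, h1] at a
  exact add_left_cancel a

theorem VF.deriv_pair_lift (X : VF n P) (s t : ℤˣ) (Y Z : VF n P) :
    X.deriv (pair (lift g B s Y) (lift g B t Z)) = (sg s + sg t) * X.deriv (flat g Y Z) := by
  rw [pair_lift, add_mul, VF.deriv_add, VF.deriv_sg_mul, VF.deriv_sg_mul]
  ring

/-- The Dorfman bracket of lifts, as in the Koszul formula; the field strength `H + dB` appears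
because the lifts are graphs over `B`. -/
theorem pair_dorfman_lift (H : Form n P 3) (s t u : ℤˣ) (X Y Z : VF n P) :
    pair (dorfman H (lift g B s X) (lift g B t Y)) (lift g B u Z) =
      sg t * (X.deriv (flat g Y Z) - flat g Y (X.bracket Z))
      - sg s * (Y.deriv (flat g X Z) - Z.deriv (flat g X Y) - flat g X (Y.bracket Z))
      + sg u * flat g Z (X.bracket Y) - fieldStrength H B ![X, Y, Z] := by
  have hH : Form.contract₂ H X Y Z = H ![X, Y, Z] := rfl
  have hB : fieldStrength H B ![X, Y, Z] = H ![X, Y, Z] + (X.deriv (B ![Y, Z])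
      - Y.deriv (B ![X, Z]) + Z.deriv (B ![X, Y]) - B ![X.bracket Y, Z] + B ![X.bracket Z, Y]
      - B ![Y.bracket Z, X]) := rfl
  have hl : (dorfman H (lift g B s X) (lift g B t Y)).2 Z =
      (X.deriv ((lift g B t Y).2 Z) - (lift g B t Y).2 (X.bracket Z))
      - (Y.deriv ((lift g B s X).2 Z) - Z.deriv ((lift g B s X).2 Y)
        - (lift g B s X).2 (Y.bracket Z)) - Form.contract₂ H X Y Z := rfl
  have h1 : (dorfman H (lift g B s X) (lift g B t Y)).1 = X.bracket Y := rfl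
  rw [pair, h1, lift_fst, hl, hH, hB]
  simp only [lift_snd_apply, VF.deriv_add, VF.deriv_sg_mul]
  rw [B.map_skew Y Z, B.map_skew X Z]
  simp only [Form.map_apply, VF.deriv_neg]
  have e : B ![Y, X] = -B ![X, Y] := B.map_skew X Y
  have e1 : B ![Z, X.bracket Y] = -B ![X.bracket Y, Z] := B.map_skew (X.bracket Y) Z
  have e2 : B ![Y.bracket Z, X] = -B ![X, Y.bracket Z] := B.map_skew X (Y.bracket Z)
  have e3 : B ![X.bracket Z, Y] = -B ![Y, X.bracket Z] := B.map_skew Y (X.bracket Z)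
  simp only [e, e2, e3, VF.deriv_neg]
  have e4 : B ![X.bracket Y, Z] = -B ![Z, X.bracket Y] := B.map_skew Z (X.bracket Y)
  rw [e4]
  ring

variable [T2Space P] [SigmaCompactSpace P]

/-- The Dorfman bracket of lifts in terms of the Levi-Civita connection of `g`. -/
theorem pair_dorfman_lift_lc (H : Form n P 3) (s t u : ℤˣ) (X Y Z : VF n P) :
    pair (dorfman H (lift g B s X) (lift g B t Y)) (lift g B u Z) =
      (sg t + sg u) * flat g (lc g X Y) Z - (sg s + sg u) * flat g (lc g Y X) Z
      + (sg s + sg t) * flat g (lc g Z X) Y - fieldStrength H B ![X, Y, Z] := by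
  rw [pair_dorfman_lift, ← lc_torsion g X Y, ← lc_torsion g X Z, ← lc_torsion g Y Z, lc_metric,
    lc_metric, lc_metric]
  simp only [map_sub]
  rw [flat_comm g Z (lc g X Y), flat_comm g Z (lc g Y X), flat_comm g Y (lc g Z X)]
  ring

theorem tau_eq (ψ : Sec n P) : tau g B ψ =
    (sharp g (ψ.2 - B.mapL ψ.1), flat g ψ.1 + B.mapL (sharp g (ψ.2 - B.mapL ψ.1))) := by
  have h : ∀ X, Form.map B X = B.mapL X := fun X => rfl
  refine Prod.ext ?_ ?_ <;> simp only [tau, h, map_sub] <;> abel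

theorem tau_lift (s : ℤˣ) (X : VF n P) :
    tau g B (lift g B s X) = (sg s : Fn n P) • lift g B s X := by
  have h : (lift g B s X).2 - B.mapL X = flat g ((sg s : Fn n P) • X) := by
    rw [map_smul]; exact add_sub_cancel_right _ _
  rw [tau_eq, lift_fst, h, sharp_flat]
  refine Prod.ext rfl ?_
  change _ = (sg s : Fn n P) • ((sg s : Fn n P) • flat g X + B.mapL X)
  rw [smul_add, smul_smul, sg_mul_sg, one_smul, map_smul]

/-- The eigensections of `τ` are lifts. -/
theorem eq_lift_of_tau (s : ℤˣ) {ψ : Sec n P} (h : tau g B ψ = (sg s : Fn n P) • ψ) :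
    ψ = lift g B s ψ.1 := by
  rw [tau_eq] at h
  have h1 : sharp g (ψ.2 - B.mapL ψ.1) = (sg s : Fn n P) • ψ.1 := congrArg Prod.fst h
  refine Prod.ext rfl ?_
  have h2 := congrArg (flat g) h1
  rw [flat_sharp, map_smul] at h2
  change ψ.2 = _ + _
  rw [← h2]; abel

end Lifts

/-! ### Levi-Civita connections on `E` in terms of connections on `TP` -/

section Connections

variable {n : ℕ} {P : Type*} [TopologicalSpace P] [ChartedSpace (EuclideanSpace ℝ (Fin n)) P]
  [IsManifold (𝓡 n) ∞ P] {H : Form n P 3} {g : Metric n P} {B : Form n P 2}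
  {D : Conn n P}

theorem Conn.nabla_sub_left (D : Conn n P) (ψ₁ ψ₂ ψ' : Sec n P) :
    D.nabla (ψ₁ - ψ₂) ψ' = D.nabla ψ₁ ψ' - D.nabla ψ₂ ψ' :=
  map_sub (AddMonoidHom.mk' (fun ψ => D.nabla ψ ψ') fun _ _ => D.add_left _ _ _) ψ₁ ψ₂

theorem Conn.nabla_sub_right (D : Conn n P) (ψ ψ₁ ψ₂ : Sec n P) :
    D.nabla ψ (ψ₁ - ψ₂) = D.nabla ψ ψ₁ - D.nabla ψ ψ₂ :=
  map_sub (AddMonoidHom.mk' (D.nabla ψ) (D.add_right ψ)) ψ₁ ψ₂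

variable [T2Space P] [SigmaCompactSpace P]

/-- `∇G = 0` together with metricity of the pairing says that `∇` commutes with `τ`. -/
theorem IsLeviCivita.tau_nabla (hD : IsLeviCivita H g B D) (ψ ψ' : Sec n P) :
    tau g B (D.nabla ψ ψ') = D.nabla ψ (tau g B ψ') := by
  refine sec_ext (g := g) (B := B) fun s Z => ?_
  have h1 := hD.metric ψ (lift g B s Z) ψ'
  have h2 := D.compat ψ (lift g B s Z) (tau g B ψ')
  simp only [genMetric] at h1
  rw [h1] at h2
  rw [pair_comm, pair_comm _ (lift g B s Z)]
  exact add_left_cancel h2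

/-- As `∇` commutes with `τ`, it preserves both eigenbundles. -/
theorem IsLeviCivita.nabla_lift_eq (hD : IsLeviCivita H g B D) (ψ : Sec n P) (t : ℤˣ)
    (Y : VF n P) : D.nabla ψ (lift g B t Y) = lift g B t (D.nabla ψ (lift g B t Y)).1 := by
  refine eq_lift_of_tau t ?_
  have h0 : ψ.1.deriv (sg t) = 0 := by
    have := VF.deriv_sg_mul ψ.1 t 1
    rw [mul_one] at this
    rw [this, show (1 : Fn n P) = ContMDiffMap.const 1 from rfl, VF.deriv_const, mul_zero]
  rw [hD.tau_nabla, tau_lift, D.leibniz, h0, zero_smul, add_zero]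

/-- The connection on `TP` obtained from the restriction of `∇` to a map
`Γ(V_s) × Γ(V_t) → Γ(V_t)` by identifying both eigenbundles with `TP`. -/
def IsLeviCivita.conn (hD : IsLeviCivita H g B D) (s t : ℤˣ) : MConn g where
  nabla X Y := (D.nabla (lift g B s X) (lift g B t Y)).1
  add_left X Y Z := by rw [map_add, D.add_left]; rfl
  smul_left f X Z := by rw [map_smul, D.smul_left]; rfl
  add_right X Y Z := by rw [map_add, D.add_right]; rfl
  leibniz X f Y := by rw [map_smul, D.leibniz]; rfl
  metric X Y Z := by
    have h := D.compat (lift g B s X) (lift g B t Y) (lift g B t Z)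
    rw [hD.nabla_lift_eq _ t Y, hD.nabla_lift_eq _ t Z, lift_fst, VF.deriv_pair_lift,
      pair_lift_self, pair_lift_self] at h
    refine sg_cancel t ?_
    linear_combination h

theorem IsLeviCivita.nabla_lift (hD : IsLeviCivita H g B D) (s t : ℤˣ) (X Y : VF n P) :
    D.nabla (lift g B s X) (lift g B t Y) = lift g B t ((hD.conn s t).nabla X Y) :=
  hD.nabla_lift_eq _ t Y

/-- The difference of `conn s t` and the Levi-Civita connection. -/
def IsLeviCivita.cont (hD : IsLeviCivita H g B D) (s t : ℤˣ) :
    VF n P →ₗ[Fn n P] VF n P →ₗ[Fn n P] VF n P := (hD.conn s t).diffTensor (lcConn g)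

theorem IsLeviCivita.conn_eq (hD : IsLeviCivita H g B D) (s t : ℤˣ) (X Y : VF n P) :
    (hD.conn s t).nabla X Y = lc g X Y + hD.cont s t X Y := by
  change _ = _ + (_ - lc g X Y)
  abel

theorem IsLeviCivita.cont_skew (hD : IsLeviCivita H g B D) (s t : ℤˣ) (X Y Z : VF n P) :
    flat g (hD.cont s t X Y) Z = -flat g (hD.cont s t X Z) Y := MConn.diffTensor_skew _ _ X Y Z

/-- Vanishing torsion expresses the Dorfman bracket by the connection. -/
theorem IsLeviCivita.pair_dorfman (hD : IsLeviCivita H g B D) (s t u : ℤˣ) (X Y Z : VF n P) :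
    pair (dorfman H (lift g B s X) (lift g B t Y)) (lift g B u Z) =
      (sg t + sg u) * flat g ((hD.conn s t).nabla X Y) Z
      - (sg s + sg u) * flat g ((hD.conn t s).nabla Y X) Z
      + (sg s + sg t) * flat g ((hD.conn u s).nabla Z X) Y := by
  have h := hD.torsion_free (lift g B s X) (lift g B t Y) (lift g B u Z)
  rw [torsion, hD.nabla_lift, hD.nabla_lift, hD.nabla_lift, pair_sub_left, pair_sub_left,
    pair_lift, pair_lift, pair_lift] at h
  linear_combination -h

/-- Vanishing torsion in terms of the contorsion tensors. -/
theorem IsLeviCivita.cont_torsion (hD : IsLeviCivita H g B D) (s t u : ℤˣ) (X Y Z : VF n P) :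
    (sg t + sg u) * flat g (hD.cont s t X Y) Z - (sg s + sg u) * flat g (hD.cont t s Y X) Z
      + (sg s + sg t) * flat g (hD.cont u s Z X) Y = -fieldStrength H B ![X, Y, Z] := by
  have h1 := hD.pair_dorfman s t u X Y Z
  have h2 := pair_dorfman_lift_lc (g := g) (B := B) H s t u X Y Z
  simp only [hD.conn_eq, map_add, LinearMap.add_apply] at h1
  linear_combination h2 - h1

theorem IsLeviCivita.dorfman_mixed (hD : IsLeviCivita H g B D) (s : ℤˣ) (X Y : VF n P) :
    dorfman H (lift g B s X) (lift g B (-s) Y) =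
      lift g B (-s) ((hD.conn s (-s)).nabla X Y) - lift g B s ((hD.conn (-s) s).nabla Y X) := by
  refine sec_ext (g := g) (B := B) fun u Z => ?_
  rw [hD.pair_dorfman, pair_sub_left, pair_lift, pair_lift, sg_neg]
  ring

/-- The tensor `h` with `2 g(h(X,Y),Z) = (H + dB)(X,Y,Z)`. Reading it off from a mixed connection
makes its `C^∞(P)`-linearity, hence that of `H + dB`, automatic. -/
def IsLeviCivita.flux (hD : IsLeviCivita H g B D) :
    VF n P →ₗ[Fn n P] VF n P →ₗ[Fn n P] VF n P := -hD.cont (-1) 1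

theorem IsLeviCivita.fieldStrength_eq (hD : IsLeviCivita H g B D) (X Y Z : VF n P) :
    fieldStrength H B ![X, Y, Z] = 2 * flat g (hD.flux X Y) Z := by
  have h := hD.cont_torsion (-1) 1 1 X Y Z
  simp only [sg_neg] at h
  simp only [IsLeviCivita.flux, LinearMap.neg_apply, map_neg]
  simp only [sg_one] at h
  linear_combination h

theorem IsLeviCivita.flux_skew (hD : IsLeviCivita H g B D) (X Y Z : VF n P) :
    flat g (hD.flux X Y) Z = -flat g (hD.flux X Z) Y := by
  simp only [IsLeviCivita.flux, LinearMap.neg_apply, map_neg]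
  rw [hD.cont_skew]

theorem IsLeviCivita.flux_cyclic (hD : IsLeviCivita H g B D) (X Y Z : VF n P) :
    flat g (hD.flux X Y) Z = flat g (hD.flux Y Z) X := by
  have h := hD.cont_torsion 1 1 (-1) Y Z X
  rw [hD.fieldStrength_eq] at h
  simp only [sg_neg, IsLeviCivita.flux, LinearMap.neg_apply, map_neg] at h ⊢
  simp only [sg_one] at h
  refine Fn.two_mul_cancel ?_
  linear_combination -h

/-- The mixed connections are determined by `g` and the flux. -/
theorem IsLeviCivita.conn_mixed (hD : IsLeviCivita H g B D) (s : ℤˣ) (X Y : VF n P) :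
    (hD.conn (-s) s).nabla X Y = lc g X Y - (sg s : Fn n P) • hD.flux X Y := by
  rw [hD.conn_eq, sub_eq_add_neg]
  congr 1
  refine flat_ext (g := g) fun Z => sg_cancel s ?_
  have h := hD.cont_torsion (-s) s s X Y Z
  rw [hD.fieldStrength_eq, sg_neg] at h
  rw [map_neg, map_smul, LinearMap.neg_apply, LinearMap.smul_apply, smul_eq_mul]
  linear_combination h + 2 * (flat g (hD.flux X Y) Z) * sg_mul_sg (n := n) (P := P) s

/-- Of the connection on a single eigenbundle the vanishing torsion determines only the totally skew
part. -/
theorem IsLeviCivita.cont_cyclic (hD : IsLeviCivita H g B D) (s : ℤˣ) (X Y Z : VF n P) :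
    flat g (hD.cont s s X Y) Z + flat g (hD.cont s s Y Z) X + flat g (hD.cont s s Z X) Y =
      -(sg s * flat g (hD.flux X Y) Z) := by
  have h := hD.cont_torsion s s s X Y Z
  rw [hD.fieldStrength_eq, hD.cont_skew s s Y X Z] at h
  refine sg_cancel s ?_
  linear_combination h + 2 * (flat g (hD.flux X Y) Z) * sg_mul_sg (n := n) (P := P) s

end Connections

/-! ### Traces over `E` -/

section EFrames

variable {n : ℕ} {P : Type*} [TopologicalSpace P] [ChartedSpace (EuclideanSpace ℝ (Fin n)) P]
  [IsManifold (𝓡 n) ∞ P] [T2Space P]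

theorem sum_frameE_swap {x : P} {T : Sec n P → Sec n P → ℝ} :
    ∑ l, T (frameE x l) (coframeE x l) = ∑ l, T (coframeE x l) (frameE x l) := by
  rw [Fintype.sum_sum_type, Fintype.sum_sum_type, add_comm]
  rfl

variable [SigmaCompactSpace P] {g : Metric n P} {B : Form n P 2} {x : P}

/-- Sections expand in the frame `(e_k,0), (0,e^k)`. -/
theorem TensorAt.expand_frameE (g : Metric n P) {T : Sec n P → ℝ} (hT : TensorAt n x T)
    (ψ : Sec n P) : T ψ = ∑ l, pair ψ (frameE x l) x * T (coframeE x l) := by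
  have h1 : T ψ = T (ψ.1, 0) + T (0, ψ.2) := by rw [← hT.add]; simp
  have t1 : TensorAt n x (fun X : VF n P => T (X, 0)) :=
    hT.comp (LinearMap.inl (Fn n P) (VF n P) (OneForm n P))
  have t2 : TensorAt n x (fun X : VF n P => T (0, flat g X)) :=
    hT.comp ((LinearMap.inr (Fn n P) (VF n P) (OneForm n P)).comp (flat g))
  have e1 := t1.expand (dualAt_frame g x) ψ.1
  have e2 := t2.expand (dualAt_frame g x).symm (sharp g ψ.2)
  simp only [flat_sharp, flat_sharp_right] at e1 e2
  rw [h1, e1, e2, Fintype.sum_sum_type, add_comm]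
  congr 1 <;> refine Finset.sum_congr rfl fun k _ => ?_ <;> simp [pair, frameE, coframeE]

/-- Sections expand in lifts of dual pairs. -/
theorem TensorAt.expand_lift (B : Form n P 2) {T : Sec n P → ℝ} (hT : TensorAt n x T)
    {e e' f f' : Fin n → VF n P} (he : DualAt g x e e') (hf : DualAt g x f f') (ψ : Sec n P) :
    T ψ = 1 / 2 * (∑ k, pair ψ (lift g B 1 (e' k)) x * T (lift g B 1 (e k))
      - ∑ k, pair ψ (lift g B (-1) (f' k)) x * T (lift g B (-1) (f k))) := by
  let W := sharp g (ψ.2 - B.mapL ψ.1)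
  have hW : flat g W = ψ.2 - B.mapL ψ.1 := flat_sharp _ _
  have h1 : ψ + ψ = lift g B 1 (ψ.1 + W) + lift g B (-1) (ψ.1 - W) := by
    refine Prod.ext ?_ ?_
    · change ψ.1 + ψ.1 = (ψ.1 + W) + (ψ.1 - W)
      abel
    · change ψ.2 + ψ.2 = ((sg 1 : Fn n P) • flat g (ψ.1 + W) + B.mapL (ψ.1 + W))
        + ((sg (-1) : Fn n P) • flat g (ψ.1 - W) + B.mapL (ψ.1 - W))
      rw [sg_neg, sg_one]
      simp only [map_add, map_sub, hW]
      module
  have h2 : T ψ + T ψ = T (lift g B 1 (ψ.1 + W)) + T (lift g B (-1) (ψ.1 - W)) := by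
    rw [← hT.add, ← hT.add, h1]
  have e1 := (hT.comp (lift g B 1)).expand he (ψ.1 + W)
  have e2 := (hT.comp (lift g B (-1))).expand hf (ψ.1 - W)
  have p1 : ∀ Z, pair ψ (lift g B 1 Z) = flat g (ψ.1 + W) Z := fun Z => by
    rw [map_add, hW, LinearMap.add_apply, LinearMap.sub_apply, pair, lift_snd_apply, lift_fst,
      B.map_skew Z, flat_comm g Z]
    change _ = _ + (_ - Form.map B _ _)
    simp [sg]
    ring
  have p2 : ∀ Z, pair ψ (lift g B (-1) Z) = -flat g (ψ.1 - W) Z := fun Z => by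
    rw [map_sub, hW, LinearMap.sub_apply, LinearMap.sub_apply, pair, lift_snd_apply, lift_fst,
      B.map_skew Z, flat_comm g Z]
    change _ = -(_ - (_ - Form.map B _ _))
    simp [sg]
    ring
  simp only [p1, p2]
  have e3 : ∑ k, (-flat g (ψ.1 - W) (f' k)) x * T (lift g B (-1) (f k)) =
      -∑ k, flat g (ψ.1 - W) (f' k) x * T (lift g B (-1) (f k)) := by
    rw [← Finset.sum_neg_distrib]
    exact Finset.sum_congr rfl fun k _ => neg_mul _ _
  rw [e3, ← e1, ← e2]
  linarith

/-- A trace over `E` is half the difference of the traces over `V₊` and `V₋`. -/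
theorem traceE_eq (B : Form n P 2) {T : Sec n P → Sec n P → ℝ}
    (h₁ : ∀ C, TensorAt n x (fun A => T A C)) (h₂ : ∀ A, TensorAt n x (T A))
    {e e' f f' : Fin n → VF n P} (he : DualAt g x e e') (hf : DualAt g x f f') :
    ∑ l, T (frameE x l) (coframeE x l) =
      1 / 2 * (∑ k, T (lift g B 1 (e k)) (lift g B 1 (e' k))
        - ∑ k, T (lift g B (-1) (f k)) (lift g B (-1) (f' k))) := by
  have a : ∀ l, T (frameE x l) (coframeE x l) = _ := fun l =>
    (h₁ (coframeE x l)).expand_lift B he hf (frameE x l)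
  simp only [a]
  rw [← Finset.mul_sum, Finset.sum_sub_distrib, Finset.sum_comm,
    Finset.sum_comm (f := fun l k => pair (frameE x l) (lift g B (-1) (f' k)) x * _)]
  congr 2 <;> refine Finset.sum_congr rfl fun k _ => ?_
  · rw [(h₂ (lift g B 1 (e k))).expand_frameE g (lift g B 1 (e' k))]
    exact Finset.sum_congr rfl fun l _ => by rw [pair_comm]
  · rw [(h₂ (lift g B (-1) (f k))).expand_frameE g (lift g B (-1) (f' k))]
    exact Finset.sum_congr rfl fun l _ => by rw [pair_comm]

end EFrames

/-! ### Tensoriality of the curvature -/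

section Curvature

variable {n : ℕ} {P : Type*} [TopologicalSpace P] [ChartedSpace (EuclideanSpace ℝ (Fin n)) P]
  [IsManifold (𝓡 n) ∞ P]

theorem Form.contract₂_add_left (H : Form n P 3) (X X' Y : VF n P) :
    H.contract₂ (X + X') Y = H.contract₂ X Y + H.contract₂ X' Y := by
  ext1 Z
  have h : ∀ V : VF n P, ![V, Y, Z] = Function.update ![0, Y, Z] 0 V := fun V => by
    ext i : 1; fin_cases i <;> rfl
  change H ![X + X', Y, Z] = H ![X, Y, Z] + H ![X', Y, Z]
  rw [h (X + X'), h X, h X', H.map_update_add]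

theorem Form.contract₂_smul_left (H : Form n P 3) (f : Fn n P) (X Y : VF n P) :
    H.contract₂ (f • X) Y = f • H.contract₂ X Y := by
  ext1 Z
  have h : ∀ V : VF n P, ![V, Y, Z] = Function.update ![0, Y, Z] 0 V := fun V => by
    ext i : 1; fin_cases i <;> rfl
  change H ![f • X, Y, Z] = f • H ![X, Y, Z]
  rw [h (f • X), h X, H.map_update_smul]

theorem Form.contract₂_add_right (H : Form n P 3) (X Y Y' : VF n P) :
    H.contract₂ X (Y + Y') = H.contract₂ X Y + H.contract₂ X Y' := by
  ext1 Z
  have h : ∀ V : VF n P, ![X, V, Z] = Function.update ![X, 0, Z] 1 V := fun V => by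
    ext i : 1; fin_cases i <;> rfl
  change H ![X, Y + Y', Z] = H ![X, Y, Z] + H ![X, Y', Z]
  rw [h (Y + Y'), h Y, h Y', H.map_update_add]

theorem Form.contract₂_smul_right (H : Form n P 3) (f : Fn n P) (X Y : VF n P) :
    H.contract₂ X (f • Y) = f • H.contract₂ X Y := by
  ext1 Z
  have h : ∀ V : VF n P, ![X, V, Z] = Function.update ![X, 0, Z] 1 V := fun V => by
    ext i : 1; fin_cases i <;> rfl
  change H ![X, f • Y, Z] = f • H ![X, Y, Z]
  rw [h (f • Y), h Y, H.map_update_smul]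

theorem dorfman_fst (H : Form n P 3) (ψ ψ' : Sec n P) :
    (dorfman H ψ ψ').1 = ψ.1.bracket ψ'.1 := rfl

theorem dorfman_snd_apply (H : Form n P 3) (ψ ψ' : Sec n P) (Z : VF n P) :
    (dorfman H ψ ψ').2 Z = (ψ.1.deriv (ψ'.2 Z) - ψ'.2 (ψ.1.bracket Z))
      - (ψ'.1.deriv (ψ.2 Z) - Z.deriv (ψ.2 ψ'.1) - ψ.2 (ψ'.1.bracket Z))
      - H.contract₂ ψ.1 ψ'.1 Z := rfl

theorem dorfman_add_left (H : Form n P 3) (ψ₁ ψ₂ ψ' : Sec n P) :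
    dorfman H (ψ₁ + ψ₂) ψ' = dorfman H ψ₁ ψ' + dorfman H ψ₂ ψ' := by
  refine Prod.ext (VF.add_bracket _ _ _) (LinearMap.ext fun Z => ?_)
  simp only [Prod.snd_add, LinearMap.add_apply, dorfman_snd_apply, Prod.fst_add, VF.add_deriv,
    VF.add_bracket, map_add, VF.deriv_add, H.contract₂_add_left]
  ring

theorem dorfman_add_right (H : Form n P 3) (ψ ψ₁ ψ₂ : Sec n P) :
    dorfman H ψ (ψ₁ + ψ₂) = dorfman H ψ ψ₁ + dorfman H ψ ψ₂ := by
  refine Prod.ext (VF.bracket_add _ _ _) (LinearMap.ext fun Z => ?_)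
  simp only [Prod.snd_add, LinearMap.add_apply, dorfman_snd_apply, Prod.fst_add, VF.add_deriv,
    VF.add_bracket, map_add, VF.deriv_add, H.contract₂_add_right]
  ring

theorem dorfman_smul_right (H : Form n P 3) (f : Fn n P) (ψ ψ' : Sec n P) :
    dorfman H ψ (f • ψ') = f • dorfman H ψ ψ' + ψ.1.deriv f • ψ' := by
  refine Prod.ext ?_ (LinearMap.ext fun Z => ?_)
  · change ψ.1.bracket (f • ψ'.1) = f • ψ.1.bracket ψ'.1 + ψ.1.deriv f • ψ'.1
    rw [VF.bracket_smul, add_comm]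
  · simp only [Prod.snd_add, LinearMap.add_apply, dorfman_snd_apply, Prod.smul_fst, Prod.smul_snd,
      VF.smul_deriv, VF.smul_bracket, map_smul, map_sub, LinearMap.smul_apply, smul_eq_mul,
      VF.deriv_mul, H.contract₂_smul_right]
    ring

theorem dorfman_smul_left (H : Form n P 3) (f : Fn n P) (ψ ψ' : Sec n P) :
    dorfman H (f • ψ) ψ' =
      f • dorfman H ψ ψ' - ψ'.1.deriv f • ψ + pair ψ ψ' • dMap f := by
  refine Prod.ext ?_ (LinearMap.ext fun Z => ?_)
  · change (f • ψ.1).bracket ψ'.1 = f • ψ.1.bracket ψ'.1 - ψ'.1.deriv f • ψ.1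
      + pair ψ ψ' • (0 : VF n P)
    rw [VF.smul_bracket, smul_zero, add_zero]
  · have hd : (dMap f).2 Z = Z.deriv f := rfl
    simp only [Prod.snd_add, Prod.snd_sub, LinearMap.add_apply, LinearMap.sub_apply,
      dorfman_snd_apply, Prod.smul_fst, Prod.smul_snd,
      VF.smul_deriv, VF.smul_bracket, map_smul, map_sub, LinearMap.smul_apply, smul_eq_mul,
      VF.deriv_mul, H.contract₂_smul_left, hd, pair]
    ring

variable (H : Form n P 3) (D : Conn n P)

/-- The operator `([∇_ψ,∇_ψ'] - ∇_[ψ,ψ']) φ`. -/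
def curvOp (ψ ψ' φ : Sec n P) : Sec n P :=
  D.nabla ψ (D.nabla ψ' φ) - D.nabla ψ' (D.nabla ψ φ) - D.nabla (dorfman H ψ ψ') φ

theorem curv₀_eq (φ' φ ψ ψ' : Sec n P) :
    curv₀ H D φ' φ ψ ψ' = pair φ' (curvOp H D ψ ψ' φ) := rfl

theorem curvOp_add (ψ ψ' φ₁ φ₂ : Sec n P) :
    curvOp H D ψ ψ' (φ₁ + φ₂) = curvOp H D ψ ψ' φ₁ + curvOp H D ψ ψ' φ₂ := by
  simp only [curvOp, D.add_right]
  abel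

theorem curvOp_smul (f : Fn n P) (ψ ψ' φ : Sec n P) :
    curvOp H D ψ ψ' (f • φ) = f • curvOp H D ψ ψ' φ := by
  simp only [curvOp, D.leibniz, D.add_right, dorfman_fst, VF.bracket_deriv]
  module

theorem curvOp_add_right (ψ ψ₁ ψ₂ φ : Sec n P) :
    curvOp H D ψ (ψ₁ + ψ₂) φ = curvOp H D ψ ψ₁ φ + curvOp H D ψ ψ₂ φ := by
  simp only [curvOp, dorfman_add_right, D.add_left, D.add_right]
  abel

theorem curvOp_smul_right (f : Fn n P) (ψ ψ' φ : Sec n P) :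
    curvOp H D ψ (f • ψ') φ = f • curvOp H D ψ ψ' φ := by
  simp only [curvOp, dorfman_smul_right, D.add_left, D.smul_left, D.leibniz]
  module

theorem curvOp_add_left (ψ₁ ψ₂ ψ' φ : Sec n P) :
    curvOp H D (ψ₁ + ψ₂) ψ' φ = curvOp H D ψ₁ ψ' φ + curvOp H D ψ₂ ψ' φ := by
  simp only [curvOp, dorfman_add_left, D.add_left, D.add_right]
  abel

/-- The naive curvature fails to be tensorial in its first direction because of the symmetric part
of the Dorfman bracket. -/
theorem curvOp_smul_left (f : Fn n P) (ψ ψ' φ : Sec n P) :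
    curvOp H D (f • ψ) ψ' φ = f • curvOp H D ψ ψ' φ - pair ψ ψ' • D.nabla (dMap f) φ := by
  simp only [curvOp, dorfman_smul_left, D.add_left, D.nabla_sub_left, D.smul_left, D.leibniz]
  module

/-- The naive curvature operators are skew. -/
theorem curvOp_skew (ψ ψ' φ φ' : Sec n P) :
    pair (curvOp H D ψ ψ' φ) φ' = -pair (curvOp H D ψ ψ' φ') φ := by
  have h := VF.bracket_deriv ψ.1 ψ'.1 (pair φ φ')
  have h0 := D.compat (dorfman H ψ ψ') φ φ'
  rw [dorfman_fst, h] at h0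
  simp only [D.compat, VF.deriv_add] at h0
  simp only [curvOp, pair_sub_left]
  rw [pair_comm _ φ, pair_comm _ φ, pair_comm _ φ]
  linear_combination h0

variable [T2Space P]

theorem riem_comm (φ' φ ψ ψ' : Sec n P) (x : P) :
    riem H D φ' φ ψ ψ' x = riem H D ψ' ψ φ φ' x := by
  have := sum_frameE_swap (x := x)
    (T := fun A C => pair (D.nabla A ψ) ψ' x * pair (D.nabla C φ) φ' x)
  simp only [riem]
  rw [this]
  simp only [mul_comm (pair (D.nabla (coframeE x _) ψ) ψ' x)]
  ring

theorem riem_tensor₁ (φ ψ ψ' : Sec n P) (x : P) :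
    TensorAt n x (fun φ' => riem H D φ' φ ψ ψ' x) := by
  constructor
  · intro A C
    simp only [riem, curv₀_eq, curvOp_add_right, pair_add_left, pair_add_right,
      ContMDiffMap.coe_add, Pi.add_apply, mul_add, Finset.sum_add_distrib]
    ring
  · intro f A
    simp only [riem, curv₀_eq, curvOp_smul_right, pair_smul_left, pair_smul_right,
      ContMDiffMap.coe_mul, Pi.mul_apply, mul_left_comm _ (f x), ← Finset.mul_sum, ← mul_add]

theorem riem_tensor₄ (φ' φ ψ : Sec n P) (x : P) :
    TensorAt n x (fun ψ' => riem H D φ' φ ψ ψ' x) := by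
  simp only [riem_comm H D φ' φ ψ]
  exact riem_tensor₁ H D ψ φ φ' x

theorem ric_tensor₁ (ψ' : Sec n P) (x : P) : TensorAt n x (fun ψ => ric H D ψ ψ' x) := by
  constructor
  · intro A C
    simp only [ric, (riem_tensor₄ H D _ _ _ x).add, Finset.sum_add_distrib]
  · intro f A
    simp only [ric, (riem_tensor₄ H D _ _ _ x).smul, Finset.mul_sum]

variable [SigmaCompactSpace P]

/-- The quadratic term in the Riemann tensor compensates the failure of the naive curvature to be
tensorial. -/
theorem riem_tensor₃ (g : Metric n P) (φ' φ ψ' : Sec n P) (x : P) :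
    TensorAt n x (fun ψ => riem H D φ' φ ψ ψ' x) := by
  constructor
  · intro A C
    simp only [riem, curv₀_eq, curvOp_add_left, curvOp_add, pair_add_left, pair_add_right,
      D.add_right,
      ContMDiffMap.coe_add, Pi.add_apply, add_mul, Finset.sum_add_distrib]
    ring
  · intro f A
    have h := TensorAt.expand_frameE g (x := x) (T := fun C => pair (D.nabla C φ) φ' x)
      ⟨fun _ _ => by rw [D.add_left, pair_add_left]; rfl,
        fun _ _ => by rw [D.smul_left, pair_smul_left]; rfl⟩ (dMap f)
    simp only [pair_dMap] at h
    have h2 : ∑ l, pair (D.nabla (frameE x l) (f • A)) ψ' x * pair (D.nabla (coframeE x l) φ) φ' x =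
        f x * ∑ l, pair (D.nabla (frameE x l) A) ψ' x * pair (D.nabla (coframeE x l) φ) φ' x
        + pair A ψ' x * pair (D.nabla (dMap f) φ) φ' x := by
      rw [h, Finset.mul_sum, Finset.mul_sum, ← Finset.sum_add_distrib]
      refine Finset.sum_congr rfl fun l _ => ?_
      rw [D.leibniz, pair_add_left, pair_smul_left, pair_smul_left]
      simp only [ContMDiffMap.coe_add, ContMDiffMap.coe_mul, Pi.add_apply, Pi.mul_apply]
      ring
    have h3 : curv₀ H D φ' φ (f • A) ψ' x = f x * curv₀ H D φ' φ A ψ' x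
        - pair A ψ' x * pair (D.nabla (dMap f) φ) φ' x := by
      rw [curv₀_eq, curvOp_smul_left, pair_sub_right, pair_smul_right, pair_smul_right,
        pair_comm φ' (D.nabla _ _)]
      rfl
    have h4 : curv₀ H D ψ' (f • A) φ φ' x = f x * curv₀ H D ψ' A φ φ' x := by
      rw [curv₀_eq, curvOp_smul, pair_smul_right]
      rfl
    simp only [riem]
    rw [h2, h3, h4]
    ring

theorem riem_tensor₂ (g : Metric n P) (φ' ψ ψ' : Sec n P) (x : P) :
    TensorAt n x (fun φ => riem H D φ' φ ψ ψ' x) := by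
  simp only [riem_comm H D φ' _ ψ]
  exact riem_tensor₃ H D g ψ' ψ φ' x

variable (g : Metric n P) (B : Form n P 2) {x : P} {e e' f f' : Fin n → VF n P}

theorem ric_eq (he : DualAt g x e e') (hf : DualAt g x f f') (ψ ψ' : Sec n P) :
    ric H D ψ ψ' x =
      1 / 2 * (∑ k, riem H D (lift g B 1 (e' k)) ψ' (lift g B 1 (e k)) ψ x
        - ∑ k, riem H D (lift g B (-1) (f' k)) ψ' (lift g B (-1) (f k)) ψ x) :=
  traceE_eq B (T := fun A C => riem H D C ψ' A ψ x) (fun _ => riem_tensor₃ H D g _ _ _ x)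
    (fun _ => riem_tensor₁ H D _ _ _ x) he hf

theorem ric_tensor₂ (g : Metric n P) (ψ : Sec n P) (x : P) :
    TensorAt n x (fun ψ' => ric H D ψ ψ' x) := by
  constructor
  · intro A C
    simp only [ric, (riem_tensor₂ H D g _ _ _ x).add, Finset.sum_add_distrib]
  · intro f A
    simp only [ric, (riem_tensor₂ H D g _ _ _ x).smul, Finset.mul_sum]

theorem scalE_eq (he : DualAt g x e e') (hf : DualAt g x f f') :
    scalE H D x =
      1 / 2 * (∑ k, ric H D (lift g B 1 (e' k)) (lift g B 1 (e k)) x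
        - ∑ k, ric H D (lift g B (-1) (f' k)) (lift g B (-1) (f k)) x) :=
  traceE_eq B (T := fun A C => ric H D C A x) (fun _ => ric_tensor₂ H D g _ x)
    (fun _ => ric_tensor₁ H D _ x) he hf

/-- The involution `τ` as a linear map. -/
def tauL : Sec n P →ₗ[Fn n P] Sec n P where
  toFun := tau g B
  map_add' ψ ψ' := by
    simp only [tau_eq, Prod.fst_add, Prod.snd_add, map_add, map_sub, Prod.mk_add_mk, Prod.mk.injEq]
    constructor <;> abel
  map_smul' f ψ := by
    simp only [tau_eq, Prod.smul_fst, Prod.smul_snd, map_smul, map_sub, RingHom.id_apply,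
      Prod.smul_mk, smul_add, smul_sub]

theorem scalG_eq (he : DualAt g x e e') (hf : DualAt g x f f') :
    scalG H g B D x =
      1 / 2 * (∑ k, ric H D (lift g B 1 (e' k)) (lift g B 1 (e k)) x
        + ∑ k, ric H D (lift g B (-1) (f' k)) (lift g B (-1) (f k)) x) := by
  have h := traceE_eq B (T := fun A C => ric H D (tau g B C) A x) (fun _ => ric_tensor₂ H D g _ x)
    (fun A => (ric_tensor₁ H D A x).comp (tauL g B)) he hf
  rw [scalG]
  refine h.trans ?_
  simp only [tau_lift, (ric_tensor₁ H D _ x).smul]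
  have h1 : (sg 1 : Fn n P) x = 1 := by simp [sg]
  have h2 : (sg (-1) : Fn n P) x = -1 := by simp [sg]
  simp only [h1, h2, ← Finset.mul_sum]
  ring

end Curvature

/-! ### An identity for quadratic contractions -/

section FiniteSums

theorem sum3_rot {ι : Type*} [Fintype ι] (F : ι → ι → ι → ℝ) :
    ∑ k, ∑ l, ∑ m, F k l m = ∑ k, ∑ l, ∑ m, F l m k := by
  rw [Finset.sum_comm_cycle]

theorem sum3_swap {ι : Type*} [Fintype ι] (F : ι → ι → ι → ℝ) :
    ∑ k, ∑ l, ∑ m, F k l m = ∑ k, ∑ l, ∑ m, F l k m := Finset.sum_comm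

/-- The algebraic identity behind the scalar curvature: for arrays `C` skew in the last two indices
whose cyclic sum is the totally skew array `-H`, the terms quadratic in `C` add up to a multiple of
the square of `H`. The primes stand for raised indices. -/
theorem quadratic_identity {ι : Type*} [Fintype ι] (C C' Hd Hu : ι → ι → ι → ℝ)
    (hC : ∀ k l m, C k l m = -C k m l) (hC' : ∀ k l m, C' k l m = -C' k m l)
    (hHu : ∀ k l m, Hu k l m = -Hu k m l)
    (rHu : ∀ k l m, Hu k l m = Hu l m k)
    (hcyc : ∀ k l m, C k l m + C l m k + C m k l = -Hd k l m)
    (hcyc' : ∀ k l m, C' k l m + C' l m k + C' m k l = -Hu k l m) :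
    1 / 2 * (∑ k, ∑ l, ∑ m, C k l m * C' l k m
        + ∑ k, ∑ l, ∑ m, (Hu k l m + C' m k l) * C m l k)
      - 1 / 4 * ∑ k, ∑ l, ∑ m, C m k l * C' m l k
      + 1 / 4 * ∑ k, ∑ l, ∑ m, Hd m k l * Hu m l k
      = -(1 / 6) * ∑ k, ∑ l, ∑ m, Hd k l m * Hu k l m := by
  set N := ∑ k, ∑ l, ∑ m, C k l m * C' k l m with hN
  set Q := ∑ k, ∑ l, ∑ m, C k l m * C' l k m with hQ
  set S := ∑ k, ∑ l, ∑ m, Hd k l m * Hu k l m with hS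
  set R := ∑ k, ∑ l, ∑ m, Hu k l m * C k l m with hR
  have r1 : ∀ F : ι → ι → ι → ℝ, ∑ k, ∑ l, ∑ m, F m k l = ∑ k, ∑ l, ∑ m, F k l m := fun F =>
    sum3_rot fun k l m => F m k l
  have r2 : ∀ F : ι → ι → ι → ℝ, ∑ k, ∑ l, ∑ m, F m l k = ∑ k, ∑ l, ∑ m, F k l m := fun F => by
    rw [sum3_rot fun k l m => F m l k]
    exact Finset.sum_congr rfl fun k _ => Finset.sum_comm
  have a1 : ∑ k, ∑ l, ∑ m, C m k l * C' m l k = -N := by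
    rw [r1 fun k l m => C k l m * C' k m l, hN]
    simp only [← Finset.sum_neg_distrib]
    refine Finset.sum_congr rfl fun k _ => Finset.sum_congr rfl fun l _ =>
      Finset.sum_congr rfl fun m _ => ?_
    rw [hC' k m l]; ring
  have a2 : ∑ k, ∑ l, ∑ m, Hd m k l * Hu m l k = -S := by
    rw [r1 fun k l m => Hd k l m * Hu k m l, hS]
    simp only [← Finset.sum_neg_distrib]
    refine Finset.sum_congr rfl fun k _ => Finset.sum_congr rfl fun l _ =>
      Finset.sum_congr rfl fun m _ => ?_
    rw [hHu k m l]; ring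
  have a3 : ∑ k, ∑ l, ∑ m, (Hu k l m + C' m k l) * C m l k = -R - N := by
    have := r2 fun k l m => (Hu m l k + C' k m l) * C k l m
    rw [this, hR, hN]
    simp only [← Finset.sum_neg_distrib, ← Finset.sum_sub_distrib]
    refine Finset.sum_congr rfl fun k _ => Finset.sum_congr rfl fun l _ =>
      Finset.sum_congr rfl fun m _ => ?_
    rw [hC' k m l, hHu m l k, rHu m k l]; ring
  have a4 : 3 * R = -S := by
    have b1 : R = ∑ k, ∑ l, ∑ m, Hu k l m * C l m k := by
      rw [hR, sum3_rot]
      simp only [← rHu]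
    have b2 : R = ∑ k, ∑ l, ∑ m, Hu k l m * C m k l := by
      rw [hR, ← r1]
      refine Finset.sum_congr rfl fun k _ => Finset.sum_congr rfl fun l _ =>
        Finset.sum_congr rfl fun m _ => ?_
      rw [rHu m k l]
    have b3 : R + ∑ k, ∑ l, ∑ m, Hu k l m * C l m k + ∑ k, ∑ l, ∑ m, Hu k l m * C m k l = -S := by
      rw [hR, hS]
      simp only [← Finset.sum_neg_distrib, ← Finset.sum_add_distrib]
      refine Finset.sum_congr rfl fun k _ => Finset.sum_congr rfl fun l _ =>
        Finset.sum_congr rfl fun m _ => ?_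
      linear_combination Hu k l m * hcyc k l m
    linarith
  have a5 : 3 * N - 6 * Q = S := by
    have b0 : ∑ k, ∑ l, ∑ m, (C k l m + C l m k + C m k l) * (C' k l m + C' l m k + C' m k l)
        = S := by
      rw [hS]
      refine Finset.sum_congr rfl fun k _ => Finset.sum_congr rfl fun l _ =>
        Finset.sum_congr rfl fun m _ => ?_
      rw [hcyc, hcyc']; ring
    have b1 : ∑ k, ∑ l, ∑ m, C k l m * C' l m k = -Q := by
      rw [hQ]
      simp only [← Finset.sum_neg_distrib]
      refine Finset.sum_congr rfl fun k _ => Finset.sum_congr rfl fun l _ =>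
        Finset.sum_congr rfl fun m _ => ?_
      rw [hC' l m k]; ring
    have b2 : ∑ k, ∑ l, ∑ m, C k l m * C' m k l = -Q := by
      rw [sum3_rot, hQ, sum3_swap]
      simp only [← Finset.sum_neg_distrib]
      refine Finset.sum_congr rfl fun k _ => Finset.sum_congr rfl fun l _ =>
        Finset.sum_congr rfl fun m _ => ?_
      rw [hC k m l]; ring
    have c1 : ∑ k, ∑ l, ∑ m, C l m k * C' l m k = N := (sum3_rot _).symm
    have c2 : ∑ k, ∑ l, ∑ m, C m k l * C' m k l = N := r1 fun k l m => C k l m * C' k l m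
    have c3 : ∑ k, ∑ l, ∑ m, C l m k * C' m k l = -Q := by
      rw [← b1, sum3_rot fun k l m => C k l m * C' l m k]
    have c4 : ∑ k, ∑ l, ∑ m, C l m k * C' k l m = -Q := by
      rw [← b2, sum3_rot fun k l m => C k l m * C' m k l]
    have c5 : ∑ k, ∑ l, ∑ m, C m k l * C' k l m = -Q := by
      rw [← b1, ← r1 fun k l m => C k l m * C' l m k]
    have c6 : ∑ k, ∑ l, ∑ m, C m k l * C' l m k = -Q := by
      rw [← b2, ← r1 fun k l m => C k l m * C' m k l]
    simp only [add_mul, mul_add, Finset.sum_add_distrib] at b0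
    rw [b1, b2, c1, c2, c3, c4, c5, c6] at b0
    linarith
  rw [a1, a2, a3]
  linarith

end FiniteSums

/-! ### Traces of metric connections with torsion -/

section TensorRules

variable {n : ℕ} {P : Type*} [TopologicalSpace P] [ChartedSpace (EuclideanSpace ℝ (Fin n)) P]
  [IsManifold (𝓡 n) ∞ P]

theorem tensorAt_left (g : Metric n P) (c : VF n P →ₗ[Fn n P] VF n P →ₗ[Fn n P] VF n P)
    (Y W : VF n P) (x : P) : TensorAt n x (fun A => flat g (c A Y) W x) :=
  ⟨fun Z W => by simp, fun f Z => by simp⟩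

theorem tensorAt_mid (g : Metric n P) (c : VF n P →ₗ[Fn n P] VF n P →ₗ[Fn n P] VF n P)
    (X W : VF n P) (x : P) : TensorAt n x (fun A => flat g (c X A) W x) :=
  ⟨fun Z W => by simp, fun f Z => by simp⟩

variable [T2Space P] {g : Metric n P} {c h : VF n P →ₗ[Fn n P] VF n P →ₗ[Fn n P] VF n P} {x : P}
  {e e' : Fin n → VF n P}

/-- The antisymmetrization of `c` in its first two arguments, by the cyclic identity. -/
theorem TensorAt.antisymm_expand (hc : ∀ X Y Z, flat g (c X Y) Z = -flat g (c X Z) Y)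
    (hcyc : ∀ X Y Z, flat g (c X Y) Z + flat g (c Y Z) X + flat g (c Z X) Y = -flat g (h X Y) Z)
    (he0 : DualAt g x e e') (A C : VF n P) {T : VF n P → ℝ} (hT : TensorAt n x T) :
    T (c A C - c C A) = -∑ m, (flat g (h A C) (e' m) x + flat g (c (e' m) A) C x) * T (e m) := by
  rw [hT.expand he0, ← Finset.sum_neg_distrib]
  refine Finset.sum_congr rfl fun m _ => ?_
  have a := hcyc A C (e' m)
  have b : flat g (c A C - c C A) (e' m) = -(flat g (h A C) (e' m) + flat g (c (e' m) A) C) := by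
    rw [map_sub, LinearMap.sub_apply, hc C A (e' m)]
    linear_combination a
  rw [b, ← neg_mul]
  rfl

theorem sum_quad_comp
    (hc : ∀ X Y Z, flat g (c X Y) Z = -flat g (c X Z) Y)
    (he0 : DualAt g x e e') :
    ∑ k, ∑ l, flat g (c (e' l) (c (e k) (e l))) (e' k) x =
      -∑ k, ∑ l, ∑ m, flat g (c (e k) (e l)) (e m) x * flat g (c (e' l) (e' k)) (e' m) x := by
  simp only [← Finset.sum_neg_distrib]
  refine Finset.sum_congr rfl fun k _ => Finset.sum_congr rfl fun l _ => ?_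
  rw [Finset.sum_neg_distrib, he0.contract, hc, flat_comm g (c (e k) (e l))]
  rfl

theorem sum_quad_torsion
    (hc : ∀ X Y Z, flat g (c X Y) Z = -flat g (c X Z) Y)
    (hcyc : ∀ X Y Z, flat g (c X Y) Z + flat g (c Y Z) X + flat g (c Z X) Y = -flat g (h X Y) Z)
    (he0 : DualAt g x e e') :
    ∑ k, ∑ l, flat g (c (c (e k) (e' l) - c (e' l) (e k)) (e l)) (e' k) x =
      -∑ k, ∑ l, ∑ m, (flat g (h (e' k) (e' l)) (e' m) x + flat g (c (e' m) (e' k)) (e' l) x)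
        * flat g (c (e m) (e l)) (e k) x := by
  have a : ∀ k l, flat g (c (c (e k) (e' l) - c (e' l) (e k)) (e l)) (e' k) x = _ := fun k l =>
    TensorAt.antisymm_expand hc hcyc he0 (e k) (e' l) (T := fun W => flat g (c W (e l)) (e' k) x)
      ⟨fun Z W => by simp, fun f Z => by simp⟩
  simp only [a, Finset.sum_neg_distrib]
  congr 1
  rw [Finset.sum_comm, Finset.sum_comm (f := fun k l => ∑ m,
    (flat g (h (e' k) (e' l)) (e' m) x + _) * _)]
  refine Finset.sum_congr rfl fun l _ => ?_
  rw [Finset.sum_comm, Finset.sum_comm (f := fun k m =>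
    (flat g (h (e' k) (e' l)) (e' m) x + _) * _)]
  refine Finset.sum_congr rfl fun m _ => ?_
  exact trace_swap (x := x)
    (T := fun A C => (flat g (h A (e' l)) (e' m) x + flat g (c (e' m) A) (e' l) x)
      * flat g (c (e m) (e l)) C x)
    (fun C => ((tensorAt_left g h _ _ x).add_tensor (tensorAt_mid g c _ _ x)).mul_const _)
    (fun A => (tensorAt_form x _).const_mul _) he0

end TensorRules

section Sector

theorem Fn.sum_apply {n : ℕ} {P : Type*} [TopologicalSpace P]
    [ChartedSpace (EuclideanSpace ℝ (Fin n)) P] {ι : Type*} (s : Finset ι) (f : ι → Fn n P)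
    (x : P) : (∑ i ∈ s, f i) x = ∑ i ∈ s, f i x :=
  map_sum (ContMDiffMap.evalRingHom x : Fn n P →+* ℝ) f s

variable {n : ℕ} {P : Type*} [TopologicalSpace P] [ChartedSpace (EuclideanSpace ℝ (Fin n)) P]
  [IsManifold (𝓡 n) ∞ P] [T2Space P] [SigmaCompactSpace P]

theorem tensorAt_lc (g : Metric n P) (Y W : VF n P) (x : P) :
    TensorAt n x (fun A => flat g (lc g A Y) W x) :=
  ⟨fun Z W => by simp [lc_add_left], fun f Z => by simp [lc_smul_left]⟩

/-- The Hessian `(∇_X dφ)(Y)`. -/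
def hess (g : Metric n P) (φ : Fn n P) (X Y : VF n P) : Fn n P :=
  X.deriv (Y.deriv φ) - (lc g X Y).deriv φ

theorem hess_apply (g : Metric n P) (φ : Fn n P) (X Y : VF n P) (x : P) :
    hess g φ X Y x = X.deriv (Y.deriv φ) x - (lc g X Y).deriv φ x := rfl

theorem hess_comm (g : Metric n P) (φ : Fn n P) (X Y : VF n P) : hess g φ X Y = hess g φ Y X := by
  have h1 := VF.bracket_deriv X Y φ
  rw [← lc_torsion g, VF.sub_deriv] at h1
  simp only [hess]
  linear_combination -h1

variable {g : Metric n P} {φ : Fn n P} {c h : VF n P →ₗ[Fn n P] VF n P →ₗ[Fn n P] VF n P}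

/-- The covariant derivative of a contorsion tensor with trace `-2dφ` has the Hessian as trace. -/
theorem trace_cov
    (htr : ∀ y (f f' : Fin n → VF n P), DualAt g y f f' →
      ∀ Z : VF n P, ∑ k, flat g (c (f k) Z) (f' k) y = -2 * Z.deriv φ y)
    {x : P} {e e' : Fin n → VF n P} (he : ∀ᶠ y in 𝓝 x, DualAt g y e e') (X Y : VF n P) :
    ∑ k, flat g (lc g X (c (e k) Y) - c (lc g X (e k)) Y - c (e k) (lc g X Y)) (e' k) x =
      -2 * hess g φ X Y x := by
  have h1 := (lcConn g).trace_nabla (x := x) (T := fun A C => flat g (c A Y) C x)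
    (fun C => ⟨fun Z W => by simp, fun f Z => by simp⟩) (fun A => tensorAt_form x _) he X
  have h2 : (∑ k, X.deriv (flat g (c (e k) Y) (e' k))) x = -2 * X.deriv (Y.deriv φ) x := by
    rw [← VF.deriv_sum, X.deriv_congr (h := (-2 : ℝ) • Y.deriv φ), VF.deriv_real_smul]
    · rfl
    · filter_upwards [he] with y hy
      rw [ContMDiffMap.coe_smul, Pi.smul_apply, smul_eq_mul, ← htr y e e' hy Y,
        Fn.sum_apply]
  have h3 := htr x e e' he.self_of_nhds (lc g X Y)
  have h4 : ∀ k, flat g (lc g X (c (e k) Y) - c (lc g X (e k)) Y - c (e k) (lc g X Y)) (e' k) =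
      X.deriv (flat g (c (e k) Y) (e' k)) - (flat g (c (lc g X (e k)) Y) (e' k)
        + flat g (c (e k) Y) (lc g X (e' k))) - flat g (c (e k) (lc g X Y)) (e' k) := fun k => by
    simp only [lc_metric, map_sub, LinearMap.sub_apply]
    ring
  have h5 : ∑ k, flat g (lc g X (c (e k) Y) - c (lc g X (e k)) Y - c (e k) (lc g X Y)) (e' k) x =
      (∑ k, X.deriv (flat g (c (e k) Y) (e' k))) x
      - ∑ k, (flat g (c (lc g X (e k)) Y) (e' k) x + flat g (c (e k) Y) (lc g X (e' k)) x)
      - ∑ k, flat g (c (e k) (lc g X Y)) (e' k) x := by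
    simp only [h4, Fn.sum_apply, ContMDiffMap.coe_sub, ContMDiffMap.coe_add, Pi.sub_apply,
      Pi.add_apply, Finset.sum_sub_distrib]
  simp only [lcConn_nabla] at h1
  rw [h5, h1, h2, h3, hess_apply]
  ring

/-- The same contraction with the trace taken over the first two arguments. -/
theorem trace_cov_left (hc : ∀ X Y Z, flat g (c X Y) Z = -flat g (c X Z) Y)
    (htr : ∀ y (f f' : Fin n → VF n P), DualAt g y f f' →
      ∀ Z : VF n P, ∑ k, flat g (c (f k) Z) (f' k) y = -2 * Z.deriv φ y)
    {x : P} {e e' : Fin n → VF n P} (he : ∀ᶠ y in 𝓝 x, DualAt g y e e') (X W : VF n P) :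
    ∑ k, flat g (lc g X (c (e k) (e' k)) - c (lc g X (e k)) (e' k) - c (e k) (lc g X (e' k))) W x =
      2 * hess g φ X W x := by
  have h := trace_cov htr he X W
  rw [← neg_inj, ← Finset.sum_neg_distrib]
  refine Eq.trans (Finset.sum_congr rfl fun k _ => ?_) (h.trans (by ring))
  change (-flat g _ W) x = _
  congr 1
  have e1 := lc_metric g X (c (e k) (e' k)) W
  have e2 := lc_metric g X (c (e k) W) (e' k)
  rw [hc (e k) W (e' k), VF.deriv_neg] at e2
  simp only [map_sub, LinearMap.sub_apply]
  rw [hc _ W, hc _ (lc g X W)]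
  rw [hc _ W] at e2
  linear_combination e1 + e2

/-- The commutator curvature of the connections `p = ∇ + c` and `q = ∇ - h`, with the mixed bracket
built from `∇ + h` and `∇ - h`. -/
def mixedCurv (g : Metric n P) (c h : VF n P →ₗ[Fn n P] VF n P →ₗ[Fn n P] VF n P) (A X Y : VF n P) :
    VF n P :=
  (lc g A (lc g X Y - h X Y) + c A (lc g X Y - h X Y))
  - (lc g X (lc g A Y + c A Y) - h X (lc g A Y + c A Y))
  - (lc g (lc g A X + h A X) Y - h (lc g A X + h A X) Y)
  + (lc g (lc g X A - h X A) Y + c (lc g X A - h X A) Y)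

/-- The trace of the mixed curvature: the Ricci tensor with its flux and dilaton corrections. -/
theorem trace_mixedCurv
    (hh : ∀ X Y Z, flat g (h X Y) Z = -flat g (h X Z) Y)
    (hr : ∀ X Y Z, flat g (h X Y) Z = flat g (h Y Z) X)
    (htr : ∀ y (f f' : Fin n → VF n P), DualAt g y f f' →
      ∀ Z : VF n P, ∑ k, flat g (c (f k) Z) (f' k) y = -2 * Z.deriv φ y)
    {x : P} {e e' : Fin n → VF n P} (he : ∀ᶠ y in 𝓝 x, DualAt g y e e') (X Y : VF n P) :
    ∑ k, flat g (mixedCurv g c h (e k) X Y) (e' k) x =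
      ∑ k, flat g (curvLC g (e k) X Y) (e' k) x + 2 * hess g φ X Y x
      - ∑ k, flat g (h X (e k)) (h Y (e' k)) x
      - (∑ k, flat g (lc g (e k) (h X Y) - h (lc g (e k) X) Y - h X (lc g (e k) Y)) (e' k) x
        - 2 * (h X Y).deriv φ x) := by
  have he0 := he.self_of_nhds
  have t1 := trace_cov htr he X Y
  have t2 := htr x e e' he0 (h X Y)
  have hs : ∀ A C, h A C = -h C A := fun A C => flat_ext (g := g) fun Z => by
    rw [map_neg, LinearMap.neg_apply, hr C A Z, hh A Z C, hr A C Z, hr C Z A, hr Z A C, neg_neg]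
  have t3 := trace_skew (x := x) (T := fun A C => flat g (c A Y) C x)
    (fun C => ⟨fun Z W => by simp, fun f Z => by simp⟩) (fun A => tensorAt_form x _) he0
    (b := h X) (fun A C => by rw [hh, flat_comm g A])
  have t4 : ∀ k, flat g (mixedCurv g c h (e k) X Y) (e' k) =
      flat g (curvLC g (e k) X Y) (e' k)
      - flat g (lc g X (c (e k) Y) - c (lc g X (e k)) Y - c (e k) (lc g X Y)) (e' k)
      - flat g (h X (e k)) (h Y (e' k))
      - flat g (lc g (e k) (h X Y) - h (lc g (e k) X) Y - h X (lc g (e k) Y)) (e' k)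
      - flat g (c (e k) (h X Y)) (e' k)
      - (flat g (c (h X (e k)) Y) (e' k) + flat g (c (e k) Y) (h X (e' k))) := fun k => by
    have a1 : flat g (h X (c (e k) Y)) (e' k) = -flat g (c (e k) Y) (h X (e' k)) := by
      rw [hh, flat_comm g (c (e k) Y)]
    have a2 : flat g (h (h (e k) X) Y) (e' k) = -flat g (h X (e k)) (h Y (e' k)) := by
      rw [hr, hs (e k) X, map_neg, flat_comm]
    have a3 : curvLC g (e k) X Y = lc g (e k) (lc g X Y) - lc g X (lc g (e k) Y)
        - (lc g (lc g (e k) X) Y - lc g (lc g X (e k)) Y) := by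
      rw [← lc_sub_left, lc_torsion]; rfl
    rw [a3]
    simp only [mixedCurv, lc_sub_right, lc_add_right, lc_add_left, lc_sub_left, map_add, map_sub,
      LinearMap.add_apply, LinearMap.sub_apply, a1, a2, hs X (e k), lc_neg_left, map_neg,
      LinearMap.neg_apply]
    rw [hs (e k) X]
    simp only [map_neg, LinearMap.neg_apply, lc_neg_left]
    ring
  simp only [t4, ContMDiffMap.coe_sub, ContMDiffMap.coe_add, Pi.sub_apply,
      Pi.add_apply, Finset.sum_sub_distrib, Finset.sum_add_distrib]
  rw [t1, t2, t3]
  ring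

/-- The commutator curvature of `p = ∇ + c` with the Lie bracket replaced by `p_X Y - p_Y X`. As `p`
may have torsion, this is not a tensor; in the scalar curvature the defect is absorbed by
`coeffSq`. -/
def pureCurv (g : Metric n P) (c : VF n P →ₗ[Fn n P] VF n P →ₗ[Fn n P] VF n P) (X Y Z : VF n P) :
    VF n P :=
  (lc g X (lc g Y Z + c Y Z) + c X (lc g Y Z + c Y Z))
  - (lc g Y (lc g X Z + c X Z) + c Y (lc g X Z + c X Z))
  - (lc g ((lc g X Y + c X Y) - (lc g Y X + c Y X)) Z
    + c ((lc g X Y + c X Y) - (lc g Y X + c Y X)) Z)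

/-- The full contraction of the square of the connection coefficients of `∇ + c` in the frame `e`.
It depends on the frame. -/
def coeffSq (g : Metric n P) (c : VF n P →ₗ[Fn n P] VF n P →ₗ[Fn n P] VF n P)
    (e e' : Fin n → VF n P) (x : P) : ℝ :=
  ∑ k, ∑ l, ∑ m, flat g (lc g (e m) (e k) + c (e m) (e k)) (e' l) x
    * flat g (lc g (e' m) (e l) + c (e' m) (e l)) (e' k) x

theorem coeffSq_eq (c : VF n P →ₗ[Fn n P] VF n P →ₗ[Fn n P] VF n P)
    {x : P} {e e' : Fin n → VF n P} (he : DualAt g x e e') :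
    coeffSq g c e e' x =
      ∑ k, ∑ l, ∑ m, flat g (lc g (e m) (e k)) (e' l) x * flat g (lc g (e' m) (e l)) (e' k) x
      + 2 * ∑ k, ∑ l, ∑ m, flat g (c (e' m) (e k)) (e' l) x * flat g (lc g (e m) (e l)) (e' k) x
      + ∑ k, ∑ l, ∑ m, flat g (c (e m) (e k)) (e l) x * flat g (c (e' m) (e' l)) (e' k) x := by
  have a1 : ∑ k, ∑ l, ∑ m, flat g (lc g (e m) (e k)) (e' l) x * flat g (c (e' m) (e l)) (e' k) x =
      ∑ k, ∑ l, ∑ m, flat g (c (e' m) (e k)) (e' l) x * flat g (lc g (e m) (e l)) (e' k) x := by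
    rw [Finset.sum_comm]
    exact Finset.sum_congr rfl fun k _ => Finset.sum_congr rfl fun l _ =>
      Finset.sum_congr rfl fun m _ => mul_comm _ _
  have a2 : ∑ k, ∑ l, ∑ m, flat g (c (e m) (e k)) (e' l) x * flat g (lc g (e' m) (e l)) (e' k) x =
      ∑ k, ∑ l, ∑ m, flat g (c (e' m) (e k)) (e' l) x * flat g (lc g (e m) (e l)) (e' k) x := by
    refine Finset.sum_congr rfl fun k _ => Finset.sum_congr rfl fun l _ => ?_
    exact trace_swap (x := x)
      (T := fun A C => flat g (c A (e k)) (e' l) x * flat g (lc g C (e l)) (e' k) x)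
      (fun C => (tensorAt_left g c _ _ x).mul_const _)
      (fun A => (tensorAt_lc g _ _ x).const_mul _) he
  have a3 : ∑ k, ∑ l, ∑ m, flat g (c (e m) (e k)) (e' l) x * flat g (c (e' m) (e l)) (e' k) x =
      ∑ k, ∑ l, ∑ m, flat g (c (e m) (e k)) (e l) x * flat g (c (e' m) (e' l)) (e' k) x := by
    refine Finset.sum_congr rfl fun k _ => ?_
    rw [Finset.sum_comm, Finset.sum_comm (f := fun l m => flat g (c (e m) (e k)) (e l) x * _)]
    refine Finset.sum_congr rfl fun m _ => ?_
    exact (trace_swap (x := x)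
      (T := fun A C => flat g (c (e m) (e k)) A x * flat g (c (e' m) C) (e' k) x)
      (fun C => (tensorAt_form x _).mul_const _)
      (fun A => (tensorAt_mid g c _ _ x).const_mul _) he).symm
  have a4 : ∀ a b c d : ℝ, (a + b) * (c + d) = a * c + a * d + b * c + b * d := by intros; ring
  have a5 : ∀ X Y Z, flat g (lc g X Y + c X Y) Z x = flat g (lc g X Y) Z x + flat g (c X Y) Z x :=
    fun X Y Z => by rw [map_add]; rfl
  rw [coeffSq]
  simp only [a5, a4, Finset.sum_add_distrib]
  rw [a1, a2, a3]
  ring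

/-- The curvature of `∇ + c` in terms of that of `∇` and covariant derivatives of `c`. The last term
is the one that is not tensorial. -/
theorem pureCurv_eq (X Y Z : VF n P) : pureCurv g c X Y Z = curvLC g X Y Z
      + (lc g X (c Y Z) - c (lc g X Y) Z - c Y (lc g X Z))
      - (lc g Y (c X Z) - c (lc g Y X) Z - c X (lc g Y Z))
      + c X (c Y Z) - c Y (c X Z) - c (c X Y - c Y X) Z - lc g (c X Y - c Y X) Z := by
  have a3 : curvLC g X Y Z = lc g X (lc g Y Z) - lc g Y (lc g X Z)
      - (lc g (lc g X Y) Z - lc g (lc g Y X) Z) := by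
    rw [← lc_sub_left, lc_torsion]; rfl
  rw [a3]
  simp only [pureCurv, lc_add_right, lc_add_left, lc_sub_left, map_add, map_sub,
    LinearMap.add_apply, LinearMap.sub_apply]
  abel

variable {x : P} {e e' : Fin n → VF n P}

/-! ### The scalar curvature of one eigenbundle -/

theorem sum_cov_left
    (hc : ∀ X Y Z, flat g (c X Y) Z = -flat g (c X Z) Y)
    (htr : ∀ y (f f' : Fin n → VF n P), DualAt g y f f' →
      ∀ Z : VF n P, ∑ k, flat g (c (f k) Z) (f' k) y = -2 * Z.deriv φ y)
    (he : ∀ᶠ y in 𝓝 x, DualAt g y e e') :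
    ∑ k, ∑ l, flat g (lc g (e k) (c (e' l) (e l)) - c (lc g (e k) (e' l)) (e l)
      - c (e' l) (lc g (e k) (e l))) (e' k) x = 2 * ∑ k, hess g φ (e k) (e' k) x := by
  have he' : ∀ᶠ y in 𝓝 x, DualAt g y e' e := he.mono fun y hy => hy.symm
  rw [Finset.mul_sum]
  exact Finset.sum_congr rfl fun k _ => trace_cov_left hc htr he' (e k) (e' k)

theorem sum_cov_right
    (htr : ∀ y (f f' : Fin n → VF n P), DualAt g y f f' →
      ∀ Z : VF n P, ∑ k, flat g (c (f k) Z) (f' k) y = -2 * Z.deriv φ y)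
    (he : ∀ᶠ y in 𝓝 x, DualAt g y e e') :
    ∑ k, ∑ l, flat g (lc g (e' l) (c (e k) (e l)) - c (lc g (e' l) (e k)) (e l)
      - c (e k) (lc g (e' l) (e l))) (e' k) x = -2 * ∑ k, hess g φ (e k) (e' k) x := by
  rw [Finset.sum_comm, Finset.mul_sum]
  exact Finset.sum_congr rfl fun l _ => by rw [trace_cov htr he (e' l) (e l), hess_comm]

theorem sum_quad_trace
    (hc : ∀ X Y Z, flat g (c X Y) Z = -flat g (c X Z) Y)
    (htr : ∀ y (f f' : Fin n → VF n P), DualAt g y f f' →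
      ∀ Z : VF n P, ∑ k, flat g (c (f k) Z) (f' k) y = -2 * Z.deriv φ y)
    (he0 : DualAt g x e e') :
    ∑ k, ∑ l, flat g (c (e k) (c (e' l) (e l))) (e' k) x =
      -4 * (sharp g (diff φ)).deriv φ x := by
  rw [Finset.sum_comm]
  have a : ∀ l, ∑ k, flat g (c (e k) (c (e' l) (e l))) (e' k) x =
      2 * flat g (c (e' l) (sharp g (diff φ))) (e l) x := fun l => by
    rw [htr x e e' he0, hc, flat_sharp_right]
    simp [diff]
  simp only [a]
  rw [← Finset.mul_sum, htr x e' e he0.symm]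
  ring

theorem sum_lc_torsion
    (hc : ∀ X Y Z, flat g (c X Y) Z = -flat g (c X Z) Y)
    (hr : ∀ X Y Z, flat g (h X Y) Z = flat g (h Y Z) X)
    (hcyc : ∀ X Y Z, flat g (c X Y) Z + flat g (c Y Z) X + flat g (c Z X) Y = -flat g (h X Y) Z)
    (he0 : DualAt g x e e') :
    ∑ k, ∑ l, flat g (lc g (c (e k) (e' l) - c (e' l) (e k)) (e l)) (e' k) x =
      -(∑ k, ∑ l, ∑ m, flat g (h (e' m) (e k)) (e' l) x * flat g (lc g (e m) (e l)) (e' k) x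
        + ∑ k, ∑ l, ∑ m, flat g (c (e' m) (e k)) (e' l) x
          * flat g (lc g (e m) (e l)) (e' k) x) := by
  have a : ∀ k l, flat g (lc g (c (e k) (e' l) - c (e' l) (e k)) (e l)) (e' k) x = _ := fun k l =>
    TensorAt.antisymm_expand hc hcyc he0 (e k) (e' l) (T := fun W => flat g (lc g W (e l)) (e' k) x)
      ⟨fun Z W => by simp [lc_add_left], fun f Z => by simp [lc_smul_left]⟩
  simp only [a, ← Finset.sum_add_distrib, ← Finset.sum_neg_distrib]
  refine Finset.sum_congr rfl fun k _ => Finset.sum_congr rfl fun l _ =>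
    Finset.sum_congr rfl fun m _ => ?_
  rw [hr (e' m)]
  ring

/-- The scalar curvature of one eigenbundle: the scalar curvature of `g` with its flux and dilaton
corrections. The derivatives of the frame cancel, as do the terms quadratic in the part of `c` not
determined by the flux. -/
theorem scalar_contraction
    (hc : ∀ X Y Z, flat g (c X Y) Z = -flat g (c X Z) Y)
    (hh : ∀ X Y Z, flat g (h X Y) Z = -flat g (h X Z) Y)
    (hr : ∀ X Y Z, flat g (h X Y) Z = flat g (h Y Z) X)
    (hcyc : ∀ X Y Z, flat g (c X Y) Z + flat g (c Y Z) X + flat g (c Z X) Y = -flat g (h X Y) Z)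
    (htr : ∀ y (f f' : Fin n → VF n P), DualAt g y f f' →
      ∀ Z : VF n P, ∑ k, flat g (c (f k) Z) (f' k) y = -2 * Z.deriv φ y)
    (he : ∀ᶠ y in 𝓝 x, DualAt g y e e') :
    1 / 2 * ∑ k, ∑ l, flat g (pureCurv g c (e k) (e' l) (e l)) (e' k) x
      - 1 / 4 * coeffSq g c e e' x + 1 / 4 * coeffSq g (-h) e e' x =
    1 / 2 * ∑ k, ∑ l, flat g (curvLC g (e k) (e' l) (e l)) (e' k) x
      + 2 * ∑ k, hess g φ (e k) (e' k) x - 2 * (sharp g (diff φ)).deriv φ x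
      - 1 / 6 * ∑ k, ∑ l, ∑ m, flat g (h (e k) (e l)) (e m) x * flat g (h (e' k) (e' l)) (e' m) x
      := by
  have he0 := he.self_of_nhds
  have quad := quadratic_identity
    (fun k l m => flat g (c (e k) (e l)) (e m) x) (fun k l m => flat g (c (e' k) (e' l)) (e' m) x)
    (fun k l m => flat g (h (e k) (e l)) (e m) x) (fun k l m => flat g (h (e' k) (e' l)) (e' m) x)
    (fun k l m => by rw [hc]; rfl) (fun k l m => by rw [hc]; rfl) (fun k l m => by rw [hh]; rfl)
    (fun k l m => by rw [hr])
    (fun k l m => congrArg (fun f : Fn n P => f x) (hcyc (e k) (e l) (e m)))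
    (fun k l m => congrArg (fun f : Fn n P => f x) (hcyc (e' k) (e' l) (e' m)))
  have hP : ∀ X Y Z W, flat g (pureCurv g c X Y Z) W x = flat g (curvLC g X Y Z) W x
      + flat g (lc g X (c Y Z) - c (lc g X Y) Z - c Y (lc g X Z)) W x
      - flat g (lc g Y (c X Z) - c (lc g Y X) Z - c X (lc g Y Z)) W x
      + flat g (c X (c Y Z)) W x - flat g (c Y (c X Z)) W x - flat g (c (c X Y - c Y X) Z) W x
      - flat g (lc g (c X Y - c Y X) Z) W x := fun X Y Z W => by
    have hT := tensorAt_form x (flat g W)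
    simp only [flat_comm g _ W, pureCurv_eq]
    rw [hT.sub, hT.sub, hT.sub, hT.add, hT.sub, hT.add]
  simp only [hP, Finset.sum_sub_distrib, Finset.sum_add_distrib]
  rw [sum_cov_left hc htr he, sum_cov_right htr he, sum_quad_trace hc htr he0,
    sum_quad_comp hc he0, sum_quad_torsion hc hcyc he0, sum_lc_torsion hc hr hcyc he0,
    coeffSq_eq c he0, coeffSq_eq (-h) he0]
  simp only [LinearMap.neg_apply, map_neg, ContMDiffMap.coe_neg, Pi.neg_apply, neg_mul, mul_neg,
    neg_neg, Finset.sum_neg_distrib]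
  linear_combination quad

end Sector

/-! ### The trace of the contorsion -/

section Dilaton

theorem Fn.ofNat_apply {n : ℕ} {P : Type*} [TopologicalSpace P]
    [ChartedSpace (EuclideanSpace ℝ (Fin n)) P] (k : ℕ) [k.AtLeastTwo] (x : P) :
    (ofNat(k) : Fn n P) x = ofNat(k) :=
  map_ofNat (ContMDiffMap.evalRingHom x : Fn n P →+* ℝ) k

theorem sg_apply {n : ℕ} {P : Type*} [TopologicalSpace P]
    [ChartedSpace (EuclideanSpace ℝ (Fin n)) P] (s : ℤˣ) (x : P) :
    (sg s : Fn n P) x = ((s : ℤ) : ℝ) :=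
  map_intCast (ContMDiffMap.evalRingHom x : Fn n P →+* ℝ) s

variable {n : ℕ} {P : Type*} [TopologicalSpace P] [ChartedSpace (EuclideanSpace ℝ (Fin n)) P]
  [IsManifold (𝓡 n) ∞ P] {H : Form n P 3} {g : Metric n P} {B : Form n P 2} {D : Conn n P}
  {φ : Fn n P}

theorem lift_sub_lift (A : VF n P) :
    ((0, flat g A) : Sec n P) + (0, flat g A) = lift g B 1 A - lift g B (-1) A := by
  refine Prod.ext ?_ ?_
  · change (0 : VF n P) + 0 = A - A
    rw [sub_self, add_zero]
  · change flat g A + flat g A = ((sg 1 : Fn n P) • flat g A + B.mapL A)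
      - ((sg (-1) : Fn n P) • flat g A + B.mapL A)
    rw [sg_neg, sg_one]
    module

variable [T2Space P] [SigmaCompactSpace P]

/-- A covector that kills all gradients at a point is zero. -/
theorem TensorAt.eq_zero_of_grad {x : P} {T : VF n P → ℝ} (hT : TensorAt n x T)
    (h : ∀ f : Fn n P, T (sharp g (diff f)) = 0) (Z : VF n P) : T Z = 0 := by
  have he := dualAt_frame g x
  let W : VF n P := ∑ k, (ContMDiffMap.const (T (fr x k)) : Fn n P) • cofr g x k
  have hW : ∀ Z, T Z = flat g W Z x := fun Z => by
    rw [hT.expand he Z]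
    simp only [W, map_sum, map_smul, LinearMap.sum_apply, LinearMap.smul_apply, smul_eq_mul,
      Fn.sum_apply]
    refine Finset.sum_congr rfl fun k _ => ?_
    rw [flat_comm g Z, mul_comm]
    rfl
  have hW0 : W x = 0 := W.eq_zero_of_deriv x fun f => by
    have := h f
    rwa [hW, flat_sharp_right] at this
  rw [hW, flat_comm, (tensorAt_form x (flat g Z)).congr (W := 0) hW0, map_zero]
  rfl

/-- Twice a covector is the difference of two lifts, so `∇` on covectors is an alternating sum over
signs, in which the Levi-Civita connection and the flux cancel. -/
theorem IsLeviCivita.pair_nabla_covector (hD : IsLeviCivita H g B D) (A X Y : VF n P) :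
    8 * pair (D.nabla (0, flat g A) (0, flat g X)) (0, flat g Y) =
      2 * (flat g (hD.cont 1 1 A X) Y + flat g (hD.cont (-1) (-1) A X) Y) := by
  have h1 : 8 * pair (D.nabla (0, flat g A) (0, flat g X)) (0, flat g Y) =
      pair (D.nabla ((0, flat g A) + (0, flat g A)) ((0, flat g X) + (0, flat g X)))
        ((0, flat g Y) + (0, flat g Y)) := by
    simp only [D.add_left, D.add_right, pair_add_left, pair_add_right]
    ring
  have e1 := hD.conn_mixed 1 A X
  have e2 := hD.conn_mixed (-1) A X
  rw [neg_neg] at e2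
  rw [h1, lift_sub_lift (B := B), lift_sub_lift (B := B), lift_sub_lift (B := B)]
  simp only [D.nabla_sub_left, D.nabla_sub_right, pair_sub_left, pair_sub_right, hD.nabla_lift,
    pair_lift, e1, e2]
  simp only [hD.conn_eq, map_add, map_sub, map_smul, LinearMap.add_apply, LinearMap.sub_apply,
    LinearMap.smul_apply, smul_eq_mul, sg_neg]
  rw [sg_one]
  ring

theorem IsLeviCivita.pair_nabla_lift_covector (hD : IsLeviCivita H g B D) (s : ℤˣ)
    (A X Y : VF n P) :
    pair (D.nabla (lift g B s A) (0, flat g X)) (lift g B s Y) =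
      flat g ((hD.conn s s).nabla A X) Y := by
  refine Fn.two_mul_cancel ?_
  have h1 : 2 * pair (D.nabla (lift g B s A) (0, flat g X)) (lift g B s Y) =
      pair (D.nabla (lift g B s A) ((0, flat g X) + (0, flat g X))) (lift g B s Y) := by
    simp only [D.add_right, pair_add_left]
    ring
  rw [h1, lift_sub_lift (B := B)]
  simp only [D.nabla_sub_right, pair_sub_left, hD.nabla_lift, pair_lift]
  rcases Int.units_eq_one_or s with rfl | rfl <;>
    · simp only [sg_neg, sg_one]
      ring

/-- Up to constant factors, the characteristic vector field is the difference of the traces of the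
two contorsion tensors and `dφ` is their sum: if `X_∇ = 0`, both traces are `-2dφ`. -/
theorem IsLeviCivita.trace_cont (hD : IsLeviCivita H g B D) (hX : ∀ f x, charField D f x = 0)
    (hφ : ∀ (Z : VF n P) x, Z.deriv φ x = dilatonForm g D Z x) (s : ℤˣ)
    (x : P) (e e' : Fin n → VF n P) (he : DualAt g x e e') (Z : VF n P) :
    ∑ k, flat g (hD.cont s s (e k) Z) (e' k) x = -2 * Z.deriv φ x := by
  have hfr := dualAt_frame g x
  have hdiff : ∀ Z, ∑ k, flat g (hD.cont 1 1 (fr x k) Z) (cofr g x k) x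
      - ∑ k, flat g (hD.cont (-1) (-1) (fr x k) Z) (cofr g x k) x = 0 := by
    intro Z
    refine TensorAt.eq_zero_of_grad (g := g) (x := x) (T := fun Z =>
      ∑ k, flat g (hD.cont 1 1 (fr x k) Z) (cofr g x k) x
      - ∑ k, flat g (hD.cont (-1) (-1) (fr x k) Z) (cofr g x k) x) ⟨fun Z W => ?_, fun f Z => ?_⟩
      (fun f => ?_) Z
    · simp only [map_add, LinearMap.add_apply, ContMDiffMap.coe_add, Pi.add_apply,
        Finset.sum_add_distrib]
      ring
    · simp only [map_smul, LinearMap.smul_apply, smul_eq_mul, ContMDiffMap.coe_mul, Pi.mul_apply,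
        ← Finset.mul_sum]
      ring
    · have h0 := hX f x
      rw [charField, divergence, traceE_eq B (T := fun A C => pair (D.nabla A (dMap f)) C x)
        (fun C => ⟨fun _ _ => by rw [D.add_left, pair_add_left]; rfl,
          fun _ _ => by rw [D.smul_left, pair_smul_left]; rfl⟩)
        (fun A => ⟨fun _ _ => by rw [pair_add_right]; rfl,
          fun _ _ => by rw [pair_smul_right]; rfl⟩) hfr hfr] at h0
      have hd : dMap f = ((0, flat g (sharp g (diff f))) : Sec n P) := by rw [flat_sharp]; rfl
      simp only [hd, hD.pair_nabla_lift_covector, hD.conn_eq, map_add, LinearMap.add_apply,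
        ContMDiffMap.coe_add, Pi.add_apply, Finset.sum_add_distrib] at h0
      linarith
  have hsum : ∑ k, flat g (hD.cont 1 1 (fr x k) Z) (cofr g x k) x
      + ∑ k, flat g (hD.cont (-1) (-1) (fr x k) Z) (cofr g x k) x = -4 * Z.deriv φ x := by
    rw [hφ, dilatonForm, ← Finset.sum_add_distrib, Finset.mul_sum]
    have hsw := trace_swap (x := x) (T := fun A C => flat g (hD.cont 1 1 A Z) C x
      + flat g (hD.cont (-1) (-1) A Z) C x)
      (fun C => (tensorAt_left g _ _ _ x).add_tensor (tensorAt_left g _ _ _ x))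
      (fun A => (tensorAt_form x _).add_tensor (tensorAt_form x _)) hfr
    rw [hsw]
    refine Finset.sum_congr rfl fun k _ => ?_
    have h1 := hD.pair_nabla_covector (cofr g x k) (fr x k) Z
    rw [flat_sharp, hD.cont_skew 1 1 _ (fr x k), hD.cont_skew (-1) (-1) _ (fr x k)] at h1
    have h4 := congrArg (fun f : Fn n P => f x) h1
    simp only [ContMDiffMap.coe_mul, Pi.mul_apply, Fn.ofNat_apply, ContMDiffMap.coe_add,
      ContMDiffMap.coe_neg, Pi.add_apply, Pi.neg_apply] at h4
    linarith
  have hd := hdiff Z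
  rw [trace_eq (x := x) (T := fun A C => flat g (hD.cont s s A Z) C x)
    (fun C => tensorAt_left g _ _ _ x) (fun A => tensorAt_form x _) he hfr]
  rcases Int.units_eq_one_or s with rfl | rfl <;> linarith

end Dilaton

/-! ### The curvature on the eigenbundles -/

section CurvatureOfLifts

variable {n : ℕ} {P : Type*} [TopologicalSpace P] [ChartedSpace (EuclideanSpace ℝ (Fin n)) P]
  [IsManifold (𝓡 n) ∞ P] [T2Space P] [SigmaCompactSpace P]
  {H : Form n P 3} {g : Metric n P} {B : Form n P 2} {D : Conn n P}

/-- The flux with the sign with which it enters the mixed connections on `V_s`. -/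
abbrev IsLeviCivita.sflux (hD : IsLeviCivita H g B D) (s : ℤˣ) :
    VF n P →ₗ[Fn n P] VF n P →ₗ[Fn n P] VF n P := (sg s : Fn n P) • hD.flux

theorem IsLeviCivita.conn_neg_left (hD : IsLeviCivita H g B D) (s : ℤˣ) (X Y : VF n P) :
    (hD.conn (-s) s).nabla X Y = lc g X Y - hD.sflux s X Y := hD.conn_mixed s X Y

theorem IsLeviCivita.conn_neg_right (hD : IsLeviCivita H g B D) (s : ℤˣ) (X Y : VF n P) :
    (hD.conn s (-s)).nabla X Y = lc g X Y + hD.sflux s X Y := by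
  have h := hD.conn_mixed (-s) X Y
  rw [neg_neg] at h
  rw [h, sg_neg, neg_smul, sub_neg_eq_add]
  rfl

/-- The curvature of `V_s` in mixed directions. -/
theorem IsLeviCivita.curvOp_mixed (hD : IsLeviCivita H g B D) (s : ℤˣ) (A X Y : VF n P) :
    curvOp H D (lift g B s A) (lift g B (-s) X) (lift g B s Y) =
      lift g B s (mixedCurv g (hD.cont s s) (hD.sflux s) A X Y) := by
  simp only [curvOp, hD.dorfman_mixed, D.nabla_sub_left, hD.nabla_lift, hD.conn_neg_left,
    hD.conn_neg_right, hD.conn_eq s s, ← map_sub]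
  congr 1
  simp only [mixedCurv]
  abel

theorem IsLeviCivita.curvOp_mixed_swap (hD : IsLeviCivita H g B D) (s : ℤˣ) (A X Y : VF n P) :
    curvOp H D (lift g B (-s) X) (lift g B s A) (lift g B s Y) =
      -lift g B s (mixedCurv g (hD.cont s s) (hD.sflux s) A X Y) := by
  rw [← hD.curvOp_mixed]
  have h := hD.dorfman_mixed (-s) X A
  rw [neg_neg] at h
  simp only [curvOp, hD.dorfman_mixed, h, D.nabla_sub_left]
  abel

/-- The curvature operators preserve the eigenbundles. -/
theorem IsLeviCivita.pair_curvOp_neg (hD : IsLeviCivita H g B D) (ψ ψ' : Sec n P) (s : ℤˣ)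
    (X Y : VF n P) : pair (lift g B (-s) X) (curvOp H D ψ ψ' (lift g B s Y)) = 0 := by
  have h : ∃ W, curvOp H D ψ ψ' (lift g B s Y) = lift g B s W := by
    obtain ⟨W₁, h₁⟩ : ∃ W, D.nabla ψ (lift g B s Y) = lift g B s W := ⟨_, hD.nabla_lift_eq ψ s Y⟩
    obtain ⟨W₂, h₂⟩ : ∃ W, D.nabla ψ' (lift g B s Y) = lift g B s W := ⟨_, hD.nabla_lift_eq ψ' s Y⟩
    rw [curvOp, h₁, h₂, hD.nabla_lift_eq ψ s W₂, hD.nabla_lift_eq ψ' s W₁,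
      hD.nabla_lift_eq (dorfman H ψ ψ') s Y, ← map_sub, ← map_sub]
    exact ⟨_, rfl⟩
  obtain ⟨W, hW⟩ := h
  rw [hW, pair_lift_neg']

theorem IsLeviCivita.pair_nabla_neg (hD : IsLeviCivita H g B D) (ψ : Sec n P) (s : ℤˣ)
    (X Y : VF n P) : pair (D.nabla ψ (lift g B s Y)) (lift g B (-s) X) = 0 := by
  rw [hD.nabla_lift_eq, pair_lift_neg]

theorem IsLeviCivita.riem_mixed₁ (hD : IsLeviCivita H g B D) (s : ℤˣ) (A C X Y : VF n P) (x : P) :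
    riem H D (lift g B s C) (lift g B s Y) (lift g B s A) (lift g B (-s) X) x =
      ((s : ℤ) : ℝ) * flat g (mixedCurv g (hD.cont s s) (hD.sflux s) A X Y) C x := by
  have h1 : curv₀ H D (lift g B s C) (lift g B s Y) (lift g B s A) (lift g B (-s) X) x =
      2 * ((s : ℤ) : ℝ) * flat g (mixedCurv g (hD.cont s s) (hD.sflux s) A X Y) C x := by
    rw [curv₀_eq, hD.curvOp_mixed, pair_lift_self, flat_comm g C]
    simp only [ContMDiffMap.coe_mul, Pi.mul_apply, Fn.ofNat_apply, sg_apply]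
  simp only [riem]
  rw [h1, curv₀_eq, hD.pair_curvOp_neg]
  simp only [hD.pair_nabla_neg]
  simp
  ring

theorem IsLeviCivita.riem_mixed₂ (hD : IsLeviCivita H g B D) (s : ℤˣ) (A C X Y : VF n P) (x : P) :
    riem H D (lift g B s A) (lift g B (-s) Y) (lift g B s C) (lift g B s X) x =
      ((s : ℤ) : ℝ) * flat g (mixedCurv g (hD.cont s s) (hD.sflux s) A Y X) C x := by
  have h1 : curv₀ H D (lift g B s X) (lift g B s C) (lift g B (-s) Y) (lift g B s A) x =
      2 * ((s : ℤ) : ℝ) * flat g (mixedCurv g (hD.cont s s) (hD.sflux s) A Y X) C x := by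
    rw [curv₀_eq, pair_comm, curvOp_skew, hD.curvOp_mixed_swap, pair_neg_left, neg_neg,
      pair_lift_self]
    simp only [ContMDiffMap.coe_mul, Pi.mul_apply, Fn.ofNat_apply, sg_apply]
  have h2 := hD.pair_curvOp_neg (lift g B s C) (lift g B s X) (-s) A Y
  have h3 := fun ψ => hD.pair_nabla_neg ψ (-s) A Y
  rw [neg_neg] at h2
  simp only [neg_neg] at h3
  simp only [riem]
  rw [h1, curv₀_eq, h2]
  simp only [h3]
  simp
  ring

/-- The Riemann tensor vanishes when both skew pairs mix the eigenbundles. -/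
theorem IsLeviCivita.riem_opposite (hD : IsLeviCivita H g B D) (s : ℤˣ) (A C X Y : VF n P) (x : P) :
    riem H D (lift g B (-s) C) (lift g B s X) (lift g B (-s) A) (lift g B s Y) x = 0 := by
  have h2 := hD.pair_curvOp_neg (lift g B s X) (lift g B (-s) C) (-s) Y A
  have h3 := fun ψ => hD.pair_nabla_neg ψ (-s) Y A
  simp only [neg_neg] at h2 h3
  simp only [riem]
  rw [curv₀_eq, curv₀_eq, hD.pair_curvOp_neg, h2]
  simp only [h3]
  simp

/-- The mixed Ricci tensor is an average of the traces of the two mixed curvatures. -/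
theorem IsLeviCivita.ric_mixed (hD : IsLeviCivita H g B D) (X Y : VF n P) (x : P) :
    ric H D (lift g B 1 X) (lift g B (-1) Y) x =
      1 / 2 * (∑ k, flat g (mixedCurv g (hD.cont 1 1) (hD.sflux 1) (fr x k) Y X) (cofr g x k) x
        + ∑ k, flat g (mixedCurv g (hD.cont (-1) (-1)) (hD.sflux (-1)) (fr x k) X Y)
          (cofr g x k) x) := by
  have he := dualAt_frame g x
  rw [ric_eq H D g B he.symm he]
  have h1 : ∀ k, riem H D (lift g B (-1) (cofr g x k)) (lift g B (-1) Y) (lift g B (-1) (fr x k))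
      (lift g B 1 X) x = -flat g (mixedCurv g (hD.cont (-1) (-1)) (hD.sflux (-1)) (fr x k) X Y)
          (cofr g x k) x := fun k => by
    have := hD.riem_mixed₁ (-1) (fr x k) (cofr g x k) X Y x
    rw [neg_neg] at this
    rw [this]
    simp
  simp only [hD.riem_mixed₂, h1, Finset.sum_neg_distrib, Units.val_one, Int.cast_one, one_mul]
  ring

/-- The Dorfman bracket of two sections of `V_s` has components in both eigenbundles, which
contribute the quadratic terms. -/
theorem IsLeviCivita.pair_curvOp_pure (hD : IsLeviCivita H g B D) (s : ℤˣ) (X Y Z C : VF n P)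
    {x : P} {e e' : Fin n → VF n P} (he : DualAt g x e e') :
    pair (lift g B s C) (curvOp H D (lift g B s X) (lift g B s Y) (lift g B s Z)) x =
      2 * ((s : ℤ) : ℝ) * (flat g (pureCurv g (hD.cont s s) X Y Z) C x
        - ∑ m, flat g ((hD.conn s s).nabla (e' m) X) Y x
          * flat g ((hD.conn s s).nabla (e m) Z) C x
        + ∑ m, flat g ((hD.conn (-s) s).nabla (e' m) X) Y x
          * flat g ((hD.conn (-s) s).nabla (e m) Z) C x) := by
  set σ : ℝ := ((s : ℤ) : ℝ) with hσ
  have hσ2 : σ * σ = 1 := by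
    rcases Int.units_eq_one_or s with rfl | rfl <;> simp [hσ]
  have hT : TensorAt n x (fun ψ : Sec n P => pair (D.nabla ψ (lift g B s Z)) (lift g B s C) x) :=
    ⟨fun _ _ => by rw [D.add_left, pair_add_left]; rfl,
      fun _ _ => by rw [D.smul_left, pair_smul_left]; rfl⟩
  have hexp : ∀ ψ, pair (D.nabla ψ (lift g B s Z)) (lift g B s C) x =
      1 / 2 * σ * (∑ k, pair ψ (lift g B s (e' k)) x *
          pair (D.nabla (lift g B s (e k)) (lift g B s Z)) (lift g B s C) x
        - ∑ k, pair ψ (lift g B (-s) (e' k)) x *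
          pair (D.nabla (lift g B (-s) (e k)) (lift g B s Z)) (lift g B s C) x) := by
    intro ψ
    have := hT.expand_lift B he he ψ
    rw [this]
    rcases Int.units_eq_one_or s with rfl | rfl
    · simp [hσ]
    · simp [hσ]; ring
  have hp := hexp (dorfman H (lift g B s X) (lift g B s Y))
  have hpp : ∀ W, flat g ((hD.conn s s).nabla W Z) C x =
      ∑ k, flat g W (e' k) x * flat g ((hD.conn s s).nabla (e k) Z) C x := fun W =>
    TensorAt.expand (T := fun W => flat g ((hD.conn s s).nabla W Z) C x)
      ⟨fun _ _ => by rw [MConn.add_left, map_add]; rfl,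
        fun _ _ => by rw [MConn.smul_left, map_smul]; rfl⟩ he W
  have hW := hpp ((hD.conn s s).nabla X Y - (hD.conn s s).nabla Y X)
  have h2 : ∀ k, pair (dorfman H (lift g B s X) (lift g B s Y)) (lift g B s (e' k)) x =
      2 * σ * (flat g ((hD.conn s s).nabla X Y - (hD.conn s s).nabla Y X) (e' k) x
        + flat g ((hD.conn s s).nabla (e' k) X) Y x) := fun k => by
    rw [hD.pair_dorfman, map_sub]
    simp only [ContMDiffMap.coe_sub, ContMDiffMap.coe_add, ContMDiffMap.coe_mul, Pi.sub_apply,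
      Pi.add_apply, Pi.mul_apply, LinearMap.sub_apply, sg_apply]
    ring
  have h3 : ∀ k, pair (dorfman H (lift g B s X) (lift g B s Y)) (lift g B (-s) (e' k)) x =
      2 * σ * flat g ((hD.conn (-s) s).nabla (e' k) X) Y x := fun k => by
    rw [hD.pair_dorfman, sg_neg]
    simp only [ContMDiffMap.coe_sub, ContMDiffMap.coe_add, ContMDiffMap.coe_mul, Pi.sub_apply,
      Pi.add_apply, Pi.mul_apply, ContMDiffMap.coe_neg, Pi.neg_apply, sg_apply]
    ring
  have h4 : ∀ t W, pair (D.nabla (lift g B t W) (lift g B s Z)) (lift g B s C) x =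
      2 * σ * flat g ((hD.conn t s).nabla W Z) C x := fun t W => by
    rw [hD.nabla_lift, pair_lift_self]
    simp only [ContMDiffMap.coe_mul, Pi.mul_apply, Fn.ofNat_apply, sg_apply]
    rfl
  have hp' : pair (D.nabla (dorfman H (lift g B s X) (lift g B s Y)) (lift g B s Z))
      (lift g B s C) x = 2 * σ * (flat g ((hD.conn s s).nabla
          ((hD.conn s s).nabla X Y - (hD.conn s s).nabla Y X) Z) C x
        + ∑ m, flat g ((hD.conn s s).nabla (e' m) X) Y x
          * flat g ((hD.conn s s).nabla (e m) Z) C x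
        - ∑ m, flat g ((hD.conn (-s) s).nabla (e' m) X) Y x
          * flat g ((hD.conn (-s) s).nabla (e m) Z) C x) := by
    rw [hp, hW, ← Finset.sum_add_distrib, ← Finset.sum_sub_distrib, ← Finset.sum_sub_distrib,
      Finset.mul_sum, Finset.mul_sum]
    refine Finset.sum_congr rfl fun m _ => ?_
    rw [h2, h3, h4, h4]
    linear_combination 2 * σ * ((flat g ((hD.conn s s).nabla X Y - (hD.conn s s).nabla Y X) (e' m) x
        + flat g ((hD.conn s s).nabla (e' m) X) Y x) * flat g ((hD.conn s s).nabla (e m) Z) C x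
        - flat g ((hD.conn (-s) s).nabla (e' m) X) Y x *
          flat g ((hD.conn (-s) s).nabla (e m) Z) C x) * hσ2
  have h5 : pair (D.nabla (lift g B s X) (D.nabla (lift g B s Y) (lift g B s Z))
      - D.nabla (lift g B s Y) (D.nabla (lift g B s X) (lift g B s Z))) (lift g B s C) x =
      2 * σ * (flat g ((hD.conn s s).nabla X ((hD.conn s s).nabla Y Z)
        - (hD.conn s s).nabla Y ((hD.conn s s).nabla X Z)) C x) := by
    rw [hD.nabla_lift s s Y Z, hD.nabla_lift s s X Z, hD.nabla_lift, hD.nabla_lift, ← map_sub,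
      pair_lift_self]
    simp only [ContMDiffMap.coe_mul, Pi.mul_apply, Fn.ofNat_apply, sg_apply]
    rfl
  have h6 : flat g (pureCurv g (hD.cont s s) X Y Z) C x =
      flat g ((hD.conn s s).nabla X ((hD.conn s s).nabla Y Z)
        - (hD.conn s s).nabla Y ((hD.conn s s).nabla X Z)) C x
      - flat g ((hD.conn s s).nabla ((hD.conn s s).nabla X Y - (hD.conn s s).nabla Y X) Z) C x := by
    have : pureCurv g (hD.cont s s) X Y Z = ((hD.conn s s).nabla X ((hD.conn s s).nabla Y Z)
        - (hD.conn s s).nabla Y ((hD.conn s s).nabla X Z))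
        - (hD.conn s s).nabla ((hD.conn s s).nabla X Y - (hD.conn s s).nabla Y X) Z := by
      simp only [hD.conn_eq, pureCurv]
    rw [this, map_sub (flat g) (_ - _)]
    rfl
  rw [pair_comm, curvOp, pair_sub_left, ContMDiffMap.coe_sub, Pi.sub_apply, h5, hp', h6]
  ring

end CurvatureOfLifts

/-! ### The scalar curvatures -/

section ScalarCurvatures

variable {n : ℕ} {P : Type*} [TopologicalSpace P] [ChartedSpace (EuclideanSpace ℝ (Fin n)) P]
  [IsManifold (𝓡 n) ∞ P] [T2Space P] [SigmaCompactSpace P]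
  {H : Form n P 3} {g : Metric n P} {B : Form n P 2} {D : Conn n P} {φ : Fn n P}

theorem IsLeviCivita.coeffSq_pure (hD : IsLeviCivita H g B D) (s : ℤˣ) (e e' : Fin n → VF n P)
    (x : P) : ∑ k, ∑ l, ∑ m, flat g ((hD.conn s s).nabla (e' m) (e l)) (e' k) x
      * flat g ((hD.conn s s).nabla (e m) (e k)) (e' l) x = coeffSq g (hD.cont s s) e e' x := by
  refine Finset.sum_congr rfl fun k _ => Finset.sum_congr rfl fun l _ =>
    Finset.sum_congr rfl fun m _ => ?_
  rw [mul_comm, hD.conn_eq, hD.conn_eq]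

theorem IsLeviCivita.coeffSq_mixed (hD : IsLeviCivita H g B D) (s : ℤˣ) (e e' : Fin n → VF n P)
    (x : P) : ∑ k, ∑ l, ∑ m, flat g ((hD.conn (-s) s).nabla (e' m) (e l)) (e' k) x
      * flat g ((hD.conn (-s) s).nabla (e m) (e k)) (e' l) x =
      coeffSq g (-hD.sflux s) e e' x := by
  refine Finset.sum_congr rfl fun k _ => Finset.sum_congr rfl fun l _ =>
    Finset.sum_congr rfl fun m _ => ?_
  rw [mul_comm, hD.conn_neg_left, hD.conn_neg_left, sub_eq_add_neg, sub_eq_add_neg]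
  rfl

/-- The trace of the Riemann tensor over `V_s`, in terms of the connection induced on the
tangent bundle. -/
theorem IsLeviCivita.sum_riem_pure (hD : IsLeviCivita H g B D) (s : ℤˣ) {x : P}
    {e e' : Fin n → VF n P} (he : DualAt g x e e') :
    ∑ k, ∑ l, riem H D (lift g B s (e' l)) (lift g B s (e k)) (lift g B s (e l))
      (lift g B s (e' k)) x =
      ((s : ℤ) : ℝ) * (2 * ∑ k, ∑ l, flat g (pureCurv g (hD.cont s s) (e k) (e' l) (e l)) (e' k) x
        - coeffSq g (hD.cont s s) e e' x + coeffSq g (-hD.sflux s) e e' x) := by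
  have h4 : ∀ t W Z C, pair (D.nabla (lift g B t W) (lift g B s Z)) (lift g B s C) x =
      2 * ((s : ℤ) : ℝ) * flat g ((hD.conn t s).nabla W Z) C x := fun t W Z C => by
    rw [hD.nabla_lift, pair_lift_self]
    simp only [ContMDiffMap.coe_mul, Pi.mul_apply, Fn.ofNat_apply, sg_apply]
  have h3 : ∀ k l, ∑ a, pair (D.nabla (frameE x a) (lift g B s (e l))) (lift g B s (e' k)) x
      * pair (D.nabla (coframeE x a) (lift g B s (e k))) (lift g B s (e' l)) x =
      2 * ((s : ℤ) : ℝ) * (∑ m, flat g ((hD.conn s s).nabla (e' m) (e l)) (e' k) x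
          * flat g ((hD.conn s s).nabla (e m) (e k)) (e' l) x
        - ∑ m, flat g ((hD.conn (-s) s).nabla (e' m) (e l)) (e' k) x
          * flat g ((hD.conn (-s) s).nabla (e m) (e k)) (e' l) x) := fun k l => by
    have hT : ∀ Z C, TensorAt n x
        (fun A => pair (D.nabla A (lift g B s Z)) (lift g B s C) x) := fun Z C =>
      ⟨fun _ _ => by rw [D.add_left, pair_add_left]; rfl,
        fun _ _ => by rw [D.smul_left, pair_smul_left]; rfl⟩
    rw [traceE_eq B (T := fun A C => pair (D.nabla A (lift g B s (e l))) (lift g B s (e' k)) x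
      * pair (D.nabla C (lift g B s (e k))) (lift g B s (e' l)) x)
      (fun C => (hT _ _).mul_const _) (fun A => (hT _ _).const_mul _) he.symm he.symm]
    simp only [h4, Finset.mul_sum, mul_sub]
    rcases Int.units_eq_one_or s with rfl | rfl
    · simp only [Units.val_one, Int.cast_one]
      congr 1 <;> exact Finset.sum_congr rfl fun _ _ => by ring
    · simp only [neg_neg, Units.val_neg, Units.val_one, Int.cast_neg, Int.cast_one]
      rw [← Finset.sum_sub_distrib, ← Finset.sum_sub_distrib]
      exact Finset.sum_congr rfl fun _ _ => by ring
  have hC : ∑ k, ∑ l, flat g (pureCurv g (hD.cont s s) (e l) (e' k) (e k)) (e' l) x =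
      ∑ k, ∑ l, flat g (pureCurv g (hD.cont s s) (e k) (e' l) (e l)) (e' k) x := Finset.sum_comm
  have hP := hD.coeffSq_pure s e e' x
  have hQ := hD.coeffSq_mixed s e e' x
  have hP' := hP
  have hQ' := hQ
  rw [Finset.sum_comm] at hP' hQ'
  simp only [riem, h3, curv₀_eq, hD.pair_curvOp_pure s _ _ _ _ he, ← Finset.mul_sum,
    Finset.sum_add_distrib, Finset.sum_sub_distrib, hC, hP, hQ, hP', hQ']
  ring

/-- The trace of the Ricci tensor over `V_s`. -/
theorem IsLeviCivita.sum_ric_pure (hD : IsLeviCivita H g B D) (s : ℤˣ) {x : P}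
    {e e' : Fin n → VF n P} (he : DualAt g x e e') :
    ∑ k, ric H D (lift g B s (e' k)) (lift g B s (e k)) x =
      ∑ k, ∑ l, flat g (pureCurv g (hD.cont s s) (e k) (e' l) (e l)) (e' k) x
        - 1 / 2 * coeffSq g (hD.cont s s) e e' x + 1 / 2 * coeffSq g (-hD.sflux s) e e' x := by
  have h := hD.sum_riem_pure s he
  simp only [ric_eq H D g B he he, ← Finset.mul_sum, Finset.sum_sub_distrib]
  rcases Int.units_eq_one_or s with rfl | rfl
  · simp only [hD.riem_opposite, Finset.sum_const_zero]
    rw [h]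
    simp
    ring
  · have h0 := hD.riem_opposite (-1)
    rw [neg_neg] at h0
    simp only [h0, Finset.sum_const_zero]
    rw [h]
    simp
    ring

theorem IsLeviCivita.sflux_skew (hD : IsLeviCivita H g B D) (s : ℤˣ) (X Y Z : VF n P) :
    flat g (hD.sflux s X Y) Z = -flat g (hD.sflux s X Z) Y := by
  simp only [IsLeviCivita.sflux, LinearMap.smul_apply, map_smul, smul_eq_mul]
  rw [hD.flux_skew, mul_neg]

theorem IsLeviCivita.sflux_cyclic (hD : IsLeviCivita H g B D) (s : ℤˣ) (X Y Z : VF n P) :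
    flat g (hD.sflux s X Y) Z = flat g (hD.sflux s Y Z) X := by
  simp only [IsLeviCivita.sflux, LinearMap.smul_apply, map_smul, smul_eq_mul]
  rw [hD.flux_cyclic]

/-- The traces of the Ricci tensor over the two eigenbundles agree: both equal `β_φ + 2Λ`, written
out in components. -/
theorem IsLeviCivita.sum_ric (hD : IsLeviCivita H g B D) (hX : ∀ f x, charField D f x = 0)
    (hφ : ∀ (Z : VF n P) x, Z.deriv φ x = dilatonForm g D Z x) (s : ℤˣ) {x : P}
    {e e' : Fin n → VF n P} (he : ∀ᶠ y in 𝓝 x, DualAt g y e e') :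
    ∑ k, ric H D (lift g B s (e' k)) (lift g B s (e k)) x =
      ∑ k, ∑ l, flat g (curvLC g (e k) (e' l) (e l)) (e' k) x
      + 4 * ∑ k, hess g φ (e k) (e' k) x - 4 * (sharp g (diff φ)).deriv φ x
      - 1 / 3 * ∑ k, ∑ l, ∑ m, flat g (hD.flux (e k) (e l)) (e m) x
        * flat g (hD.flux (e' k) (e' l)) (e' m) x := by
  have h := scalar_contraction (hD.cont_skew s s) (hD.sflux_skew s) (hD.sflux_cyclic s)
    (fun X Y Z => by
      rw [hD.cont_cyclic s X Y Z]
      simp only [IsLeviCivita.sflux, LinearMap.smul_apply, map_smul, smul_eq_mul])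
    (fun y f f' hf Z => hD.trace_cont hX hφ s y f f' hf Z) he
  have hσ : ((s : ℤ) : ℝ) * ((s : ℤ) : ℝ) = 1 := by
    rcases Int.units_eq_one_or s with rfl | rfl <;> simp
  have h2 : ∀ X Y Z X' Y' Z', flat g (hD.sflux s X Y) Z x * flat g (hD.sflux s X' Y') Z' x =
      flat g (hD.flux X Y) Z x * flat g (hD.flux X' Y') Z' x := fun X Y Z X' Y' Z' => by
    simp only [IsLeviCivita.sflux, LinearMap.smul_apply, map_smul, smul_eq_mul,
      ContMDiffMap.coe_mul, Pi.mul_apply, sg_apply]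
    linear_combination (flat g (hD.flux X Y) Z x * flat g (hD.flux X' Y') Z' x) * hσ
  simp only [h2] at h
  rw [hD.sum_ric_pure s he.self_of_nhds]
  linarith

theorem IsLeviCivita.scalE_eq_zero (hD : IsLeviCivita H g B D)
    (hX : ∀ f x, charField D f x = 0)
    (hφ : ∀ (Z : VF n P) x, Z.deriv φ x = dilatonForm g D Z x) (x : P) : scalE H D x = 0 := by
  have he := dualNear_frame g x
  rw [scalE_eq H D g B he.self_of_nhds he.self_of_nhds, hD.sum_ric hX hφ 1 he,
    hD.sum_ric hX hφ (-1) he, sub_self, mul_zero]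

end ScalarCurvatures

/-! ### The beta functions -/

section BetaFunctions

theorem sum_fin_succ_pi {n p : ℕ} (F : (Fin (p + 1) → Fin n) → ℝ) :
    ∑ i, F i = ∑ k, ∑ i : Fin p → Fin n, F (Fin.cons k i) := by
  rw [← (Fin.consEquiv fun _ => Fin n).sum_comp, Fintype.sum_prod_type]
  rfl

variable {n : ℕ} {P : Type*} [TopologicalSpace P] [ChartedSpace (EuclideanSpace ℝ (Fin n)) P]
  [IsManifold (𝓡 n) ∞ P]

theorem deriv_expNeg (X : VF n P) (φ : Fn n P) (x : P) :
    X.deriv (expNeg φ) x = -2 * expNeg φ x * X.deriv φ x := by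
  have h : HasDerivAt (fun r : ℝ => Real.exp (-2 * r)) (Real.exp (-2 * φ x) * (-2)) (φ x) := by
    simpa using ((hasDerivAt_id (φ x)).const_mul (-2)).exp
  have h1 : mvfderiv (𝓡 n) (expNeg φ) x (X x) =
      fderiv ℝ (fun r : ℝ => Real.exp (-2 * r)) (φ x) (mvfderiv (𝓡 n) φ x (X x)) := by
    change mvfderiv (𝓡 n) ((fun r : ℝ => Real.exp (-2 * r)) ∘ φ) x (X x) = _
    rw [mvfderiv_comp_apply x h.differentiableAt.mdifferentiableAt (φ.mdiffAt x), mvfderiv,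
      mfderiv_eq_fderiv]
    rfl
  rw [VF.deriv_apply, VF.deriv_apply, h1, h.hasFDerivAt.fderiv]
  change mvfderiv (𝓡 n) φ x (X x) * (Real.exp (-2 * φ x) * (-2)) =
    -2 * Real.exp (-2 * φ x) * mvfderiv (𝓡 n) φ x (X x)
  ring

variable [T2Space P] [SigmaCompactSpace P] {H : Form n P 3} {g : Metric n P} {B : Form n P 2}
  {D : Conn n P}

theorem formInner_one (α β : (Fin 1 → VF n P) → Fn n P) (x : P) :
    formInner g α β x = ∑ k, α ![fr x k] x * β ![cofr g x k] x := by
  simp only [formInner, sum_fin_succ_pi, Fintype.sum_unique]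
  simp only [Nat.factorial, Nat.cast_one, mul_one, one_mul, div_one]
  refine Finset.sum_congr rfl fun k _ => ?_
  congr 3
  · funext a; fin_cases a; rfl
  · funext a; fin_cases a; rfl

theorem formInner_two (α β : (Fin 2 → VF n P) → Fn n P) (x : P) :
    formInner g α β x =
      1 / 2 * ∑ k, ∑ l, α ![fr x k, fr x l] x * β ![cofr g x k, cofr g x l] x := by
  simp only [formInner, sum_fin_succ_pi, Fintype.sum_unique]
  congr 1
  refine Finset.sum_congr rfl fun k _ => Finset.sum_congr rfl fun l _ => ?_
  congr 3
  · funext a; fin_cases a <;> rfl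
  · funext a; fin_cases a <;> rfl

theorem formInner_three (α β : (Fin 3 → VF n P) → Fn n P) (x : P) :
    formInner g α β x =
      1 / 6 * ∑ k, ∑ l, ∑ m, α ![fr x k, fr x l, fr x m] x
        * β ![cofr g x k, cofr g x l, cofr g x m] x := by
  simp only [formInner, sum_fin_succ_pi, Fintype.sum_unique]
  congr 1
  refine Finset.sum_congr rfl fun k _ => Finset.sum_congr rfl fun l _ =>
    Finset.sum_congr rfl fun m _ => ?_
  congr 3
  · funext a; fin_cases a <;> rfl
  · funext a; fin_cases a <;> rfl

theorem covForm_dForm (φ : Fn n P) (X Y : VF n P) :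
    covForm g X (dForm φ) ![Y] = hess g φ X Y := by
  simp [covForm, dForm, hess]

theorem laplace_eq (φ : Fn n P) (x : P) :
    laplace g φ x = ∑ k, hess g φ (fr x k) (cofr g x k) x := by
  simp only [laplace, codiff, neg_neg]
  refine Finset.sum_congr rfl fun k _ => ?_
  rw [← covForm_dForm]
  rfl

theorem formInner_dForm (φ : Fn n P) (x : P) :
    formInner g (dForm φ) (dForm φ) x = (sharp g (diff φ)).deriv φ x := by
  rw [formInner_one]
  have h := (dualAt_frame g x).contract (sharp g (diff φ)) (sharp g (diff φ))
  simp only [flat_sharp] at h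
  exact h

theorem scalLC_eq (x : P) : scalLC g x =
    ∑ k, ∑ l, flat g (curvLC g (fr x k) (cofr g x l) (fr x l)) (cofr g x k) x := by
  rw [Finset.sum_comm]
  simp only [scalLC, ricLC_eq]

theorem IsLeviCivita.formInner_intProd (hD : IsLeviCivita H g B D) (X Y : VF n P) (x : P) :
    formInner g (intProd X (fieldStrength H B)) (intProd Y (fieldStrength H B)) x =
      2 * ∑ k, flat g (hD.flux X (fr x k)) (hD.flux Y (cofr g x k)) x := by
  have h : ∀ X Z W, intProd X (fieldStrength H B) ![Z, W] x = 2 * flat g (hD.flux X Z) W x :=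
    fun X Z W => by
      have := congrArg (fun f : Fn n P => f x) (hD.fieldStrength_eq X Z W)
      simp only [ContMDiffMap.coe_mul, Pi.mul_apply, Fn.ofNat_apply] at this
      exact this
  rw [formInner_two, Finset.mul_sum, Finset.mul_sum]
  refine Finset.sum_congr rfl fun k _ => ?_
  rw [← (dualAt_frame g x).contract (hD.flux X (fr x k)), Finset.mul_sum, Finset.mul_sum]
  refine Finset.sum_congr rfl fun l _ => ?_
  rw [h, h]
  ring

theorem IsLeviCivita.formInner_fieldStrength (hD : IsLeviCivita H g B D) (x : P) :
    formInner g (fieldStrength H B) (fieldStrength H B) x =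
      2 / 3 * ∑ k, ∑ l, ∑ m, flat g (hD.flux (fr x k) (fr x l)) (fr x m) x
        * flat g (hD.flux (cofr g x k) (cofr g x l)) (cofr g x m) x := by
  rw [formInner_three]
  simp only [hD.fieldStrength_eq, Finset.mul_sum]
  refine Finset.sum_congr rfl fun k _ => Finset.sum_congr rfl fun l _ =>
    Finset.sum_congr rfl fun m _ => ?_
  simp only [ContMDiffMap.coe_mul, Pi.mul_apply, Fn.ofNat_apply]
  ring

theorem IsLeviCivita.betaG_eq (hD : IsLeviCivita H g B D) (φ : Fn n P) (X Y : VF n P) (x : P) :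
    betaG H g B φ X Y x = ricLC g X Y x + 2 * hess g φ X Y x
      - ∑ k, flat g (hD.flux X (fr x k)) (hD.flux Y (cofr g x k)) x := by
  rw [betaG, hD.formInner_intProd, covForm_dForm, covForm_dForm, hess_comm g φ Y X]
  ring

theorem IsLeviCivita.betaPhi_eq (hD : IsLeviCivita H g B D) (Λ : ℝ) (φ : Fn n P) (x : P) :
    betaPhi H Λ g B φ x =
      ∑ k, ∑ l, flat g (curvLC g (fr x k) (cofr g x l) (fr x l)) (cofr g x k) x
      + 4 * ∑ k, hess g φ (fr x k) (cofr g x k) x - 4 * (sharp g (diff φ)).deriv φ x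
      - 1 / 3 * ∑ k, ∑ l, ∑ m, flat g (hD.flux (fr x k) (fr x l)) (fr x m) x
        * flat g (hD.flux (cofr g x k) (cofr g x l)) (cofr g x m) x - 2 * Λ := by
  rw [betaPhi, scalLC_eq, hD.formInner_fieldStrength, laplace_eq, formInner_dForm]
  ring

theorem IsLeviCivita.flux_swap (hD : IsLeviCivita H g B D) (X Y : VF n P) :
    hD.flux X Y = -hD.flux Y X := flat_ext (g := g) fun Z => by
  rw [map_neg, LinearMap.neg_apply, hD.flux_cyclic, hD.flux_skew]

/-- The covariant derivative of `e^{-2φ} H'`. -/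
theorem IsLeviCivita.covForm_expNeg (hD : IsLeviCivita H g B D) (φ : Fn n P) (A C X Y : VF n P)
    (x : P) :
    covForm g A (fun v => expNeg φ * fieldStrength H B v) (Fin.cons C ![X, Y]) x =
      2 * expNeg φ x * (flat g (lc g A (hD.flux X Y) - hD.flux (lc g A X) Y
        - hD.flux X (lc g A Y)) C x - 2 * A.deriv φ x * flat g (hD.flux X Y) C x) := by
  have e : (Fin.cons C ![X, Y] : Fin 3 → VF n P) = ![C, X, Y] := rfl
  have u0 : ∀ W, Function.update ![C, X, Y] 0 W = ![W, X, Y] := fun W => by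
    ext i : 1; fin_cases i <;> rfl
  have u1 : ∀ W, Function.update ![C, X, Y] 1 W = ![C, W, Y] := fun W => by
    ext i : 1; fin_cases i <;> rfl
  have u2 : ∀ W, Function.update ![C, X, Y] 2 W = ![C, X, W] := fun W => by
    ext i : 1; fin_cases i <;> rfl
  have h := lc_metric g A (hD.flux X Y) C
  have h' := congrArg (fun f : Fn n P => f x) h
  have he := deriv_expNeg A φ x
  have h2 : A.deriv (2 * flat g (hD.flux X Y) C) = 2 * A.deriv (flat g (hD.flux X Y) C) := by
    rw [two_mul, VF.deriv_add, two_mul]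
  rw [e, covForm, Fin.sum_univ_three, u0, u1, u2]
  simp only [Matrix.cons_val_zero, Matrix.cons_val_one, Matrix.cons_val, hD.fieldStrength_eq]
  simp only [hD.flux_cyclic C, hD.flux_cyclic (lc g A C), VF.deriv_mul (f := expNeg φ), h2]
  simp only [ContMDiffMap.coe_sub, ContMDiffMap.coe_add, ContMDiffMap.coe_mul, Pi.sub_apply,
      Pi.add_apply, Pi.mul_apply, Fn.ofNat_apply, map_sub, LinearMap.sub_apply, he] at h' ⊢
  rw [h']
  ring

theorem IsLeviCivita.betaB_eq (hD : IsLeviCivita H g B D) (φ : Fn n P) (X Y : VF n P) (x : P) :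
    betaB H g B φ X Y x = 2 * (hD.flux X Y).deriv φ x
      - ∑ k, flat g (lc g (fr x k) (hD.flux X Y) - hD.flux (lc g (fr x k) X) Y
        - hD.flux X (lc g (fr x k) Y)) (cofr g x k) x := by
  have h1 : (hD.flux X Y).deriv φ x =
      ∑ k, (fr x k).deriv φ x * flat g (hD.flux X Y) (cofr g x k) x := by
    have := (tensorAt_form x (diff φ)).expand (dualAt_frame g x) (hD.flux X Y)
    rw [show (hD.flux X Y).deriv φ x = diff φ (hD.flux X Y) x from rfl, this]
    exact Finset.sum_congr rfl fun k _ => mul_comm _ _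
  have h2 : Real.exp (2 * φ x) * expNeg φ x = 1 := by
    change Real.exp (2 * φ x) * Real.exp (-2 * φ x) = 1
    rw [← Real.exp_add]
    simp
  simp only [betaB, codiff]
  have h3 := fun k => hD.covForm_expNeg φ (fr x k) (cofr g x k) X Y x
  simp only [h3, mul_assoc, ← Finset.mul_sum, Finset.sum_sub_distrib]
  rw [← h1]
  linear_combination (2 * (hD.flux X Y).deriv φ x
      - ∑ k, flat g (lc g (fr x k) (hD.flux X Y) - hD.flux (lc g (fr x k) X) Y
        - hD.flux X (lc g (fr x k) Y)) (cofr g x k) x) * h2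

theorem IsLeviCivita.betaG_comm (hD : IsLeviCivita H g B D) (φ : Fn n P) (X Y : VF n P) (x : P) :
    betaG H g B φ X Y x = betaG H g B φ Y X x := by
  have h := trace_swap (x := x) (T := fun A C => flat g (hD.flux X A) (hD.flux Y C) x)
    (fun C => tensorAt_mid g _ _ _ x)
    (fun A => (tensorAt_form x (flat g (hD.flux X A))).comp (hD.flux Y)) (dualAt_frame g x)
  rw [hD.betaG_eq, hD.betaG_eq, ricLC_comm, hess_comm g φ X Y, h]
  simp only [flat_comm g (hD.flux X _)]

theorem IsLeviCivita.betaB_swap (hD : IsLeviCivita H g B D) (φ : Fn n P) (X Y : VF n P) (x : P) :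
    betaB H g B φ X Y x = -betaB H g B φ Y X x := by
  have h : ∀ A, lc g A (hD.flux X Y) - hD.flux (lc g A X) Y - hD.flux X (lc g A Y) =
      -(lc g A (hD.flux Y X) - hD.flux (lc g A Y) X - hD.flux Y (lc g A X)) := fun A => by
    rw [hD.flux_swap X Y, hD.flux_swap (lc g A X) Y, hD.flux_swap X (lc g A Y), lc_neg_right]
    abel
  rw [hD.betaB_eq, hD.betaB_eq, hD.flux_swap X Y, VF.neg_deriv, ← hD.flux_swap X Y]
  simp only [h, map_neg, LinearMap.neg_apply, ContMDiffMap.coe_neg, Pi.neg_apply,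
    Finset.sum_neg_distrib]
  ring

/-- The mixed Ricci tensor is the difference of the first two beta functions. -/
theorem IsLeviCivita.ric_mixed_eq_beta {φ : Fn n P} (hD : IsLeviCivita H g B D)
    (hX : ∀ f x, charField D f x = 0)
    (hφ : ∀ (Z : VF n P) x, Z.deriv φ x = dilatonForm g D Z x) (X Y : VF n P) (x : P) :
    ric H D (lift g B 1 X) (lift g B (-1) Y) x = betaG H g B φ X Y x - betaB H g B φ X Y x := by
  have he := dualNear_frame g x
  have h1 := fun s => trace_mixedCurv (hD.sflux_skew s) (hD.sflux_cyclic s)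
    (fun y f f' hf Z => hD.trace_cont hX hφ s y f f' hf Z) he
  have s1 : hD.sflux 1 = hD.flux := by rw [IsLeviCivita.sflux, sg_one, one_smul]
  have s2 : hD.sflux (-1) = -hD.flux := by
    rw [IsLeviCivita.sflux, sg_neg, sg_one]
    exact neg_one_smul (Fn n P) hD.flux
  have g1 := hD.betaG_eq φ Y X x
  have g2 := hD.betaG_eq φ X Y x
  have b1 := hD.betaB_eq φ Y X x
  have b2 := hD.betaB_eq φ X Y x
  have hn : ∀ A, lc g A (-hD.flux X Y) - -hD.flux (lc g A X) Y - -hD.flux X (lc g A Y) =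
      -(lc g A (hD.flux X Y) - hD.flux (lc g A X) Y - hD.flux X (lc g A Y)) := fun A => by
    rw [lc_neg_right]
    abel
  rw [hD.ric_mixed, h1, h1, s1, s2, ← ricLC_eq, ← ricLC_eq]
  simp only [LinearMap.neg_apply, hn, map_neg, ContMDiffMap.coe_neg, Pi.neg_apply,
    Finset.sum_neg_distrib, neg_neg, VF.neg_deriv]
  have e1 := hD.betaG_comm φ Y X x
  have e2 := hD.betaB_swap φ Y X x
  linarith

theorem IsLeviCivita.ricciCompatible_iff {φ : Fn n P} (hD : IsLeviCivita H g B D)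
    (hX : ∀ f x, charField D f x = 0)
    (hφ : ∀ (Z : VF n P) x, Z.deriv φ x = dilatonForm g D Z x) :
    RicciCompatible H g B D ↔
      (∀ X Y x, betaG H g B φ X Y x = 0) ∧ (∀ X Y x, betaB H g B φ X Y x = 0) := by
  constructor
  · intro h
    have h1 : ∀ X Y x, betaG H g B φ X Y x - betaB H g B φ X Y x = 0 := fun X Y x => by
      rw [← hD.ric_mixed_eq_beta hX hφ]
      refine h _ _ ?_ ?_ x
      · rw [tau_lift, sg_one, one_smul]
      · rw [tau_lift, sg_neg, sg_one]
        exact neg_one_smul (Fn n P) (lift g B (-1) Y)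
    -- `β_g` is symmetric and `β_B` skew, so adding the transposed equation gives `2β_g = 0`.
    have h2 : ∀ X Y x, betaG H g B φ X Y x = 0 := fun X Y x => by
      have e1 := hD.betaG_comm φ X Y x
      have e2 := hD.betaB_swap φ X Y x
      have e3 := h1 X Y x
      have e4 := h1 Y X x
      linarith
    refine ⟨h2, fun X Y x => ?_⟩
    have e3 := h1 X Y x
    rw [h2] at e3
    linarith
  · rintro ⟨h1, h2⟩ ψ ψ' hψ hψ' x
    rw [eq_lift_of_tau (g := g) (B := B) 1 (ψ := ψ) (by rw [hψ, sg_one, one_smul]),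
      eq_lift_of_tau (g := g) (B := B) (-1) (ψ := ψ') (by
        rw [hψ', sg_neg, sg_one]
        exact (neg_one_smul (Fn n P) ψ').symm),
      hD.ric_mixed_eq_beta hX hφ, h1, h2, sub_zero]

theorem IsLeviCivita.scalG_eq_beta {φ : Fn n P} (hD : IsLeviCivita H g B D)
    (hX : ∀ f x, charField D f x = 0)
    (hφ : ∀ (Z : VF n P) x, Z.deriv φ x = dilatonForm g D Z x) (Λ : ℝ) (x : P) :
    scalG H g B D x = betaPhi H Λ g B φ x + 2 * Λ := by
  have he := dualNear_frame g x
  rw [scalG_eq H D g B he.self_of_nhds he.self_of_nhds, hD.sum_ric hX hφ 1 he,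
    hD.sum_ric hX hφ (-1) he, hD.betaPhi_eq Λ φ x]
  ring

end BetaFunctions

end GenGeom

end

theorem theorem4p1 {n : ℕ} {P : Type*} [TopologicalSpace P]
    [ChartedSpace (EuclideanSpace ℝ (Fin n)) P] [IsManifold (𝓡 n) ∞ P]
    [T2Space P] [SigmaCompactSpace P]
    (H : GenGeom.Form n P 3) (g : GenGeom.Metric n P) (B : GenGeom.Form n P 2)
    (φ : GenGeom.Fn n P) (Λ : ℝ) (D : GenGeom.Conn n P)
    (hD : GenGeom.IsLeviCivita H g B D)
    (hX : ∀ f x, GenGeom.charField D f x = 0)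
    (hφ : ∀ (Z : GenGeom.VF n P) x, Z.deriv φ x = GenGeom.dilatonForm g D Z x) :
    (((∀ X Y x, GenGeom.betaG H g B φ X Y x = 0) ∧ (∀ X Y x, GenGeom.betaB H g B φ X Y x = 0) ∧
        (∀ x, GenGeom.betaPhi H Λ g B φ x = 0)) ↔
      ((∀ x, GenGeom.scalG H g B D x = 2 * Λ) ∧ GenGeom.RicciCompatible H g B D)) ∧
    (GenGeom.RicciCompatible H g B D ↔
      ((∀ X Y x, GenGeom.betaG H g B φ X Y x = 0) ∧
        (∀ X Y x, GenGeom.betaB H g B φ X Y x = 0))) ∧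
    (∀ x, GenGeom.scalE H D x = 0) := by
  have hr := hD.ricciCompatible_iff hX hφ
  have hs : (∀ x, GenGeom.betaPhi H Λ g B φ x = 0) ↔ ∀ x, GenGeom.scalG H g B D x = 2 * Λ :=
    forall_congr' fun x => by rw [hD.scalG_eq_beta hX hφ Λ x, add_eq_right]
  refine ⟨?_, hr, hD.scalE_eq_zero hX hφ⟩
  rw [hr, hs, ← and_assoc, and_comm]
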